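/- Throughout, $\lambda\in\mathbb N$ is the security parameter. A function $f$ of $\lambda$ is negligible if for every $c\in\mathbb N$ we have $|f(\lambda)|<\lambda^{-c}$ for all large $\lambda$. "PPT" means a family, indexed by $\lambda$, of randomized Boolean circuits of size at most polynomial in $\lambda$, and "QPT" means such a family of quantum circuits (over a fixed universal gate set, containing $X$, $H$, $T$, CNOT and Toffoli gates, with ancillas initialized to $|0\rangle$ and standard-basis measurements). Messages, states and keys are classical bit strings. **Two-round OSP.** A two-round oblivious state preparation protocol consists of a PPT algorithm $\mathsf{Sen}(1^\lambda,b)\to(\mathsf{msg}_S,\mathsf{st}_S)$ with $b\in\{0,1\}$, a QPT algorithm $\mathsf{Rec}(\mathsf{msg}_S)\to(|\psi\rangle,\mathsf{msg}_R)$ with $|\psi\rangle$ a one-qubit state, and a PPT algorithm $\mathsf{Dec}(\mathsf{st}_S,\mathsf{msg}_R)\to s\in\{0,1\}$, such that (correctness) for each $b$, in an honest execution, $1-\mathbb E\,\|H^b|s\rangle\langle s|H^b|\psi\rangle\|$ is negligible; and (security) for every QPT adversary that receives $\mathsf{msg}_S$ and outputs $\mathsf{msg}_R$ and a bit, the probabilities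 that this bit is $0$ when the sender's input is $b=0$ and when it is $b=1$ differ by a negligible function. **Two-round differentiated-bit CSG.** A two-round differentiated-bit claw-state generator with indistinguishability security (for claws of length $n=1$) consists of a PPT algorithm $\mathsf{Sen}(1^\lambda)\to(\mathsf{msg}_S,\mathsf{st}_S)$, a QPT algorithm $\mathsf{Rec}(\mathsf{msg}_S)\to(|\psi\rangle,\mathsf{msg}_R)$ with $|\psi\rangle$ a two-qubit state, and a PPT algorithm $\mathsf{Dec}(\mathsf{st}_S,\mathsf{msg}_R)\to(x_0,x_1,z)\in\{0,1\}^3$, such that (correctness) in an honest execution $1-\mathbb E\,\big\||\phi\rangle\langle\phi|\psi\rangle\big\|$ is negligible, where $|\phi\rangle=\frac1{\sqrt2}\big(|0,x_0\rangle+(-1)^z|1,x_1\rangle\big)$ (and $x_0=x_1$ is allowed); and (indistinguishability security) every QPT adversary that receives $\mathsf{msg}_S$ and outputs $\mathsf{msg}_R$ and a bit outputs the bit $x_0\oplus x_1$ with probability negligibly close to $\frac12$, where $(x_0,x_1,z)\gets\mathsf{Dec}(\mathsf{st}_S,\mathsf{msg}_R)$. **CPA-secure PKE.** A CPA-secure public-key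 (bit) encryption scheme with classical key generator and quantum encryptor consists of PPT $\mathsf{KeyGen}(1^\lambda)\to(\mathsf{pk},\mathsf{sk})$, QPT $\mathsf{Enc}(\mathsf{pk},m)\to\mathsf{ct}$ for $m\in\{0,1\}$, and PPT $\mathsf{Dec}(\mathsf{sk},\mathsf{ct})\to m$, with classical keys and ciphertexts, such that for each $m$ the probability that decrypting an honest encryption of $m$ gives $m$ is $1$ up to a negligible function, and for every QPT adversary the probabilities that it outputs $0$ on $(\mathsf{pk},\mathsf{Enc}(\mathsf{pk},0))$ and on $(\mathsf{pk},\mathsf{Enc}(\mathsf{pk},1))$ differ by a negligible function. **The scheme.** Given a two-round differentiated-bit CSG with $n=1$, $\mathsf{KeyGen}(1^\lambda)$ runs $\mathsf{CSG.Sen}(1^\lambda)$ and outputs $\mathsf{pk}=\mathsf{msg}_S$, $\mathsf{sk}=\mathsf{st}_S$. $\mathsf{Enc}(\mathsf{pk},m)$ runs $(|\psi\rangle,\mathsf{msg}_R)\gets\mathsf{CSG.Rec}(\mathsf{msg}_S)$, measures $|\psi\rangle$ in the standard basis to obtain $(b,x_b)$, and outputs $(\mathsf{msg}_R,b,m\oplus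 x_b)$. $\mathsf{Dec}(\mathsf{sk},(\mathsf{msg}_R,b,m'))$ runs $(x_0,x_1,z)\gets\mathsf{CSG.Dec}(\mathsf{st}_S,\mathsf{msg}_R)$ and outputs $m'\oplus x_b$. **Theorem.** 1. For every two-round differentiated-bit CSG with $n=1$ and indistinguishability security, the scheme above is a CPA-secure public-key encryption scheme with classical key generator and quantum encryptor. 2. Predicting $x_b$ reduces to predicting $x_0\oplus x_1$: let a two-round differentiated-bit CSG with $n=1$ be given whose algorithms are efficient and correct as above (no security is assumed). For every QPT $A$ there is a QPT adversary $B$ against the indistinguishability security such that $$\Big(\Pr[B\text{ outputs }x_0\oplus x_1]-\tfrac12\Big)-\tfrac12\Big(\Pr[A(\mathsf{msg}_S,\mathsf{msg}_R,b)=x_b]-\tfrac12\Big)$$ is negligible, where on the right $(\mathsf{msg}_S,\mathsf{msg}_R,x_0,x_1)$ comes from an honest execution and $b\in\{0,1\}$ is uniform and independent of it. 3. For every two-round OSP there exists a two-round differentiated-bit CSG with $n=1$ and indistinguishability security for which the scheme above is a CPA-secure public-key encryption scheme. In particular, two-round OSP implies CPA-secure public-key encryption with classical key generator and decryptor, quantum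 encryptor, and classical keys and ciphertexts. -/

import Mathlib

open scoped BigOperators

noncomputable section

namespace OSPPKE

/-! ## Asymptotics -/

/-- Negligible functions of the security parameter. -/
def Negligible (f : ℕ → ℝ) : Prop :=
  ∀ c : ℕ, ∃ N : ℕ, ∀ n : ℕ, N < n → |f n| < ((n : ℝ) ^ c)⁻¹

/-- Polynomially bounded functions of the security parameter. -/
def PolyBounded (s : ℕ → ℕ) : Prop :=
  ∃ c N : ℕ, ∀ n : ℕ, N < n → s n < n ^ c

/-- Indicator of an event; probabilities are expectations of indicators. -/
def ind (p : Prop) [Decidable p] : ℝ := if p then 1 else 0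

/-! ## Registers

A register is a finite type `W` of wires; its classical contents are the bit strings `W → Bool`.
The concatenation of two registers is their disjoint sum. -/

/-- Bit strings on a register. -/
abbrev Bits (W : Type) : Type := W → Bool

/-! ## Randomized classical circuits -/

/-- A Boolean gate: a binary operation, two wires that are read and one that is assigned. -/
structure BoolGate (W : Type) where
  op : Bool → Bool → Bool
  src₁ : W
  src₂ : W
  tgt : W

/-- Assign the value of the gate to its target wire. -/
def BoolGate.apply {W : Type} [DecidableEq W] (g : BoolGate W) (x : Bits W) : Bits W :=
  Function.update x g.tgt (g.op (x g.src₁) (x g.src₂))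

/-- Relabel the wires of a gate. -/
def BoolGate.map {W W' : Type} (e : W → W') (g : BoolGate W) : BoolGate W' :=
  ⟨g.op, e g.src₁, e g.src₂, e g.tgt⟩

/-- A randomized Boolean circuit with input register `I` and output register `O`: a straight-line
sequence of Boolean gates on the input wires, the wires `Rnd` that hold uniformly random bits and
the wires `Aux` that hold zeros; each output bit is read off from a wire. -/
structure RandCircuit (I O : Type) where
  Rnd : Type
  Aux : Type
  [fintypeRnd : Fintype Rnd]
  [decEqRnd : DecidableEq Rnd]
  [fintypeAux : Fintype Aux]
  [decEqAux : DecidableEq Aux]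
  gates : List (BoolGate (I ⊕ (Rnd ⊕ Aux)))
  out : O → I ⊕ (Rnd ⊕ Aux)

attribute [instance] RandCircuit.fintypeRnd RandCircuit.decEqRnd RandCircuit.fintypeAux
  RandCircuit.decEqAux

namespace RandCircuit

/-- Number of gates and wires. -/
def size {I O : Type} [Fintype I] [Fintype O] (C : RandCircuit I O) : ℕ :=
  C.gates.length + Fintype.card I + Fintype.card C.Rnd + Fintype.card C.Aux + Fintype.card O

/-- The output on input `x` and random bits `r`. -/
def eval {I O : Type} [DecidableEq I] (C : RandCircuit I O) (x : Bits I) (r : Bits C.Rnd) : Bits O :=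
  fun o => C.gates.foldl (fun s g => g.apply s) (Sum.elim x (Sum.elim r (fun _ => false)))
    (C.out o)

/-- The expectation of `f` at the output on input `x`, over uniform random bits. -/
def expect {I O : Type} [DecidableEq I] (C : RandCircuit I O) (x : Bits I) (f : Bits O → ℝ) : ℝ :=
  (∑ r : Bits C.Rnd, f (C.eval x r)) / 2 ^ Fintype.card C.Rnd

end RandCircuit

/-! ## Quantum circuits -/

/-- The gate set: `X`, Hadamard, `T`, controlled-not and Toffoli. -/
inductive QGate (W : Type) where
  | x (i : W) : QGate W
  | h (i : W) : QGate W
  | t (i : W) : QGate W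
  | cnot (c i : W) (hci : c ≠ i) : QGate W
  | toffoli (a b i : W) (hab : a ≠ b) (hai : a ≠ i) (hbi : b ≠ i) : QGate W

namespace QGate

/-- The action of a gate on a vector given by its amplitudes in the standard basis. -/
def apply {W : Type} [DecidableEq W] : QGate W → (Bits W → ℂ) → (Bits W → ℂ)
  | x i, ψ => fun w => ψ (Function.update w i (!(w i)))
  | h i, ψ => fun w => ((Real.sqrt 2 : ℝ) : ℂ)⁻¹ *
      (ψ (Function.update w i false) +
        (if w i then -1 else 1) * ψ (Function.update w i true))
  | t i, ψ => fun w => (if w i then Complex.exp (Complex.I * (Real.pi / 4 : ℝ)) else 1) * ψ w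
  | cnot c i _, ψ => fun w => ψ (Function.update w i (xor (w i) (w c)))
  | toffoli a b i _ _ _, ψ => fun w => ψ (Function.update w i (xor (w i) (w a && w b)))

/-- Relabel the wires of a gate. -/
def map {W W' : Type} (e : W ↪ W') : QGate W → QGate W'
  | x i => x (e i)
  | h i => h (e i)
  | t i => t (e i)
  | cnot c i hci => cnot (e c) (e i) (e.injective.ne hci)
  | toffoli a b i hab hai hbi =>
      toffoli (e a) (e b) (e i) (e.injective.ne hab) (e.injective.ne hai) (e.injective.ne hbi)

end QGate

/-- A quantum circuit with classical input register `I` and output register `O`: a sequence of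
gates on the input qubits and ancilla qubits initialized to `|0⟩`. At the end the qubits are split
into the output register and the discarded qubits `Garb`. -/
structure QCircuit (I O : Type) where
  Aux : Type
  Garb : Type
  [fintypeAux : Fintype Aux]
  [decEqAux : DecidableEq Aux]
  [fintypeGarb : Fintype Garb]
  [decEqGarb : DecidableEq Garb]
  gates : List (QGate (I ⊕ Aux))
  out : I ⊕ Aux ≃ O ⊕ Garb

attribute [instance] QCircuit.fintypeAux QCircuit.decEqAux QCircuit.fintypeGarb
  QCircuit.decEqGarb

namespace QCircuit

/-- Number of gates and qubits. -/
def size {I O : Type} [Fintype I] (C : QCircuit I O) : ℕ :=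
  C.gates.length + Fintype.card I + Fintype.card C.Aux

/-- The final amplitudes on input `|x⟩|0…0⟩`. -/
def final {I O : Type} [DecidableEq I] [Fintype I] (C : QCircuit I O) (x : Bits I) :
    Bits (I ⊕ C.Aux) → ℂ :=
  C.gates.foldl (fun ψ g => g.apply ψ)
    (fun w => if w = Sum.elim x (fun _ => false) then 1 else 0)

/-- The final amplitude of `|y⟩` on the output register and `|g⟩` on the discarded qubits. -/
def amp {I O : Type} [DecidableEq I] [Fintype I] (C : QCircuit I O) (x : Bits I)
    (y : Bits O) (g : Bits C.Garb) : ℂ :=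
  C.final x (fun w => Sum.elim y g (C.out w))

/-- The expectation of `f` at the result of measuring the output register in the standard basis,
on the classical input `x`. -/
def expect {I O : Type} [DecidableEq I] [Fintype I] [Fintype O] [DecidableEq O]
    (C : QCircuit I O) (x : Bits I) (f : Bits O → ℝ) : ℝ :=
  ∑ y : Bits O, ∑ g : Bits C.Garb, ‖C.amp x y g‖ ^ 2 * f y

/-- For an output register that consists of `Q` and `M`: the unnormalized state on `Q` when
measuring `M` gives `m` and measuring the discarded qubits gives `g`. -/
def branch {I Q M : Type} [DecidableEq I] [Fintype I] [Fintype Q] [DecidableEq Q]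
    (C : QCircuit I (Q ⊕ M)) (x : Bits I) (m : Bits M) (g : Bits C.Garb) :
    EuclideanSpace ℂ (Bits Q) :=
  WithLp.toLp 2 (fun q => C.amp x (Sum.elim q m) g)

/-- The expectation of `F |ψ⟩ m`, where `m` is the result of measuring the register `M` and `|ψ⟩`
is the resulting (normalized) state of the register `Q`. Discarding a qubit is measuring it and
forgetting the result, so `|ψ⟩` is pure. -/
def expectState {I Q M : Type} [DecidableEq I] [Fintype I] [Fintype Q] [DecidableEq Q]
    [Fintype M] [DecidableEq M] (C : QCircuit I (Q ⊕ M)) (x : Bits I)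
    (F : EuclideanSpace ℂ (Bits Q) → Bits M → ℝ) : ℝ :=
  ∑ m : Bits M, ∑ g : Bits C.Garb,
    ‖C.branch x m g‖ ^ 2 * F (((‖C.branch x m g‖⁻¹ : ℝ) : ℂ) • C.branch x m g) m

end QCircuit

/-! ## Efficiency of circuit families -/

/-- Probabilistic polynomial time: polynomial-size randomized classical circuits. -/
def PPT {I O : ℕ → Type} [∀ l, Fintype (I l)] [∀ l, Fintype (O l)]
    (C : ∀ l, RandCircuit (I l) (O l)) : Prop :=
  PolyBounded (fun l => (C l).size)

/-- Quantum polynomial time: polynomial-size quantum circuits. -/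
def QPT {I O : ℕ → Type} [∀ l, Fintype (I l)] (C : ∀ l, QCircuit (I l) (O l)) : Prop :=
  PolyBounded (fun l => (C l).size)

/-! ## States and projections -/

/-- The standard basis vector `|x⟩`. -/
def ket {Q : Type} [Fintype Q] [DecidableEq Q] (x : Bits Q) : EuclideanSpace ℂ (Bits Q) :=
  EuclideanSpace.single x 1

/-- The sign `(-1)^z`. -/
def sgn (z : Bool) : ℂ := if z then -1 else 1

/-- The norm of `|v⟩⟨v|ψ⟩`. -/
def projNorm {Q : Type} [Fintype Q] [DecidableEq Q] (v ψ : EuclideanSpace ℂ (Bits Q)) : ℝ :=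
  ‖(inner ℂ v ψ : ℂ) • v‖

/-- The one-qubit state `H^b|s⟩`. -/
def ospState (b s : Bool) : EuclideanSpace ℂ (Bits Unit) :=
  if b then ((Real.sqrt 2 : ℝ) : ℂ)⁻¹ • (ket (fun _ => false) + sgn s • ket (fun _ => true))
  else ket (fun _ => s)

/-- The state `(|0,x₀⟩ + (-1)^z |1,x₁⟩)/√2`. -/
def clawState {n : ℕ} (x₀ x₁ : Bits (Fin n)) (z : Bool) :
    EuclideanSpace ℂ (Bits (Unit ⊕ Fin n)) :=
  ((Real.sqrt 2 : ℝ) : ℂ)⁻¹ •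
    (ket (Sum.elim (fun _ => false) x₀) + sgn z • ket (Sum.elim (fun _ => true) x₁))

/-! ## Two-round oblivious state preparation -/

/-- The algorithms of a two-round OSP, at every value `l` of the security parameter. -/
structure TwoRoundOSP where
  MsgS : ℕ → Type
  St : ℕ → Type
  MsgR : ℕ → Type
  [fintypeMsgS : ∀ l, Fintype (MsgS l)]
  [decEqMsgS : ∀ l, DecidableEq (MsgS l)]
  [fintypeSt : ∀ l, Fintype (St l)]
  [decEqSt : ∀ l, DecidableEq (St l)]
  [fintypeMsgR : ∀ l, Fintype (MsgR l)]
  [decEqMsgR : ∀ l, DecidableEq (MsgR l)]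
  Sen : ∀ l, RandCircuit Unit (MsgS l ⊕ St l)
  Rec : ∀ l, QCircuit (MsgS l) (Unit ⊕ MsgR l)
  Dec : ∀ l, RandCircuit (St l ⊕ MsgR l) Unit

attribute [instance] TwoRoundOSP.fintypeMsgS TwoRoundOSP.decEqMsgS TwoRoundOSP.fintypeSt
  TwoRoundOSP.decEqSt TwoRoundOSP.fintypeMsgR TwoRoundOSP.decEqMsgR

namespace TwoRoundOSP

/-- The sender's algorithms are PPT and the receiver is QPT. -/
def Efficient (P : TwoRoundOSP) : Prop := PPT P.Sen ∧ QPT P.Rec ∧ PPT P.Dec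

/-- `E ‖Π_{OSP,b} |s⟩|ψ⟩‖` in an honest execution with input `b`. -/
def fidelity (P : TwoRoundOSP) (l : ℕ) (b : Bool) : ℝ :=
  (P.Sen l).expect (fun _ => b) fun y =>
    (P.Rec l).expectState (y ∘ Sum.inl) fun ψ msgR =>
      (P.Dec l).expect (Sum.elim (y ∘ Sum.inr) msgR) fun s =>
        projNorm (ospState b (s ())) ψ

/-- Correctness with negligible error. -/
def Correct (P : TwoRoundOSP) : Prop := ∀ b : Bool, Negligible (fun l => 1 - P.fidelity l b)

/-- The probability that the adversary, which receives the sender's message and produces the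
receiver's message together with a bit, outputs the bit 0 when the sender's input is `b`. -/
def advProb (P : TwoRoundOSP) (A : ∀ l, QCircuit (P.MsgS l) (P.MsgR l ⊕ Unit)) (l : ℕ)
    (b : Bool) : ℝ :=
  (P.Sen l).expect (fun _ => b) fun y =>
    (A l).expect (y ∘ Sum.inl) fun a =>
      ind (a (Sum.inr ()) = false)

/-- No QPT adversary learns the sender's input. -/
def Secure (P : TwoRoundOSP) : Prop :=
  ∀ A : ∀ l, QCircuit (P.MsgS l) (P.MsgR l ⊕ Unit), QPT A →
    Negligible (fun l => |P.advProb A l false - P.advProb A l true|)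

end TwoRoundOSP

/-! ## Two-round claw-state generators -/

/-- The algorithms of a two-round claw-state generator for claws of length `n l` whose receiver
obtains a state of one qubit (the differentiating bit) and `n l` further qubits. -/
structure TwoRoundCSG (n : ℕ → ℕ) where
  MsgS : ℕ → Type
  St : ℕ → Type
  MsgR : ℕ → Type
  [fintypeMsgS : ∀ l, Fintype (MsgS l)]
  [decEqMsgS : ∀ l, DecidableEq (MsgS l)]
  [fintypeSt : ∀ l, Fintype (St l)]
  [decEqSt : ∀ l, DecidableEq (St l)]
  [fintypeMsgR : ∀ l, Fintype (MsgR l)]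
  [decEqMsgR : ∀ l, DecidableEq (MsgR l)]
  Sen : ∀ l, RandCircuit Empty (MsgS l ⊕ St l)
  Rec : ∀ l, QCircuit (MsgS l) ((Unit ⊕ Fin (n l)) ⊕ MsgR l)
  Dec : ∀ l, RandCircuit (St l ⊕ MsgR l) (Fin (n l) ⊕ (Fin (n l) ⊕ Unit))

attribute [instance] TwoRoundCSG.fintypeMsgS TwoRoundCSG.decEqMsgS TwoRoundCSG.fintypeSt
  TwoRoundCSG.decEqSt TwoRoundCSG.fintypeMsgR TwoRoundCSG.decEqMsgR

/-- The string `x₀` in the sender's output `(x₀, x₁, z)`. -/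
def clawX₀ {n : ℕ} (d : Bits (Fin n ⊕ (Fin n ⊕ Unit))) : Bits (Fin n) := fun i => d (Sum.inl i)

/-- The string `x₁` in the sender's output `(x₀, x₁, z)`. -/
def clawX₁ {n : ℕ} (d : Bits (Fin n ⊕ (Fin n ⊕ Unit))) : Bits (Fin n) :=
  fun i => d (Sum.inr (Sum.inl i))

/-- The bit `z` in the sender's output `(x₀, x₁, z)`. -/
def clawZ {n : ℕ} (d : Bits (Fin n ⊕ (Fin n ⊕ Unit))) : Bool := d (Sum.inr (Sum.inr ()))

namespace TwoRoundCSG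

variable {n : ℕ → ℕ}

/-- The sender's algorithms are PPT and the receiver is QPT. -/
def Efficient (P : TwoRoundCSG n) : Prop := PPT P.Sen ∧ QPT P.Rec ∧ PPT P.Dec

/-- `E ‖Π |x₀,x₁,z⟩|ψ⟩‖` in an honest execution, where `Π` projects, for every `(x₀,x₁,z)`, onto
the differentiated-bit claw state of `(x₀,x₁,z)`. The strings `x₀` and `x₁` may coincide. -/
def fidelity (P : TwoRoundCSG n) (l : ℕ) : ℝ :=
  (P.Sen l).expect Empty.elim fun y =>
    (P.Rec l).expectState (y ∘ Sum.inl) fun ψ msgR =>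
      (P.Dec l).expect (Sum.elim (y ∘ Sum.inr) msgR) fun d =>
        projNorm (clawState (clawX₀ d) (clawX₁ d) (clawZ d)) ψ

/-- Differentiated-bit correctness with negligible error. -/
def Correct (P : TwoRoundCSG n) : Prop := Negligible (fun l => 1 - P.fidelity l)

/-- The probability that the adversary, which receives the sender's message and produces the
receiver's message together with a bit, outputs the bit `x_{0,i} ⊕ x_{1,i}`. -/
def advProb (P : TwoRoundCSG n) (A : ∀ l, QCircuit (P.MsgS l) (P.MsgR l ⊕ Unit)) (l : ℕ)
    (i : Fin (n l)) : ℝ :=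
  (P.Sen l).expect Empty.elim fun y =>
    (A l).expect (y ∘ Sum.inl) fun a =>
      (P.Dec l).expect (Sum.elim (y ∘ Sum.inr) (a ∘ Sum.inl)) fun d =>
        ind (a (Sum.inr ()) = xor (clawX₀ d i) (clawX₁ d i))

/-- Indistinguishability security. -/
def IndSecure (P : TwoRoundCSG n) : Prop :=
  ∀ A : ∀ l, QCircuit (P.MsgS l) (P.MsgR l ⊕ Unit), QPT A → ∀ i : ∀ l, Fin (n l),
    Negligible (fun l => |P.advProb A l (i l) - 1 / 2|)

/-- The probability that `A`, given the two messages of an honest execution with claws of length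
one and a uniformly random bit `b`, outputs `x_b`. -/
def predictProb (P : TwoRoundCSG (fun _ => 1))
    (A : ∀ l, QCircuit (P.MsgS l ⊕ (P.MsgR l ⊕ Unit)) Unit) (l : ℕ) : ℝ :=
  (P.Sen l).expect Empty.elim fun y =>
    (P.Rec l).expectState (y ∘ Sum.inl) fun _ msgR =>
      (P.Dec l).expect (Sum.elim (y ∘ Sum.inr) msgR) fun d =>
        (∑ b : Bool,
          (A l).expect (Sum.elim (y ∘ Sum.inl) (Sum.elim msgR (fun _ => b))) fun a =>
            ind (a () = if b then clawX₁ d 0 else clawX₀ d 0)) / 2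

end TwoRoundCSG

/-! ## Public-key encryption with a quantum encryptor -/

/-- The algorithms of a public-key bit encryption scheme with classical key generator and
decryptor, quantum encryptor, and classical keys and ciphertexts. -/
structure PKE where
  PK : ℕ → Type
  SK : ℕ → Type
  CT : ℕ → Type
  [fintypePK : ∀ l, Fintype (PK l)]
  [decEqPK : ∀ l, DecidableEq (PK l)]
  [fintypeSK : ∀ l, Fintype (SK l)]
  [decEqSK : ∀ l, DecidableEq (SK l)]
  [fintypeCT : ∀ l, Fintype (CT l)]
  [decEqCT : ∀ l, DecidableEq (CT l)]
  KeyGen : ∀ l, RandCircuit Empty (PK l ⊕ SK l)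
  Enc : ∀ l, QCircuit (PK l ⊕ Unit) (CT l)
  Dec : ∀ l, RandCircuit (SK l ⊕ CT l) Unit

attribute [instance] PKE.fintypePK PKE.decEqPK PKE.fintypeSK PKE.decEqSK PKE.fintypeCT
  PKE.decEqCT

namespace PKE

/-- Key generation and decryption are PPT and encryption is QPT. -/
def Efficient (E : PKE) : Prop := PPT E.KeyGen ∧ QPT E.Enc ∧ PPT E.Dec

/-- The probability that an encryption of `m` is decrypted to `m`. -/
def decProb (E : PKE) (l : ℕ) (m : Bool) : ℝ :=
  (E.KeyGen l).expect Empty.elim fun k =>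
    (E.Enc l).expect (Sum.elim (k ∘ Sum.inl) (fun _ => m)) fun ct =>
      (E.Dec l).expect (Sum.elim (k ∘ Sum.inr) ct) fun m' => ind (m' () = m)

/-- Correctness with negligible error. -/
def Correct (E : PKE) : Prop := ∀ m : Bool, Negligible (fun l => 1 - E.decProb l m)

/-- The probability that the adversary outputs 0 on the public key and an encryption of `m`. -/
def advProb (E : PKE) (A : ∀ l, QCircuit (E.PK l ⊕ E.CT l) Unit) (l : ℕ) (m : Bool) : ℝ :=
  (E.KeyGen l).expect Empty.elim fun k =>
    (E.Enc l).expect (Sum.elim (k ∘ Sum.inl) (fun _ => m)) fun ct =>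
      (A l).expect (Sum.elim (k ∘ Sum.inl) ct) fun a => ind (a () = false)

/-- CPA security against QPT adversaries. -/
def Secure (E : PKE) : Prop :=
  ∀ A : ∀ l, QCircuit (E.PK l ⊕ E.CT l) Unit, QPT A →
    Negligible (fun l => |E.advProb A l false - E.advProb A l true|)

/-- CPA-secure public-key encryption with classical key generator and quantum encryptor. -/
def IsCPASecurePKE (E : PKE) : Prop := E.Efficient ∧ E.Correct ∧ E.Secure

end PKE

/-! ## The encryption scheme obtained from a two-round claw-state generator -/

section Scheme

variable {S T R : Type}

/-- The qubits of the receiver among the qubits of the encryptor. -/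
def encEmb (A : Type) : S ⊕ A ↪ (S ⊕ Unit) ⊕ A where
  toFun := Sum.map Sum.inl id
  inj' := Sum.map_injective.2 ⟨Sum.inl_injective, Function.injective_id⟩

/-- The ciphertext consists of the receiver's message, the differentiating bit and the message
qubit; the qubit that held `x_b` is discarded. -/
def encOut {A G : Type} (e : S ⊕ A ≃ ((Unit ⊕ Fin 1) ⊕ R) ⊕ G) :
    (S ⊕ Unit) ⊕ A ≃ (R ⊕ (Unit ⊕ Unit)) ⊕ (Fin 1 ⊕ G) :=
  ((Equiv.sumAssoc S Unit A).trans
    ((Equiv.sumCongr (Equiv.refl S) (Equiv.sumComm Unit A)).trans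
      ((Equiv.sumAssoc S A Unit).symm.trans (Equiv.sumCongr e (Equiv.refl Unit))))).trans
  { toFun := fun w => match w with
      | Sum.inl (Sum.inl (Sum.inl (Sum.inl u))) => Sum.inl (Sum.inr (Sum.inl u))
      | Sum.inl (Sum.inl (Sum.inl (Sum.inr i))) => Sum.inr (Sum.inl i)
      | Sum.inl (Sum.inl (Sum.inr r)) => Sum.inl (Sum.inl r)
      | Sum.inl (Sum.inr g) => Sum.inr (Sum.inr g)
      | Sum.inr u => Sum.inl (Sum.inr (Sum.inr u))
    invFun := fun w => match w with
      | Sum.inl (Sum.inr (Sum.inl u)) => Sum.inl (Sum.inl (Sum.inl (Sum.inl u)))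
      | Sum.inr (Sum.inl i) => Sum.inl (Sum.inl (Sum.inl (Sum.inr i)))
      | Sum.inl (Sum.inl r) => Sum.inl (Sum.inl (Sum.inr r))
      | Sum.inr (Sum.inr g) => Sum.inl (Sum.inr g)
      | Sum.inl (Sum.inr (Sum.inr u)) => Sum.inr u
    left_inv := by rintro ((((_ | _) | _) | _) | _) <;> rfl
    right_inv := by rintro ((_ | (_ | _)) | (_ | _)) <;> rfl }

/-- Encryption of the bit `m`: run the receiver, add the qubit that holds `x_b` to the qubit that
holds `m`, and measure the receiver's message, the differentiating bit and the message qubit. The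
result is `(msg_R, b, m ⊕ x_b)`, where `(b, x_b)` is the result of measuring the receiver's state
in the standard basis. -/
abbrev encCircuit (C : QCircuit S ((Unit ⊕ Fin 1) ⊕ R)) :
    QCircuit (S ⊕ Unit) (R ⊕ (Unit ⊕ Unit)) where
  Aux := C.Aux
  Garb := Fin 1 ⊕ C.Garb
  gates := C.gates.map (QGate.map (encEmb C.Aux)) ++
    [QGate.cnot (encEmb C.Aux (C.out.symm (Sum.inl (Sum.inl (Sum.inr 0)))))
      (Sum.inl (Sum.inr ())) (by
        rcases C.out.symm (Sum.inl (Sum.inl (Sum.inr 0))) with s | a <;> simp [encEmb])]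
  out := encOut C.out

/-- The wires of the decoder among the wires of the decryptor. -/
def decEmb (D A : Type) :
    (T ⊕ R) ⊕ (D ⊕ A) → (T ⊕ (R ⊕ (Unit ⊕ Unit))) ⊕ (D ⊕ (A ⊕ Unit)) :=
  Sum.map (Sum.map id Sum.inl) (Sum.map id Sum.inl)

/-- Decryption of `(msg_R, b, m')`: run the decoder to get `(x₀, x₁, z)` and output `m' ⊕ x_b`,
computed on a fresh wire as `((x₀ ⊕ x₁) ∧ b) ⊕ x₀ ⊕ m'`. -/
abbrev decCircuit (C : RandCircuit (T ⊕ R) (Fin 1 ⊕ (Fin 1 ⊕ Unit))) :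
    RandCircuit (T ⊕ (R ⊕ (Unit ⊕ Unit))) Unit where
  Rnd := C.Rnd
  Aux := C.Aux ⊕ Unit
  gates :=
    let w₀ := decEmb C.Rnd C.Aux (C.out (Sum.inl 0))
    let w₁ := decEmb C.Rnd C.Aux (C.out (Sum.inr (Sum.inl 0)))
    let wb := Sum.inl (Sum.inr (Sum.inr (Sum.inl ())))
    let wm := Sum.inl (Sum.inr (Sum.inr (Sum.inr ())))
    let wt := Sum.inr (Sum.inr (Sum.inr ()))
    C.gates.map (BoolGate.map (decEmb C.Rnd C.Aux)) ++
      [⟨xor, w₀, w₁, wt⟩, ⟨and, wt, wb, wt⟩, ⟨xor, wt, w₀, wt⟩, ⟨xor, wt, wm, wt⟩]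
  out := fun _ => Sum.inr (Sum.inr (Sum.inr ()))

/-- The encryption scheme: the public key is the sender's message, the secret key is the sender's
state. -/
abbrev pkeOfCSG (P : TwoRoundCSG (fun _ => 1)) : PKE where
  PK := P.MsgS
  SK := P.St
  CT := fun l => P.MsgR l ⊕ (Unit ⊕ Unit)
  KeyGen := P.Sen
  Enc := fun l => encCircuit (P.Rec l)
  Dec := fun l => decCircuit (P.Dec l)

end Scheme

end OSPPKE

end

noncomputable section

namespace OSPPKE

/-! ## Negligible and polynomially bounded functions -/

/-! Everything about the encryption scheme rests on one replacement: in an honest execution,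
measuring the receiver's state in the standard basis may be treated as measuring the ideal claw
state, which yields `(b, x_b)` with `b` uniform. For every `[0,1]`-valued test this costs a
negligible error (`negligible_honest_sub`). Correctness is then immediate, since `m ⊕ x_b ⊕ x_b =
m`.

For the reduction, an adversary runs the receiver honestly, measures `(b, x_b)`, asks the given
predictor for `x_{1-b}` and adds the two bits. Since `1 - b` is again uniform, this guesses `x₀ ⊕
x₁` exactly as well as the predictor guesses, up to the replacement error. The theorem asks for half
that advantage, so the guess is deliberately flipped with probability 1/4
(`negligible_advProb_xorAdversary`). For CPA security, a distinguisher run on a random last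
ciphertext bit `c` becomes a predictor of `x_b`: its answer is a guess of the message, and the
message is `c ⊕ x_b` (`negligible_advProb_sub`). Chaining the two gives security
(`secure_pkeOfCSG`).

To build a claw-state generator from an OSP, the sender runs the OSP on a random bit `b` and on its
negation. The receiver holds approximately `H^b|s₁⟩` and `H^(1-b)|s₂⟩`, applies a Hadamard to each
and a controlled-not from the second to the first. For `b = 0` the second qubit is the constant
`s₂`, so `x₀ = x₁`; for `b = 1` the sum of the qubits is the constant `s₁`, so `x₀ ≠ x₁`. Thus `x₀ ⊕
x₁ = b`. The overlap with the claw state factors exactly into the two OSP overlaps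
(`projNorm_entangle`), which gives correctness, and hiding `b` follows from OSP security by a hybrid
through the input pair `(0, 0)` (`indSecure_csgOfOSP`).

The rest makes the adversaries actual circuits: sequential composition, running with a context
register, and simulation of randomized circuits by quantum ones, each with its exact output
distribution and a polynomial size bound. -/

theorem Negligible.of_abs_le {f g : ℕ → ℝ} (hg : Negligible g) (h : ∀ n, |f n| ≤ |g n|) :
    Negligible f := fun c => by
  obtain ⟨N, hN⟩ := hg c
  exact ⟨N, fun n hn => (h n).trans_lt (hN n hn)⟩

theorem Negligible.add {f g : ℕ → ℝ} (hf : Negligible f) (hg : Negligible g) :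
    Negligible (fun n => f n + g n) := fun c => by
  obtain ⟨N, hN⟩ := hf (c + 1)
  obtain ⟨M, hM⟩ := hg (c + 1)
  refine ⟨max (max N M) 2, fun n hn => ?_⟩
  simp only [max_lt_iff] at hn
  have h1 := hN n hn.1.1
  have h2 := hM n hn.1.2
  have hn2 : (2 : ℝ) ≤ n := by exact_mod_cast hn.2.le
  have hp : (0 : ℝ) < (n : ℝ) ^ c := by positivity
  have h3 : ((n : ℝ) ^ (c + 1))⁻¹ ≤ ((n : ℝ) ^ c)⁻¹ / 2 := by
    rw [pow_succ, mul_inv, div_eq_mul_inv]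
    gcongr
  have := abs_add_le (f n) (g n)
  linarith

theorem Negligible.const_mul {f : ℕ → ℝ} (hf : Negligible f) (k : ℝ) :
    Negligible (fun n => k * f n) := fun c => by
  obtain ⟨N, hN⟩ := hf (c + 1)
  obtain ⟨K, hK⟩ := exists_nat_gt |k|
  refine ⟨max N (K + 1), fun n hn => ?_⟩
  simp only [max_lt_iff] at hn
  have h1 := hN n hn.1
  have hnK : (K : ℝ) + 1 < n := by exact_mod_cast hn.2
  have hn0 : (0 : ℝ) < n := by linarith [Nat.cast_nonneg (α := ℝ) K]
  rw [abs_mul]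
  calc |k| * |f n| ≤ n * |f n| := by gcongr; linarith
    _ < n * ((n : ℝ) ^ (c + 1))⁻¹ := by gcongr
    _ = ((n : ℝ) ^ c)⁻¹ := by rw [pow_succ]; field_simp

theorem Negligible.neg {f : ℕ → ℝ} (hf : Negligible f) : Negligible (fun n => - f n) :=
  hf.of_abs_le fun n => by simp

theorem Negligible.sub {f g : ℕ → ℝ} (hf : Negligible f) (hg : Negligible g) :
    Negligible (fun n => f n - g n) := by
  simpa only [sub_eq_add_neg] using hf.add hg.neg

theorem Negligible.abs {f : ℕ → ℝ} (hf : Negligible f) : Negligible (fun n => |f n|) :=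
  hf.of_abs_le fun n => by simp

theorem Negligible.of_abs {f : ℕ → ℝ} (hf : Negligible (fun n => |f n|)) : Negligible f :=
  hf.of_abs_le fun n => by simp

theorem Negligible.mul {f g : ℕ → ℝ} (hf : Negligible f) (hg : Negligible g) :
    Negligible (fun n => f n * g n) := fun c => by
  obtain ⟨N, hN⟩ := hf c
  obtain ⟨M, hM⟩ := hg 0
  refine ⟨max N M, fun n hn => ?_⟩
  simp only [max_lt_iff] at hn
  have h1 := hN n hn.1
  have h2 := hM n hn.2
  simp only [pow_zero, inv_one] at h2
  rw [abs_mul]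
  calc |f n| * |g n| ≤ |f n| * 1 := by gcongr
    _ < _ := by simpa using h1

/-- This stands in for a bound by the square root of `δ`: optimizing over `t` would give order `√δ`.
Keeping the bound linear in `δ` lets it pass through expectations without a Jensen inequality. -/
theorem Negligible.of_forall_le {f δ : ℕ → ℝ} (hδ : Negligible δ)
    (h : ∀ n, ∀ t : ℝ, 0 < t → |f n| ≤ δ n / t + 2 * t) : Negligible f := fun c => by
  obtain ⟨N, hN⟩ := hδ (2 * c + 1)
  refine ⟨max N 32, fun n hn => ?_⟩
  simp only [max_lt_iff] at hn
  have hn2 : (32 : ℝ) < n := by exact_mod_cast hn.2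
  set u : ℝ := (n : ℝ) ^ c with hu
  have hp : 0 < u := by positivity
  have h1 := (le_abs_self _).trans (hN n hn.1).le
  -- With `t` a quarter of the target, `2 * t` uses half of it. The other term needs `δ` of the
  -- order of the target squared, hence the exponent `2 * c + 1`, whose spare power of `n > 32`
  -- absorbs the constants.
  have h2 := h n (u⁻¹ / 4) (by positivity)
  have h3 : ((n : ℝ) ^ (2 * c + 1))⁻¹ < (u⁻¹) ^ 2 / 32 := by
    rw [pow_succ, pow_mul', ← hu, mul_inv, inv_pow, div_eq_mul_inv]
    gcongr
  have h4 : δ n / (u⁻¹ / 4) ≤ u⁻¹ / 4 := by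
    rw [div_le_iff₀ (by positivity)]
    nlinarith [sq_nonneg (u⁻¹)]
  have : 0 < u⁻¹ := by positivity
  linarith

theorem PolyBounded.mono {f g : ℕ → ℕ} (hg : PolyBounded g) (h : ∀ n, f n ≤ g n) :
    PolyBounded f := by
  obtain ⟨c, N, hN⟩ := hg
  exact ⟨c, N, fun n hn => (h n).trans_lt (hN n hn)⟩

theorem PolyBounded.add {f g : ℕ → ℕ} (hf : PolyBounded f) (hg : PolyBounded g) :
    PolyBounded (fun n => f n + g n) := by
  obtain ⟨c, N, hN⟩ := hf
  obtain ⟨d, M, hM⟩ := hg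
  refine ⟨max c d + 1, max (max N M) 2, fun n hn => ?_⟩
  simp only [max_lt_iff] at hn
  have h1 := hN n hn.1.1
  have h2 := hM n hn.1.2
  have h3 : n ^ c ≤ n ^ max c d := Nat.pow_le_pow_right (by omega) (le_max_left _ _)
  have h4 : n ^ d ≤ n ^ max c d := Nat.pow_le_pow_right (by omega) (le_max_right _ _)
  have h5 : n ^ max c d * 2 ≤ n ^ (max c d + 1) := by
    rw [pow_succ]; exact Nat.mul_le_mul_left _ (by omega)
  change f n + g n < _
  omega

theorem PolyBounded.mul {f g : ℕ → ℕ} (hf : PolyBounded f) (hg : PolyBounded g) :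
    PolyBounded (fun n => f n * g n) := by
  obtain ⟨c, N, hN⟩ := hf
  obtain ⟨d, M, hM⟩ := hg
  refine ⟨c + d, max N M, fun n hn => ?_⟩
  simp only [max_lt_iff] at hn
  rw [pow_add]
  exact Nat.mul_lt_mul'' (hN n hn.1) (hM n hn.2)

theorem PolyBounded.const (k : ℕ) : PolyBounded (fun _ => k) :=
  ⟨1, k, fun n hn => by simpa using hn⟩

/-! ## Finite expectations -/

/-- The functional `E` is the expectation over a finitely supported probability distribution whose
outcomes lie in `S`. -/
def IsExp {α : Type} (S : Set α) (E : (α → ℝ) → ℝ) : Prop :=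
  ∃ (ι : Type) (_ : Fintype ι) (w : ι → ℝ) (a : ι → α), (∀ i, 0 ≤ w i) ∧ ∑ i, w i = 1 ∧
    (∀ i, a i ∈ S) ∧ ∀ f, E f = ∑ i, w i * f (a i)

namespace IsExp

variable {α β : Type} {S : Set α} {E : (α → ℝ) → ℝ}

theorem const (h : IsExp S E) (k : ℝ) : E (fun _ => k) = k := by
  obtain ⟨ι, _, w, a, -, h1, -, hE⟩ := h
  rw [hE, ← Finset.sum_mul, h1, one_mul]

theorem add (h : IsExp S E) (f g : α → ℝ) : E (fun x => f x + g x) = E f + E g := by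
  obtain ⟨ι, _, w, a, -, -, -, hE⟩ := h
  simp only [hE, mul_add, Finset.sum_add_distrib]

theorem sub (h : IsExp S E) (f g : α → ℝ) : E (fun x => f x - g x) = E f - E g := by
  obtain ⟨ι, _, w, a, -, -, -, hE⟩ := h
  simp only [hE, mul_sub, Finset.sum_sub_distrib]

theorem const_mul (h : IsExp S E) (k : ℝ) (f : α → ℝ) : E (fun x => k * f x) = k * E f := by
  obtain ⟨ι, _, w, a, -, -, -, hE⟩ := h
  simp only [hE, Finset.mul_sum]
  exact Finset.sum_congr rfl fun i _ => by ring

theorem mul_const (h : IsExp S E) (k : ℝ) (f : α → ℝ) : E (fun x => f x * k) = E f * k := by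
  simpa only [mul_comm] using h.const_mul k f

theorem div_const (h : IsExp S E) (k : ℝ) (f : α → ℝ) : E (fun x => f x / k) = E f / k := by
  simpa only [div_eq_mul_inv] using h.mul_const k⁻¹ f

theorem sum (h : IsExp S E) {κ : Type} (s : Finset κ) (f : κ → α → ℝ) :
    E (fun x => ∑ k ∈ s, f k x) = ∑ k ∈ s, E (f k) := by
  obtain ⟨ι, _, w, a, -, -, -, hE⟩ := h
  simp only [hE, Finset.mul_sum]
  exact Finset.sum_comm

theorem mono (h : IsExp S E) {f g : α → ℝ} (hfg : ∀ x ∈ S, f x ≤ g x) : E f ≤ E g := by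
  obtain ⟨ι, _, w, a, hw, -, hS, hE⟩ := h
  simp only [hE]
  exact Finset.sum_le_sum fun i _ => mul_le_mul_of_nonneg_left (hfg _ (hS i)) (hw i)

theorem abs_le (h : IsExp S E) {f g : α → ℝ} (hfg : ∀ x ∈ S, |f x| ≤ g x) : |E f| ≤ E g := by
  rw [_root_.abs_le, ← neg_one_mul, ← h.const_mul]
  refine ⟨h.mono fun x hx => ?_, h.mono fun x hx => ?_⟩
  · have := (_root_.abs_le.1 (hfg x hx)).1
    linarith
  · exact (le_abs_self _).trans (hfg x hx)

theorem comm (h : IsExp S E) {T : Set β} {F : (β → ℝ) → ℝ} (h' : IsExp T F) (f : α → β → ℝ) :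
    E (fun a => F (fun b => f a b)) = F (fun b => E (fun a => f a b)) := by
  obtain ⟨ι, _, w, a, -, -, -, hE⟩ := h
  simp only [hE, h'.sum, h'.const_mul]

theorem mem_Icc (h : IsExp S E) {f : α → ℝ} (hf : ∀ x ∈ S, f x ∈ Set.Icc (0 : ℝ) 1) :
    E f ∈ Set.Icc (0 : ℝ) 1 :=
  ⟨(h.const 0).symm.le.trans (h.mono fun x hx => (hf x hx).1),
    (h.mono fun x hx => (hf x hx).2).trans (h.const 1).le⟩

/-- Sampling `a` from `E` and then `b` from `F a`. -/
theorem bind (h : IsExp S E) {T : Set β} {F : α → (β → ℝ) → ℝ} (hF : ∀ a, IsExp T (F a)) :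
    IsExp (S ×ˢ T) (fun f : α × β → ℝ => E (fun a => F a (fun b => f (a, b)))) := by
  obtain ⟨ι, _, w, a, hw, h1, hS, hE⟩ := h
  choose κ hκ v b hv hv1 hT hF using hF
  refine ⟨Σ i : ι, κ (a i), inferInstance, fun p => w p.1 * v _ p.2, fun p => (a p.1, b _ p.2),
    fun p => mul_nonneg (hw _) (hv _ _), ?_, fun p => ⟨hS _, hT _ _⟩, fun f => ?_⟩
  · simp only [Fintype.sum_sigma, ← Finset.mul_sum, hv1, mul_one, h1]
  · simp only [Fintype.sum_sigma, hE, hF, Finset.mul_sum, mul_assoc]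

end IsExp

theorem ind_mem_Icc (p : Prop) [Decidable p] : ind p ∈ Set.Icc (0 : ℝ) 1 := by
  unfold ind; split_ifs <;> simp

theorem sum_bits_sum {A B : Type} [Fintype A] [DecidableEq A] [Fintype B] [DecidableEq B]
    {M : Type*} [AddCommMonoid M] (f : Bits (A ⊕ B) → M) :
    ∑ z, f z = ∑ a : Bits A, ∑ b : Bits B, f (Sum.elim a b) := by
  rw [← (Equiv.sumArrowEquivProdArrow A B Bool).symm.sum_comp, Fintype.sum_prod_type]
  rfl

theorem sum_bits_unique {A : Type} [Fintype A] [DecidableEq A] [Unique A]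
    {M : Type*} [AddCommMonoid M] (f : Bits A → M) :
    ∑ z, f z = f (fun _ => false) + f (fun _ => true) := by
  rw [← (Equiv.funUnique A Bool).symm.sum_comp, Fintype.sum_bool, add_comm]
  rfl

/-! ## Randomized circuits -/

/-- `Function.extend e s s'` is the global state `s'` with the wires in the range of `e` overwritten
by the local state `s`. This and the next two facts let a relabelled gate be computed on its own
register. -/
theorem extend_update {W W' β : Type} [DecidableEq W] [DecidableEq W'] {e : W → W'}
    (he : e.Injective) (s : W → β) (s' : W' → β) (i : W) (b : β) :
    Function.extend e (Function.update s i b) s' =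
      Function.update (Function.extend e s s') (e i) b := by
  funext v
  by_cases hv : ∃ w, e w = v
  · obtain ⟨w, rfl⟩ := hv
    rw [he.extend_apply]
    by_cases hw : w = i
    · subst hw; simp
    · rw [Function.update_of_ne hw, Function.update_of_ne (he.ne hw), he.extend_apply]
  · rw [Function.extend_apply' _ _ _ hv, Function.update_of_ne, Function.extend_apply' _ _ _ hv]
    rintro rfl
    exact hv ⟨i, rfl⟩

theorem extend_comp_self {W W' β : Type} {e : W → W'} (he : e.Injective) (s : W' → β) :
    Function.extend e (s ∘ e) s = s := by
  funext v
  by_cases hv : ∃ w, e w = v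
  · obtain ⟨w, rfl⟩ := hv
    rw [he.extend_apply, Function.comp_apply]
  · rw [Function.extend_apply' _ _ _ hv]

theorem extend_extend {W W' β : Type} {e : W → W'} (he : e.Injective) (s t : W → β) (s' : W' → β) :
    Function.extend e s (Function.extend e t s') = Function.extend e s s' := by
  funext v
  by_cases hv : ∃ w, e w = v
  · obtain ⟨w, rfl⟩ := hv
    rw [he.extend_apply, he.extend_apply]
  · simp only [Function.extend_apply' _ _ _ hv]

theorem BoolGate.foldl_map {W W' : Type} [DecidableEq W] [DecidableEq W'] {e : W → W'}
    (he : e.Injective) (gs : List (BoolGate W)) (s : Bits W') :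
    (gs.map (BoolGate.map e)).foldl (fun s g => g.apply s) s =
      Function.extend e (gs.foldl (fun s g => g.apply s) (s ∘ e)) s := by
  induction gs generalizing s with
  | nil => exact (extend_comp_self he s).symm
  | cons g gs ih =>
    have h : (g.map e).apply s = Function.extend e (g.apply (s ∘ e)) s := by
      rw [BoolGate.apply, BoolGate.apply, extend_update he, extend_comp_self he]
      rfl
    rw [List.map_cons, List.foldl_cons, List.foldl_cons, ih, h, extend_extend he,
      show Function.extend e (g.apply (s ∘ e)) s ∘ e = g.apply (s ∘ e) from
        funext fun w => he.extend_apply _ _ w]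

/-- The gate that copies the wire `i` to the wire `j`. -/
def BoolGate.copy {W : Type} (i j : W) : BoolGate W := ⟨fun a _ => a, i, i, j⟩

/-- No source is ever a target, so the copies do not influence one another. Partial lists are needed
only for the induction. -/
theorem BoolGate.foldl_copy {W O : Type} [DecidableEq W] {src tgt : O → W}
    (ht : tgt.Injective) (hst : ∀ o o', src o ≠ tgt o') (L : List O) (s : Bits W) :
    (L.map fun o => BoolGate.copy (src o) (tgt o)).foldl (fun s g => g.apply s) s =
      fun v => open Classical in if ∃ o ∈ L, tgt o = v then
        Function.extend tgt (s ∘ src) s v else s v := by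
  classical
  induction L generalizing s with
  | nil => simp
  | cons a L ih =>
    rw [List.map_cons, List.foldl_cons, ih]
    have hs : (BoolGate.copy (src a) (tgt a)).apply s ∘ src = s ∘ src := by
      funext o
      simp [BoolGate.apply, BoolGate.copy, Function.update_of_ne (hst o a)]
    funext v
    rw [hs]
    by_cases hv : ∃ o, tgt o = v
    · obtain ⟨o, rfl⟩ := hv
      simp only [ht.extend_apply, ht.eq_iff, exists_eq_right, List.mem_cons]
      by_cases ho : o ∈ L
      · simp [ho]
      · by_cases hoa : o = a
        · subst hoa
          simp [ho, BoolGate.apply, BoolGate.copy]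
        · simp [ho, hoa, BoolGate.apply, Function.update_of_ne (ht.ne hoa), BoolGate.copy]
    · rw [if_neg (fun h => hv ⟨_, h.choose_spec.2⟩), if_neg (fun h => hv ⟨_, h.choose_spec.2⟩)]
      rw [BoolGate.apply, Function.update_of_ne]
      exact fun h => hv ⟨a, h.symm⟩

theorem BoolGate.foldl_copy_univ {W O : Type} [DecidableEq W] [Fintype O] {src tgt : O → W}
    (ht : tgt.Injective) (hst : ∀ o o', src o ≠ tgt o') (s : Bits W) :
    (Finset.univ.toList.map fun o => BoolGate.copy (src o) (tgt o)).foldl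
      (fun s g => g.apply s) s = Function.extend tgt (s ∘ src) s := by
  rw [foldl_copy ht hst]
  funext v
  split_ifs with h
  · rfl
  · rw [Function.extend_apply' _ _ _ fun ⟨o, ho⟩ => h ⟨o, by simp, ho⟩]

/-! ### Routing, context and composition of randomized circuits -/

namespace RandCircuit

variable {I O P : Type}

theorem isExp_expect [DecidableEq I] (C : RandCircuit I O) (x : Bits I) : IsExp Set.univ (C.expect x) := by
  refine ⟨Bits C.Rnd, inferInstance, fun _ => 1 / 2 ^ Fintype.card C.Rnd, C.eval x,
    fun _ => by positivity, ?_, fun _ => trivial, fun f => ?_⟩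
  · simp
  · rw [expect, ← Finset.mul_sum]; ring

/-- A circuit without gates that outputs some of its input wires. -/
abbrev route (e : O → I) : RandCircuit I O where
  Rnd := Empty
  Aux := Empty
  gates := []
  out := fun o => Sum.inl (e o)

theorem expect_route [DecidableEq I] (e : O → I) (x : Bits I) (f : Bits O → ℝ) :
    (route e).expect x f = f (x ∘ e) := by
  simp [expect]
  rfl

/-- Run `C` on the first input register and keep the second one. -/
abbrev ctx (C : RandCircuit I O) (J : Type) : RandCircuit (I ⊕ J) (O ⊕ J) where
  Rnd := C.Rnd
  Aux := C.Aux
  gates := C.gates.map (BoolGate.map (Sum.map Sum.inl id))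
  out := Sum.elim (Sum.map Sum.inl id ∘ C.out) (fun j => Sum.inl (Sum.inr j))

theorem eval_ctx [DecidableEq I] (C : RandCircuit I O) {J : Type} [DecidableEq J] (x : Bits (I ⊕ J))
    (r : Bits C.Rnd) :
    (C.ctx J).eval x r = Sum.elim (C.eval (x ∘ Sum.inl) r) (x ∘ Sum.inr) := by
  have he : Function.Injective (Sum.map Sum.inl id : I ⊕ (C.Rnd ⊕ C.Aux) → (I ⊕ J) ⊕ _) :=
    Sum.map_injective.2 ⟨Sum.inl_injective, Function.injective_id⟩
  have hs : (Sum.elim x (Sum.elim r fun _ => false) : Bits ((I ⊕ J) ⊕ (C.Rnd ⊕ C.Aux))) ∘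
      Sum.map Sum.inl id = Sum.elim (x ∘ Sum.inl) (Sum.elim r fun _ => false) := by
    funext w; rcases w with _ | _ | _ <;> rfl
  funext o
  rcases o with o | j
  · simp only [eval, BoolGate.foldl_map he, Sum.elim_inl, Function.comp_apply, he.extend_apply, hs]
  · simp only [eval, BoolGate.foldl_map he, Sum.elim_inr]
    rw [Function.extend_apply']
    · rfl
    · rintro ⟨w | w, hw⟩ <;> simp at hw

theorem expect_ctx [DecidableEq I] (C : RandCircuit I O) {J : Type} [DecidableEq J] (x : Bits (I ⊕ J))
    (f : Bits (O ⊕ J) → ℝ) :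
    (C.ctx J).expect x f = C.expect (x ∘ Sum.inl) (fun y => f (Sum.elim y (x ∘ Sum.inr))) := by
  simp only [expect, eval_ctx]

theorem size_ctx [Fintype I] [Fintype O] (C : RandCircuit I O) (J : Type) [Fintype J] :
    (C.ctx J).size = C.size + 2 * Fintype.card J := by
  simp only [size, List.length_map, Fintype.card_sum]; ring

/-- The wires of the second circuit in a composition. -/
def seqEmb (I R₁ R₂ A₁ O A₂ : Type) : O ⊕ (R₂ ⊕ A₂) → I ⊕ ((R₁ ⊕ R₂) ⊕ (A₁ ⊕ (O ⊕ A₂)))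
  | Sum.inl o => Sum.inr (Sum.inr (Sum.inr (Sum.inl o)))
  | Sum.inr (Sum.inl r) => Sum.inr (Sum.inl (Sum.inr r))
  | Sum.inr (Sum.inr a) => Sum.inr (Sum.inr (Sum.inr (Sum.inr a)))

/-- Run `C`, then `D` on the result. -/
abbrev seq [Fintype O] [DecidableEq O] (C : RandCircuit I O)
    (D : RandCircuit O P) : RandCircuit I P where
  Rnd := C.Rnd ⊕ D.Rnd
  Aux := C.Aux ⊕ (O ⊕ D.Aux)
  gates := C.gates.map (BoolGate.map (Sum.map id (Sum.map Sum.inl Sum.inl))) ++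
    ((Finset.univ.toList.map fun o => BoolGate.copy
      (Sum.map id (Sum.map Sum.inl Sum.inl) (C.out o)) (Sum.inr (Sum.inr (Sum.inr (Sum.inl o))))) ++
    D.gates.map (BoolGate.map (seqEmb I C.Rnd D.Rnd C.Aux O D.Aux)))
  out := seqEmb I C.Rnd D.Rnd C.Aux O D.Aux ∘ D.out

/-- The second circuit gets fresh input wires, because the output map of the first may read one wire
several times, or an input wire, while gates overwrite their targets. -/
theorem eval_seq [DecidableEq I] [DecidableEq O] [Fintype O] (C : RandCircuit I O) (D : RandCircuit O P) (x : Bits I)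
    (r₁ : Bits C.Rnd) (r₂ : Bits D.Rnd) :
    (C.seq D).eval x (Sum.elim r₁ r₂) = D.eval (C.eval x r₁) r₂ := by
  have he₁ : Function.Injective (Sum.map id (Sum.map Sum.inl Sum.inl) :
      I ⊕ (C.Rnd ⊕ C.Aux) → I ⊕ ((C.Rnd ⊕ D.Rnd) ⊕ (C.Aux ⊕ (O ⊕ D.Aux)))) :=
    Sum.map_injective.2 ⟨Function.injective_id,
      Sum.map_injective.2 ⟨Sum.inl_injective, Sum.inl_injective⟩⟩
  have he₂ : Function.Injective (seqEmb I C.Rnd D.Rnd C.Aux O D.Aux) := by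
    rintro (_ | _ | _) (_ | _ | _) h <;> simp_all [seqEmb]
  have ht : Function.Injective (fun o : O => (Sum.inr (Sum.inr (Sum.inr (Sum.inl o))) :
      I ⊕ ((C.Rnd ⊕ D.Rnd) ⊕ (C.Aux ⊕ (O ⊕ D.Aux))))) := fun _ _ h => by simpa using h
  have hst : ∀ o o' : O, (Sum.map id (Sum.map Sum.inl Sum.inl) (C.out o) :
      I ⊕ ((C.Rnd ⊕ D.Rnd) ⊕ (C.Aux ⊕ (O ⊕ D.Aux)))) ≠
        Sum.inr (Sum.inr (Sum.inr (Sum.inl o'))) := by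
    intro o o'
    rcases C.out o with _ | _ | _ <;> simp
  funext p
  simp only [eval, List.foldl_append, BoolGate.foldl_map he₂, Function.comp_apply,
    he₂.extend_apply]
  rw [BoolGate.foldl_copy_univ ht hst, BoolGate.foldl_map he₁]
  have hs : (Sum.elim x (Sum.elim (Sum.elim r₁ r₂) fun _ => false) :
      Bits (I ⊕ ((C.Rnd ⊕ D.Rnd) ⊕ (C.Aux ⊕ (O ⊕ D.Aux))))) ∘
      Sum.map id (Sum.map Sum.inl Sum.inl) = Sum.elim x (Sum.elim r₁ fun _ => false) := by
    funext w; rcases w with _ | _ | _ <;> rfl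
  rw [hs]
  -- It remains to see that `D` starts correctly: copied outputs on its inputs, untouched random
  -- bits, untouched zeros.
  refine congrFun (congrArg (fun s => List.foldl (fun s g => BoolGate.apply g s) s D.gates) ?_) _
  funext w
  rcases w with o | r | a
  · exact (ht.extend_apply _ _ o).trans (he₁.extend_apply _ _ (C.out o))
  · rw [Function.comp_apply, Function.extend_apply', Function.extend_apply']
    · rfl
    · rintro ⟨_ | _ | _, hw⟩ <;> simp [seqEmb] at hw
    · rintro ⟨_, hw⟩; simp [seqEmb] at hw
  · rw [Function.comp_apply, Function.extend_apply', Function.extend_apply']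
    · rfl
    · rintro ⟨_ | _ | _, hw⟩ <;> simp [seqEmb] at hw
    · rintro ⟨_, hw⟩; simp [seqEmb] at hw

theorem expect_seq [DecidableEq I] [DecidableEq O] [Fintype O] (C : RandCircuit I O) (D : RandCircuit O P) (x : Bits I)
    (f : Bits P → ℝ) :
    (C.seq D).expect x f = C.expect x (fun y => D.expect y f) := by
  simp only [expect, sum_bits_sum, Fintype.card_sum, pow_add, eval_seq]
  rw [← Finset.sum_div, div_div, mul_comm]

theorem size_seq [Fintype I] [Fintype O] [DecidableEq O] [Fintype P] (C : RandCircuit I O) (D : RandCircuit O P) :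
    (C.seq D).size ≤ C.size + D.size := by
  simp only [size, List.length_append, List.length_map, Fintype.card_sum, Finset.length_toList,
    Finset.card_univ]
  omega

end RandCircuit

theorem PPT.seq {I O P : ℕ → Type} [∀ l, Fintype (I l)] [∀ l, Fintype (O l)] [∀ l, Fintype (P l)]
    [∀ l, DecidableEq (O l)]
    {C : ∀ l, RandCircuit (I l) (O l)} {D : ∀ l, RandCircuit (O l) (P l)} (hC : PPT C)
    (hD : PPT D) : PPT (fun l => (C l).seq (D l)) :=
  (PolyBounded.add hC hD).mono fun _ => RandCircuit.size_seq _ _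

theorem PPT.ctx {I O J : ℕ → Type} [∀ l, Fintype (I l)] [∀ l, Fintype (O l)] [∀ l, Fintype (J l)]
    {C : ∀ l, RandCircuit (I l) (O l)} (hC : PPT C)
    (hJ : PolyBounded fun l => Fintype.card (J l)) : PPT (fun l => (C l).ctx (J l)) :=
  (PolyBounded.add hC ((PolyBounded.const 2).mul hJ)).mono fun _ =>
    (RandCircuit.size_ctx _ _).le

/-! ## Quantum circuits -/

theorem sum_sum_sum_sum_comm {A B C D : Type*} [Fintype A] [Fintype B] [Fintype C] [Fintype D]
    (f : A → B → C → D → ℝ) :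
    ∑ a, ∑ b, ∑ c, ∑ d, f a b c d = ∑ c, ∑ d, ∑ a, ∑ b, f a b c d := by
  have := Finset.sum_comm (s := (Finset.univ : Finset (A × B)))
    (t := (Finset.univ : Finset (C × D))) (f := fun p q => f p.1 p.2 q.1 q.2)
  simpa only [Fintype.sum_prod_type] using this

/-- The amplitudes of a standard basis state. -/
def basisAmp {W : Type} [Fintype W] [DecidableEq W] (w₀ : Bits W) : Bits W → ℂ :=
  fun w => if w = w₀ then 1 else 0

namespace QGate

variable {W W' : Type} [DecidableEq W] [DecidableEq W']

/-- The action of a sequence of gates. -/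
def run (gs : List (QGate W)) (ψ : Bits W → ℂ) : Bits W → ℂ :=
  gs.foldl (fun ψ g => g.apply ψ) ψ

@[simp] theorem run_nil (ψ : Bits W → ℂ) : run [] ψ = ψ := rfl

@[simp] theorem run_cons (g : QGate W) (gs : List (QGate W)) (ψ : Bits W → ℂ) :
    run (g :: gs) ψ = run gs (g.apply ψ) := rfl

theorem run_append (gs hs : List (QGate W)) (ψ : Bits W → ℂ) :
    run (gs ++ hs) ψ = run hs (run gs ψ) := List.foldl_append ..

theorem apply_map (e : W ↪ W') (g : QGate W) (ψ : Bits W' → ℂ) (w' : Bits W') :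
    (g.map e).apply ψ w' = g.apply (fun w => ψ (Function.extend e w w')) (w' ∘ e) := by
  cases g <;>
    simp only [QGate.map, apply, extend_update e.injective, extend_comp_self e.injective,
      Function.comp_apply]

/-- Gates on a subregister act separately on each slice of the vector in which the bits outside that
subregister are frozen, here at their values in `w'`. -/
theorem run_map (e : W ↪ W') (gs : List (QGate W)) (ψ : Bits W' → ℂ) (w' : Bits W') :
    run (gs.map (QGate.map e)) ψ w' =
      run gs (fun w => ψ (Function.extend e w w')) (w' ∘ e) := by
  induction gs generalizing ψ with
  | nil => simp [extend_comp_self e.injective]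
  | cons g gs ih =>
    rw [List.map_cons, run_cons, run_cons, ih]
    congr 1
    funext w
    have : Function.extend e w w' ∘ e = w := funext fun i => e.injective.extend_apply _ _ i
    simp only [apply_map, extend_extend e.injective, this]

/-- Once the other wires are frozen, their contribution to a slice is a scalar factor; this pulls it
out. -/
theorem run_const_mul (gs : List (QGate W)) (k : ℂ) (ψ : Bits W → ℂ) :
    run gs (fun w => k * ψ w) = fun w => k * run gs ψ w := by
  induction gs generalizing ψ with
  | nil => rfl
  | cons g gs ih =>
    rw [run_cons, run_cons, ← ih]
    congr 1
    funext w
    cases g <;> simp only [apply] <;> ring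

theorem sum_comp_involutive {α : Type} [Fintype α] {π : α → α} (hπ : π.Involutive) (f : α → ℝ) :
    ∑ a, f (π a) = ∑ a, f a :=
  Equiv.sum_comp (hπ.toPerm π) f

theorem involutive_update (i : W) (m : Bits W → Bool)
    (hm : ∀ w b, m (Function.update w i b) = m w) :
    Function.Involutive fun w : Bits W => Function.update w i (xor (w i) (m w)) := by
  intro w
  simp [hm]

/-- Unitarity gate by gate: `X`, controlled-not and Toffoli permute the basis by an involution, `T`
multiplies by phases, and Hadamard is the parallelogram law on each pair of strings differing at the
wire. -/
theorem sum_norm_sq_apply [Fintype W] (g : QGate W) (ψ : Bits W → ℂ) :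
    ∑ w, ‖g.apply ψ w‖ ^ 2 = ∑ w, ‖ψ w‖ ^ 2 := by
  have key (i : W) (m : Bits W → Bool) (hm : ∀ w b, m (Function.update w i b) = m w) :
      ∑ w : Bits W, ‖ψ (Function.update w i (xor (w i) (m w)))‖ ^ 2 = ∑ w, ‖ψ w‖ ^ 2 :=
    sum_comp_involutive (involutive_update i m hm) fun w => ‖ψ w‖ ^ 2
  cases g with
  | x i => simpa [apply] using key i (fun _ => true) (fun _ _ => rfl)
  | h i =>
    have hi := involutive_update i (fun _ => true) (fun _ _ => rfl)
    have h1 := sum_comp_involutive hi fun w => ‖(h i).apply ψ w‖ ^ 2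
    have h2 := sum_comp_involutive hi fun w => ‖ψ w‖ ^ 2
    -- Summed over all `w`, this identity counts each pair twice on both sides; `h1` and `h2` undo
    -- the doubling.
    have h3 : ∀ w, ‖(h i).apply ψ w‖ ^ 2 +
        ‖(h i).apply ψ (Function.update w i (xor (w i) true))‖ ^ 2 =
        ‖ψ w‖ ^ 2 + ‖ψ (Function.update w i (xor (w i) true))‖ ^ 2 := by
      intro w
      have hs : ‖((Real.sqrt 2 : ℝ) : ℂ)⁻¹‖ ^ 2 = 1 / 2 := by
        rw [norm_inv, Complex.norm_real, Real.norm_of_nonneg (Real.sqrt_nonneg 2), inv_pow,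
          Real.sq_sqrt (by norm_num)]
        norm_num
      have hp := parallelogram_law_with_norm ℝ (ψ (Function.update w i false))
        (ψ (Function.update w i true))
      rcases hw : w i with _ | _
      · have hw' : Function.update w i false = w := by rw [← hw, Function.update_eq_self]
        simp only [apply, hw, norm_mul, mul_pow, hs, Function.update_idem, Function.update_self,
          Bool.false_xor, hw', if_true, Bool.false_eq_true, if_false, one_mul, neg_one_mul,
          ← sub_eq_add_neg] at hp ⊢
        linarith
      · have hw' : Function.update w i true = w := by rw [← hw, Function.update_eq_self]
        simp only [apply, hw, norm_mul, mul_pow, hs, Function.update_idem, Function.update_self,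
          Bool.true_xor, Bool.not_true, hw', if_true, Bool.false_eq_true, if_false, one_mul,
          neg_one_mul, ← sub_eq_add_neg] at hp ⊢
        linarith
    have h4 := Finset.sum_congr (s₁ := Finset.univ) rfl fun w _ => h3 w
    simp only [Finset.sum_add_distrib] at h4
    linarith
  | t i =>
    refine Finset.sum_congr rfl fun w _ => ?_
    have : ‖Complex.exp (Complex.I * (Real.pi / 4 : ℝ))‖ = 1 := by
      rw [mul_comm]; exact Complex.norm_exp_ofReal_mul_I _
    simp only [apply, norm_mul]
    split_ifs <;> simp only [this, norm_one, one_mul]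
  | cnot c i hci => exact key i (fun w => w c) fun w b => Function.update_of_ne hci _ _
  | toffoli a b i hab hai hbi =>
    exact key i (fun w => w a && w b) fun w c => by
      rw [Function.update_of_ne hai, Function.update_of_ne hbi]

theorem sum_norm_sq_run [Fintype W] (gs : List (QGate W)) (ψ : Bits W → ℂ) :
    ∑ w, ‖run gs ψ w‖ ^ 2 = ∑ w, ‖ψ w‖ ^ 2 := by
  induction gs generalizing ψ with
  | nil => rfl
  | cons g gs ih => rw [run_cons, ih, sum_norm_sq_apply]

/-- The targets are distinct and never serve as controls, so all these gates act simultaneously. -/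
theorem run_cnot {O : Type} [DecidableEq O] {a b : O → W} (hb : b.Injective)
    (hab : ∀ o o', a o ≠ b o') {L : List O} (hL : L.Nodup) (ψ : Bits W → ℂ) (w : Bits W) :
    run (L.map fun o => cnot (a o) (b o) (hab o o)) ψ w =
      ψ (Function.extend b (fun o => if o ∈ L then xor (w (b o)) (w (a o)) else w (b o)) w) := by
  induction L generalizing ψ with
  | nil => simp only [List.map_nil, run_nil, List.not_mem_nil, if_false]
           exact congrArg ψ (extend_comp_self hb w).symm
  | cons o L ih =>
    rw [List.nodup_cons] at hL
    rw [List.map_cons, run_cons, ih hL.2]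
    simp only [apply]
    congr 1
    rw [← extend_update hb]
    congr 1
    funext o'
    rw [hb.extend_apply, Function.extend_apply' _ _ (a o) fun ⟨o', ho'⟩ => hab _ _ ho'.symm]
    by_cases ho : o' = o
    · subst ho; simp [hL.1]
    · simp [ho]

theorem run_cnot_univ {O : Type} [DecidableEq O] [Fintype O] {a b : O → W} (hb : b.Injective)
    (hab : ∀ o o', a o ≠ b o') (ψ : Bits W → ℂ) (w : Bits W) :
    run (Finset.univ.toList.map fun o => cnot (a o) (b o) (hab o o)) ψ w =
      ψ (Function.extend b (fun o => xor (w (b o)) (w (a o))) w) := by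
  rw [run_cnot hb hab (Finset.nodup_toList _)]
  simp

theorem run_h_basisAmp [Fintype W] {R : Type} [DecidableEq R] {b : R → W} (hb : b.Injective)
    {w₀ : Bits W} (hw₀ : ∀ r, w₀ (b r) = false) (L : List R) (hL : L.Nodup) (w : Bits W) :
    run (L.map fun r => h (b r)) (basisAmp w₀) w =
      if ∀ v, (∀ r ∈ L, b r ≠ v) → w v = w₀ v then (((Real.sqrt 2 : ℝ) : ℂ)⁻¹) ^ L.length else 0 := by
  classical
  -- The last gate is peeled off: before it, its wire still holds 0, so only the `false` term of the
  -- Hadamard survives.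
  induction L using List.reverseRecOn generalizing w with
  | nil => simp [basisAmp, funext_iff]
  | append_singleton L r ih =>
    have hL' := List.nodup_append.1 hL
    have hr : r ∉ L := fun h => hL'.2.2 r h r (by simp) rfl
    rw [List.map_append, run_append, List.map_singleton, run_cons, run_nil]
    simp only [apply, ih hL'.1]
    rw [if_neg (c := ∀ v, (∀ r' ∈ L, b r' ≠ v) → Function.update w (b r) true v = w₀ v)]
    · have : (∀ v, (∀ r' ∈ L, b r' ≠ v) → Function.update w (b r) false v = w₀ v) ↔
          ∀ v, (∀ r' ∈ L ++ [r], b r' ≠ v) → w v = w₀ v := by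
        refine forall_congr' fun v => ?_
        by_cases hv : v = b r
        · subst hv
          simp [hw₀]
        · simp only [Function.update_of_ne hv, List.mem_append, List.mem_singleton]
          refine imp_congr_left ⟨fun h r' => ?_, fun h r' hr' => h r' (Or.inl hr')⟩
          rintro (h' | rfl)
          · exact h r' h'
          · exact Ne.symm hv
      simp only [this, mul_zero, add_zero, List.length_append, List.length_singleton]
      split_ifs
      · rw [pow_succ, mul_comm]
      · simp
    · intro h'
      have := h' (b r) fun r' hr' => hb.ne (ne_of_mem_of_not_mem hr' hr)
      simp [hw₀] at this

end QGate

namespace QCircuit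

variable {I O P : Type} [Fintype I]

theorem final_eq_run [DecidableEq I] (C : QCircuit I O) (x : Bits I) :
    C.final x = QGate.run C.gates (basisAmp (Sum.elim x fun _ => false)) := rfl

theorem sum_norm_sq_final [DecidableEq I] (C : QCircuit I O) (x : Bits I) : ∑ w, ‖C.final x w‖ ^ 2 = 1 := by
  rw [final_eq_run, QGate.sum_norm_sq_run,
    Finset.sum_eq_single (Sum.elim x fun _ => false)] <;> simp +contextual [basisAmp]

theorem sum_comp_out [DecidableEq I] [Fintype O] [DecidableEq O] (C : QCircuit I O) (F : Bits (I ⊕ C.Aux) → ℝ) :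
    ∑ w, F w = ∑ y : Bits O, ∑ g : Bits C.Garb, F (fun w => Sum.elim y g (C.out w)) := by
  refine Eq.trans ?_ (sum_bits_sum fun z : Bits (O ⊕ C.Garb) => F (z ∘ C.out))
  exact ((Equiv.arrowCongr C.out (Equiv.refl Bool)).symm.sum_comp F).symm

theorem expect_eq_sum_final [DecidableEq I] [Fintype O] [DecidableEq O] (C : QCircuit I O) (x : Bits I)
    (f : Bits O → ℝ) :
    C.expect x f = ∑ w, ‖C.final x w‖ ^ 2 * f (fun o => w (C.out.symm (Sum.inl o))) := by
  simp [sum_comp_out C, expect, amp]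

theorem expect_of_final_eq [DecidableEq I] [Fintype O] [DecidableEq O] (C : QCircuit I O) (x : Bits I)
    (w₀ : Bits (I ⊕ C.Aux)) (h : C.final x = basisAmp w₀) (f : Bits O → ℝ) :
    C.expect x f = f (fun o => w₀ (C.out.symm (Sum.inl o))) := by
  rw [expect_eq_sum_final, h, Finset.sum_eq_single w₀] <;> simp +contextual [basisAmp]

theorem isExp_expect [DecidableEq I] [Fintype O] [DecidableEq O] (C : QCircuit I O) (x : Bits I) :
    IsExp Set.univ (C.expect x) :=
  ⟨_, inferInstance, fun w => ‖C.final x w‖ ^ 2, fun w o => w (C.out.symm (Sum.inl o)),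
    fun _ => by positivity, C.sum_norm_sq_final x, fun _ => trivial, C.expect_eq_sum_final x⟩

/-! ### Circuits with a context -/

/-- Run `C` on the first input register and keep the second one. -/
abbrev ctx (C : QCircuit I O) (J : Type) : QCircuit (I ⊕ J) (O ⊕ J) where
  Aux := C.Aux
  Garb := C.Garb
  gates := C.gates.map (QGate.map (Function.Embedding.sumMap .inl (.refl _)))
  out := ((Equiv.sumAssoc I J C.Aux).trans <| (Equiv.sumCongr (.refl I) (Equiv.sumComm J C.Aux)).trans <|
    (Equiv.sumAssoc I C.Aux J).symm.trans <| (Equiv.sumCongr C.out (.refl J)).trans <|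
    (Equiv.sumAssoc O C.Garb J).trans <| (Equiv.sumCongr (.refl O) (Equiv.sumComm C.Garb J)).trans <|
    (Equiv.sumAssoc O J C.Garb).symm)

/-- No gate touches the context qubits, so they keep their classical input and contribute only an
indicator. -/
theorem amp_ctx [DecidableEq I] (C : QCircuit I O) {J : Type} [DecidableEq J] [Fintype J] (x : Bits (I ⊕ J))
    (y : Bits O) (j : Bits J) (g : Bits C.Garb) :
    (C.ctx J).amp x (Sum.elim y j) g =
      if j = x ∘ Sum.inr then C.amp (x ∘ Sum.inl) y g else 0 := by
  set e : I ⊕ C.Aux ↪ (I ⊕ J) ⊕ C.Aux := Function.Embedding.sumMap .inl (.refl _) with he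
  set w' : Bits ((I ⊕ J) ⊕ C.Aux) := fun w => Sum.elim (Sum.elim y j) g ((C.ctx J).out w) with hw'
  have h1 : w' ∘ e = fun w => Sum.elim y g (C.out w) := by
    funext w
    rcases h : C.out w with o | g <;> rcases w with w | w <;> simp [he, hw', h]
  have h2 : (fun w => basisAmp (Sum.elim x fun _ => false) (Function.extend e w w')) =
      fun w => (if j = x ∘ Sum.inr then 1 else 0) *
        basisAmp (Sum.elim (x ∘ Sum.inl) fun _ => false) w := by
    funext w
    have h3 : Function.extend e w w' =
        Sum.elim (Sum.elim (w ∘ Sum.inl) j) (w ∘ Sum.inr) := by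
      funext v
      rcases v with (i | j) | a
      · exact e.injective.extend_apply _ _ (Sum.inl i)
      · rw [Function.extend_apply']
        · simp [hw']
        · rintro ⟨_ | _, h⟩ <;> simp [he] at h
      · exact e.injective.extend_apply _ _ (Sum.inr a)
    rw [h3]
    have h4 : (Sum.elim (Sum.elim (w ∘ Sum.inl) j) (w ∘ Sum.inr) = Sum.elim x fun _ => false) ↔
        (j = x ∘ Sum.inr) ∧ w = Sum.elim (x ∘ Sum.inl) fun _ => false := by
      simp only [funext_iff, Sum.forall, Sum.elim_inl, Sum.elim_inr, Function.comp_apply]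
      tauto
    simp only [basisAmp, h4, ite_and, ite_mul, one_mul, zero_mul]
  rw [amp, final_eq_run, QGate.run_map, h2, QGate.run_const_mul, h1]
  simp only [ite_mul, one_mul, zero_mul]
  rfl

theorem expect_ctx [DecidableEq I] [Fintype O] [DecidableEq O] (C : QCircuit I O) {J : Type} [DecidableEq J]
    [Fintype J] (x : Bits (I ⊕ J)) (f : Bits (O ⊕ J) → ℝ) :
    (C.ctx J).expect x f = C.expect (x ∘ Sum.inl) (fun y => f (Sum.elim y (x ∘ Sum.inr))) := by
  simp only [expect, sum_bits_sum, amp_ctx]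
  refine Finset.sum_congr rfl fun y _ => ?_
  rw [Finset.sum_eq_single (x ∘ Sum.inr)]
  · simp
  · intro j _ hj
    simp [hj]
  · simp

theorem size_ctx (C : QCircuit I O) (J : Type) [Fintype J] :
    (C.ctx J).size = C.size + Fintype.card J := by
  simp only [size, List.length_map, Fintype.card_sum]; ring

/-! ### Composition -/

/-- Run `C`, measure its output, and run `D` on the result. -/
abbrev seq [Fintype O] [DecidableEq O] (C : QCircuit I O) (D : QCircuit O P) : QCircuit I P where
  Aux := C.Aux ⊕ (O ⊕ D.Aux)
  Garb := D.Garb ⊕ (O ⊕ C.Garb)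
  gates := C.gates.map (QGate.map (Function.Embedding.sumMap (.refl _) .inl)) ++
    ((Finset.univ.toList.map fun o : O => QGate.cnot
      (Sum.map id Sum.inl (C.out.symm (Sum.inl o))) (Sum.inr (Sum.inr (Sum.inl o)))
        (by rcases C.out.symm (Sum.inl o) with _ | _ <;> simp)) ++
    D.gates.map (QGate.map (Function.Embedding.trans .inr .inr)))
  out := ((Equiv.sumAssoc I C.Aux (O ⊕ D.Aux)).symm.trans <| (Equiv.sumCongr C.out D.out).trans <|
    (Equiv.sumComm _ _).trans (Equiv.sumAssoc P D.Garb (O ⊕ C.Garb)))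

/-- Deferred measurement: the output `y` of `C` is copied by controlled-nots and the original goes
to the garbage. Different `y` therefore never interfere, and the amplitude is a product instead of a
sum over `y`. -/
theorem amp_seq [DecidableEq I] [Fintype O] [DecidableEq O] (C : QCircuit I O) (D : QCircuit O P) (x : Bits I)
    (p : Bits P) (g₂ : Bits D.Garb) (y : Bits O) (g₁ : Bits C.Garb) :
    (C.seq D).amp x p (Sum.elim g₂ (Sum.elim y g₁)) = C.amp x y g₁ * D.amp y p g₂ := by
  set e₁ : I ⊕ C.Aux ↪ I ⊕ (C.Aux ⊕ (O ⊕ D.Aux)) :=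
    Function.Embedding.sumMap (.refl _) .inl with he₁
  set e₂ : O ⊕ D.Aux ↪ I ⊕ (C.Aux ⊕ (O ⊕ D.Aux)) := Function.Embedding.trans .inr .inr with he₂
  set w' : Bits (I ⊕ (C.Aux ⊕ (O ⊕ D.Aux))) := fun w =>
    Sum.elim p (Sum.elim g₂ (Sum.elim y g₁)) ((C.seq D).out w) with hw'
  have h1 : w' ∘ e₁ = fun w => Sum.elim y g₁ (C.out w) := by
    funext w
    rcases h : C.out w with o | g <;> rcases w with w | w <;> simp [he₁, hw', h]
  have h2 : w' ∘ e₂ = fun w => Sum.elim p g₂ (D.out w) := by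
    funext w
    rcases h : D.out w with o | g <;> simp [he₂, hw', h]
  have h3 : ∀ w : Bits (O ⊕ D.Aux), Function.extend e₂ w w' ∘ e₁ = w' ∘ e₁ := by
    intro w
    funext v
    simp only [Function.comp_apply]
    rw [Function.extend_apply']
    rintro ⟨u, hu⟩
    rcases v with v | v <;> simp [he₁, he₂] at hu
  have hb : Function.Injective fun o : O => e₂ (Sum.inl o) := fun a b h => by
    simpa using e₂.injective h
  have hab : ∀ o o' : O, e₁ (C.out.symm (Sum.inl o)) ≠ e₂ (Sum.inl o') := by
    intro o o'
    rcases C.out.symm (Sum.inl o) with _ | _ <;> simp [he₁, he₂]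
  rw [amp, final_eq_run, QGate.run_append, QGate.run_append, QGate.run_map]
  -- With the wires of `C` frozen at `y, g₁`, the state entering `D` is a multiple of the basis
  -- state `|y⟩|0…0⟩`.
  have h4 : (fun w => QGate.run (Finset.univ.toList.map fun o : O => QGate.cnot
      (e₁ (C.out.symm (Sum.inl o))) (e₂ (Sum.inl o)) (hab o o))
      (QGate.run (C.gates.map (QGate.map e₁)) (basisAmp (Sum.elim x fun _ => false)))
      (Function.extend e₂ w w')) =
      fun w => C.amp x y g₁ * basisAmp (Sum.elim y fun _ => false) w := by
    funext w
    rw [QGate.run_cnot_univ hb hab, QGate.run_map]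
    have h5 : ∀ u : Bits (I ⊕ C.Aux), Function.extend e₁ u (Function.extend
        (fun o : O => e₂ (Sum.inl o)) (fun o => xor (Function.extend e₂ w w' (e₂ (Sum.inl o)))
          (Function.extend e₂ w w' (e₁ (C.out.symm (Sum.inl o))))) (Function.extend e₂ w w')) =
        Sum.elim (u ∘ Sum.inl) (Sum.elim (u ∘ Sum.inr)
          (Sum.elim (fun o => xor (w (Sum.inl o)) (y o)) (w ∘ Sum.inr))) := by
      intro u
      funext v
      rcases v with i | a | o | a
      · exact e₁.injective.extend_apply _ _ (Sum.inl i)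
      · exact e₁.injective.extend_apply _ _ (Sum.inr a)
      · rw [Function.extend_apply']
        · refine (hb.extend_apply _ _ o).trans ?_
          rw [e₂.injective.extend_apply]
          have := congrFun (h3 w) (C.out.symm (Sum.inl o))
          rw [h1] at this
          simp only [Function.comp_apply] at this
          rw [this]
          simp
        · rintro ⟨_ | _, h⟩ <;> simp [he₁] at h
      · rw [Function.extend_apply', Function.extend_apply']
        · exact e₂.injective.extend_apply _ _ (Sum.inr a)
        · rintro ⟨_, h⟩; simp [he₂] at h
        · rintro ⟨_ | _, h⟩ <;> simp [he₁] at h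
    have h6 : (Function.extend (fun o : O => e₂ (Sum.inl o)) (fun o =>
        xor (Function.extend e₂ w w' (e₂ (Sum.inl o)))
          (Function.extend e₂ w w' (e₁ (C.out.symm (Sum.inl o))))) (Function.extend e₂ w w')) ∘
        e₁ = fun w => Sum.elim y g₁ (C.out w) := by
      rw [← h1, ← h3 w]
      funext v
      simp only [Function.comp_apply]
      rw [Function.extend_apply']
      rintro ⟨u, hu⟩
      rcases v with v | v <;> simp [he₁, he₂] at hu
    have h7 : ∀ u : Bits (I ⊕ C.Aux), basisAmp (Sum.elim x fun _ => false)
        (Sum.elim (u ∘ Sum.inl) (Sum.elim (u ∘ Sum.inr)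
          (Sum.elim (fun o => xor (w (Sum.inl o)) (y o)) (w ∘ Sum.inr)))) =
        basisAmp (Sum.elim y fun _ => false) w * basisAmp (Sum.elim x fun _ => false) u := by
      intro u
      have : (Sum.elim (u ∘ Sum.inl) (Sum.elim (u ∘ Sum.inr)
          (Sum.elim (fun o => xor (w (Sum.inl o)) (y o)) (w ∘ Sum.inr))) =
          Sum.elim x fun _ => false) ↔
          (w = Sum.elim y fun _ => false) ∧ u = Sum.elim x fun _ => false := by
        simp only [funext_iff, Sum.forall, Sum.elim_inl, Sum.elim_inr, Function.comp_apply,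
          bne_eq_false_iff_eq]
        tauto
      simp only [basisAmp, this, ite_and, ite_mul, one_mul, zero_mul]
    simp only [h5, h6, h7]
    rw [QGate.run_const_mul, mul_comm]
    rfl
  refine (congrArg (fun ψ => QGate.run D.gates ψ (w' ∘ e₂)) h4).trans ?_
  rw [QGate.run_const_mul, h2]
  rfl

theorem expect_seq [DecidableEq I] [Fintype O] [DecidableEq O] [Fintype P] [DecidableEq P] (C : QCircuit I O)
    (D : QCircuit O P) (x : Bits I) (f : Bits P → ℝ) :
    (C.seq D).expect x f = C.expect x (fun y => D.expect y f) := by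
  simp only [expect, sum_bits_sum, amp_seq, norm_mul, mul_pow, Finset.mul_sum]
  rw [sum_sum_sum_sum_comm]
  exact Finset.sum_congr rfl fun _ _ => Finset.sum_congr rfl fun _ _ =>
    Finset.sum_congr rfl fun _ _ => Finset.sum_congr rfl fun _ _ => by ring

theorem size_seq [Fintype O] [DecidableEq O] (C : QCircuit I O) (D : QCircuit O P) :
    (C.seq D).size = C.size + D.size + Fintype.card O := by
  simp only [size, List.length_append, List.length_map, Fintype.card_sum, Finset.length_toList,
    Finset.card_univ]
  ring

end QCircuit

/-! ## Simulation of randomized circuits by quantum circuits -/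

/-- Flip the wire `j` if `F` holds. -/
def flipIf {W : Type} [DecidableEq W] (j : W) (F : Bits W → Bool) (ψ : Bits W → ℂ) :
    Bits W → ℂ :=
  fun w => ψ (Function.update w j (xor (w j) (F w)))

/-- A sequence of quantum gates that adds the value of a Boolean function of two wires to another
wire. -/
def boolGates {W : Type} [DecidableEq W] (op : Bool → Bool → Bool) (a b j : W) (ha : a ≠ j)
    (hb : b ≠ j) : List (QGate W) :=
  (if op false false then [.x j] else []) ++
  ((if xor (op true false) (op false false) then [.cnot a j ha] else []) ++
  ((if xor (op false true) (op false false) then [.cnot b j hb] else []) ++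
  (if xor (xor (op true true) (op true false)) (xor (op false true) (op false false)) then
    if hab : a = b then [.cnot a j ha] else [.toffoli a b j hab ha hb] else [])))

theorem length_boolGates {W : Type} [DecidableEq W] (op : Bool → Bool → Bool) (a b j : W)
    (ha : a ≠ j) (hb : b ≠ j) : (boolGates op a b j ha hb).length ≤ 4 := by
  unfold boolGates
  split_ifs <;> simp

/-- The gates are the monomials of the algebraic normal form of `op` over the field with two
elements: constant, two linear terms, and the product. When `a = b` the product is the bit itself,
so a controlled-not replaces the Toffoli gate, which needs distinct controls. -/
theorem run_boolGates {W : Type} [DecidableEq W] (op : Bool → Bool → Bool) (a b j : W) (ha : a ≠ j)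
    (hb : b ≠ j) (ψ : Bits W → ℂ) :
    QGate.run (boolGates op a b j ha hb) ψ = flipIf j (fun w => op (w a) (w b)) ψ := by
  have h1 : QGate.run (if op false false then [QGate.x j] else []) =
      flipIf j (fun _ => op false false) := by
    cases op false false <;> funext ψ w <;> simp [flipIf, QGate.apply]
  have h2 : ∀ k (c : W) (hc : c ≠ j), QGate.run (if k = true then [QGate.cnot c j hc] else []) =
      flipIf j (fun w => k && w c) := by
    intro k c hc
    cases k <;> funext ψ w <;> simp [flipIf, QGate.apply]
  have h3 : ∀ k, QGate.run (if k = true then if hab : a = b then [QGate.cnot a j ha] else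
      [QGate.toffoli a b j hab ha hb] else []) = flipIf j (fun w => k && (w a && w b)) := by
    intro k
    cases k <;> funext ψ w <;> split_ifs with h <;> simp_all [flipIf, QGate.apply]
  simp only [boolGates, QGate.run_append, h1, h2, h3]
  funext w
  simp only [flipIf, Function.update_idem, Function.update_self, Function.update_of_ne ha,
    Function.update_of_ne hb]
  congr 2
  generalize w a = p, w b = q, w j = r
  cases p <;> cases q <;> cases r <;> cases op false false <;> cases op false true <;>
    cases op true false <;> cases op true true <;> rfl

namespace QCircuit

variable {I O : Type} [Fintype I] [DecidableEq I]

/-- Output the input together with random bits and zeros. -/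
abbrev init (I R A : Type) [Fintype R] [DecidableEq R] [Fintype A] [DecidableEq A] :
    QCircuit I (I ⊕ (R ⊕ A)) where
  Aux := R ⊕ A
  Garb := Empty
  gates := Finset.univ.toList.map fun r : R => QGate.h (Sum.inr (Sum.inl r))
  out := (Equiv.sumEmpty _ _).symm

theorem expect_init (R A : Type) [Fintype R] [DecidableEq R] [Fintype A] [DecidableEq A]
    (x : Bits I) (f : Bits (I ⊕ (R ⊕ A)) → ℝ) :
    (init I R A).expect x f =
      (∑ r : Bits R, f (Sum.elim x (Sum.elim r fun _ => false))) / 2 ^ Fintype.card R := by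
  have hb : Function.Injective fun r : R => (Sum.inr (Sum.inl r) : I ⊕ (R ⊕ A)) :=
    fun _ _ h => by simpa using h
  have hs : ‖((Real.sqrt 2 : ℝ) : ℂ)⁻¹ ^ Fintype.card R‖ ^ 2 = 1 / 2 ^ Fintype.card R := by
    rw [norm_pow, norm_inv, Complex.norm_real, Real.norm_of_nonneg (Real.sqrt_nonneg 2), ← pow_mul,
      mul_comm, pow_mul, inv_pow, Real.sq_sqrt (by norm_num)]
    simp
  have hf : ∀ (y : Bits I) (r : Bits R) (a : Bits A),
      (init I R A).final x (Sum.elim y (Sum.elim r a)) =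
        if y = x ∧ a = fun _ => false then ((Real.sqrt 2 : ℝ) : ℂ)⁻¹ ^ Fintype.card R else 0 := by
    intro y r a
    rw [final_eq_run, QGate.run_h_basisAmp hb (fun _ => rfl) _ (Finset.nodup_toList _)]
    have : (∀ v : I ⊕ (R ⊕ A), (∀ r ∈ (Finset.univ : Finset R).toList, Sum.inr (Sum.inl r) ≠ v) →
        (Sum.elim y (Sum.elim r a) : Bits (I ⊕ (R ⊕ A))) v =
          (Sum.elim x fun _ => false : Bits (I ⊕ (R ⊕ A))) v) ↔ y = x ∧ a = fun _ => false := by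
      simp [funext_iff]
    simp only [this, Finset.length_toList, Finset.card_univ]
  rw [expect_eq_sum_final]
  simp only [sum_bits_sum, hf]
  rw [Finset.sum_eq_single x]
  · rw [Finset.sum_div]
    refine Finset.sum_congr rfl fun r _ => ?_
    rw [Finset.sum_eq_single fun _ => false]
    · simp only [and_self, if_true, hs]
      rw [div_mul_eq_mul_div, one_mul]
      rfl
    · intro a _ ha
      simp [ha]
    · simp
  · intro y _ hy
    simp [hy]
  · simp

/-- Simulation of a Boolean gate. -/
abbrev ofGate (g : BoolGate I) : QCircuit I I where
  Aux := Unit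
  Garb := Unit
  gates := boolGates g.op (Sum.inl g.src₁) (Sum.inl g.src₂) (Sum.inr ()) (by simp) (by simp)
  out := Equiv.swap (Sum.inl g.tgt) (Sum.inr ())

/-- Assignment is not reversible, and a gate may read its own target. The new value is computed on
an ancilla, and the output permutation exchanges it with the old target, which is discarded. -/
theorem expect_ofGate (g : BoolGate I) (x : Bits I) (f : Bits I → ℝ) :
    (ofGate g).expect x f = f (g.apply x) := by
  rw [expect_of_final_eq _ _ (Sum.elim x fun _ => g.op (x g.src₁) (x g.src₂))]
  · congr 1
    funext i
    by_cases hi : i = g.tgt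
    · subst hi
      simp [BoolGate.apply]
    · rw [Equiv.symm_swap, Equiv.swap_apply_of_ne_of_ne (by simpa using hi) (by simp)]
      simp [BoolGate.apply, hi]
  · rw [final_eq_run, run_boolGates]
    funext w
    simp only [flipIf, basisAmp]
    congr 1
    simp only [funext_iff, Sum.forall, eq_iff_iff]
    simp only [ne_eq, reduceCtorEq, not_false_eq_true, Function.update_of_ne, Sum.elim_inl,
      Function.update_self, Sum.elim_inr, bne_eq_false_iff_eq]
    refine and_congr_right fun h => ?_
    simp only [h]

/-- Simulation of a sequence of Boolean gates. -/
def ofGates : List (BoolGate I) → QCircuit I I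
  | [] => ⟨Empty, Empty, [], Equiv.refl _⟩
  | g :: gs => (ofGate g).seq (ofGates gs)

theorem expect_ofGates (gs : List (BoolGate I)) (x : Bits I) (f : Bits I → ℝ) :
    (ofGates gs).expect x f = f (gs.foldl (fun s g => g.apply s) x) := by
  induction gs generalizing x with
  | nil => exact expect_of_final_eq _ _ (Sum.elim x fun _ => false) rfl f
  | cons g gs ih => rw [ofGates, expect_seq, expect_ofGate, ih, List.foldl_cons]

/-- Each Boolean gate costs at most four quantum gates, one ancilla and the wires of its register,
plus the register once more for the copying in `seq`. -/
theorem size_ofGates (gs : List (BoolGate I)) :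
    (ofGates gs).size ≤ gs.length * (5 + 2 * Fintype.card I) + Fintype.card I := by
  induction gs with
  | nil =>
    simp only [ofGates, size, List.length_nil, zero_mul, zero_add]
    exact (Nat.add_eq_left.2 Fintype.card_empty).le
  | cons g gs ih =>
    have : (ofGate g).size ≤ 5 + Fintype.card I := by
      have := length_boolGates g.op (Sum.inl g.src₁) (Sum.inl g.src₂) (Sum.inr () : I ⊕ Unit)
        (by simp) (by simp)
      simp only [size, Fintype.card_unit]
      omega
    rw [ofGates, size_seq, List.length_cons, add_mul, one_mul]
    omega

/-- Output copies of some input wires. -/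
abbrev route [Fintype O] [DecidableEq O] (e : O → I) : QCircuit I O where
  Aux := O
  Garb := I
  gates := Finset.univ.toList.map fun o => QGate.cnot (Sum.inl (e o)) (Sum.inr o) (by simp)
  out := Equiv.sumComm I O

theorem expect_route [Fintype O] [DecidableEq O] (e : O → I) (x : Bits I) (f : Bits O → ℝ) :
    (route e).expect x f = f (x ∘ e) := by
  rw [expect_of_final_eq _ _ (Sum.elim x (x ∘ e))]
  · rfl
  · funext w
    rw [final_eq_run, QGate.run_cnot_univ (a := fun o => Sum.inl (e o)) Sum.inr_injective
      (by simp)]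
    simp only [basisAmp]
    congr 1
    simp only [funext_iff, Sum.forall, eq_iff_iff]
    have h1 : ∀ (u : Bits O) (i : I), Function.extend Sum.inr u w (Sum.inl i) = w (Sum.inl i) :=
      fun u i => Function.extend_apply' _ _ _ (by simp)
    simp only [h1, Sum.inr_injective.extend_apply, Sum.elim_inl, Sum.elim_inr, Function.comp_apply,
      bne_eq_false_iff_eq]
    refine and_congr_right fun h => ?_
    simp [h]

/-- Simulation of a randomized circuit. -/
def ofRand [Fintype O] [DecidableEq O] (C : RandCircuit I O) : QCircuit I O :=
  (init I C.Rnd C.Aux).seq ((ofGates C.gates).seq (route C.out))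

theorem expect_ofRand [Fintype O] [DecidableEq O] (C : RandCircuit I O) (x : Bits I)
    (f : Bits O → ℝ) : (ofRand C).expect x f = C.expect x f := by
  simp only [ofRand, expect_seq, expect_ofGates, expect_route, expect_init]
  rfl

theorem size_ofRand [Fintype O] [DecidableEq O] (C : RandCircuit I O) :
    (ofRand C).size ≤ C.size * (5 + 2 * C.size) + 7 * C.size := by
  have h1 : Fintype.card (I ⊕ (C.Rnd ⊕ C.Aux)) ≤ C.size := by
    simp only [RandCircuit.size, Fintype.card_sum]; omega
  have h2 : C.gates.length ≤ C.size := by unfold RandCircuit.size; omega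
  have h3 := size_ofGates C.gates
  have h4 : C.gates.length * (5 + 2 * Fintype.card (I ⊕ (C.Rnd ⊕ C.Aux))) ≤
      C.size * (5 + 2 * C.size) := by gcongr
  have h5 : (route C.out).size + (init I C.Rnd C.Aux).size ≤ 4 * C.size := by
    simp only [size, List.length_map, Finset.length_toList, Finset.card_univ, Fintype.card_sum,
      RandCircuit.size]
    omega
  rw [ofRand, size_seq, size_seq]
  omega

end QCircuit

/-! ### Closure of quantum polynomial time under these constructions -/

theorem QPT.seq {I O P : ℕ → Type} [∀ l, Fintype (I l)] [∀ l, Fintype (O l)]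
    [∀ l, DecidableEq (O l)] {C : ∀ l, QCircuit (I l) (O l)} {D : ∀ l, QCircuit (O l) (P l)}
    (hC : QPT C) (hD : QPT D) : QPT (fun l => (C l).seq (D l)) :=
  ((PolyBounded.add hC hD).add hD).mono fun l => by
    rw [QCircuit.size_seq]
    have : Fintype.card (O l) ≤ (D l).size := by unfold QCircuit.size; omega
    omega

theorem QPT.ctx {I O J : ℕ → Type} [∀ l, Fintype (I l)] [∀ l, Fintype (J l)]
    {C : ∀ l, QCircuit (I l) (O l)} (hC : QPT C)
    (hJ : PolyBounded fun l => Fintype.card (J l)) : QPT (fun l => (C l).ctx (J l)) :=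
  (PolyBounded.add hC hJ).mono fun _ => (QCircuit.size_ctx _ _).le

theorem PPT.ofRand {I O : ℕ → Type} [∀ l, Fintype (I l)] [∀ l, Fintype (O l)]
    [∀ l, DecidableEq (I l)] [∀ l, DecidableEq (O l)] {C : ∀ l, RandCircuit (I l) (O l)}
    (hC : PPT C) : QPT (fun l => QCircuit.ofRand (C l)) :=
  ((PolyBounded.mul hC ((PolyBounded.const 5).add ((PolyBounded.const 2).mul hC))).add
    ((PolyBounded.const 7).mul hC)).mono fun _ => QCircuit.size_ofRand _

/-! ## The state of a register after a measurement -/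

namespace QCircuit

variable {I Q M : Type} [DecidableEq I] [Fintype I] [Fintype Q] [DecidableEq Q] [Fintype M]
  [DecidableEq M]

omit [Fintype M] [DecidableEq M] in
theorem norm_sq_branch (C : QCircuit I (Q ⊕ M)) (x : Bits I) (m : Bits M) (g : Bits C.Garb) :
    ‖C.branch x m g‖ ^ 2 = ∑ q, ‖C.amp x (Sum.elim q m) g‖ ^ 2 :=
  EuclideanSpace.norm_sq_eq _

/-- Measuring both registers at once amounts to measuring `M` and then measuring `Q` in the
post-measurement state. -/
theorem expect_eq_expectState (C : QCircuit I (Q ⊕ M)) (x : Bits I) (f : Bits (Q ⊕ M) → ℝ) :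
    C.expect x f = C.expectState x fun ψ m => ∑ q, ‖ψ q‖ ^ 2 * f (Sum.elim q m) := by
  simp only [expect, expectState, sum_bits_sum]
  rw [Finset.sum_comm]
  refine Finset.sum_congr rfl fun m _ => ?_
  rw [Finset.sum_comm]
  refine Finset.sum_congr rfl fun g _ => ?_
  rw [Finset.mul_sum]
  refine Finset.sum_congr rfl fun q _ => ?_
  -- A branch of probability zero is normalized to the zero vector, but it carries weight zero.
  rcases eq_or_ne (C.branch x m g) 0 with h | h
  · have : C.amp x (Sum.elim q m) g = 0 := congrArg (fun v : EuclideanSpace ℂ _ => v q) h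
    simp [h, this]
  · have h' : ‖C.branch x m g‖ ≠ 0 := norm_ne_zero_iff.2 h
    have : ‖(((‖C.branch x m g‖⁻¹ : ℝ) : ℂ) • C.branch x m g) q‖ ^ 2 =
        (‖C.branch x m g‖ ^ 2)⁻¹ * ‖C.amp x (Sum.elim q m) g‖ ^ 2 := by
      rw [PiLp.smul_apply, norm_smul, mul_pow, Complex.norm_real, Real.norm_eq_abs, sq_abs, inv_pow]
      rfl
    rw [this]
    field_simp

/-- The support condition is `‖ψ‖ ≤ 1` and not `‖ψ‖ = 1` because zero branches are normalized to the
zero vector. -/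
theorem isExp_expectState (C : QCircuit I (Q ⊕ M)) (x : Bits I) :
    IsExp {p : EuclideanSpace ℂ (Bits Q) × Bits M | ‖p.1‖ ≤ 1}
      (fun f => C.expectState x fun ψ m => f (ψ, m)) := by
  refine ⟨Bits M × Bits C.Garb, inferInstance, fun p => ‖C.branch x p.1 p.2‖ ^ 2, fun p =>
    (((‖C.branch x p.1 p.2‖⁻¹ : ℝ) : ℂ) • C.branch x p.1 p.2, p.1), fun _ => by positivity, ?_,
    fun p => ?_, fun f => ?_⟩
  · have := (C.isExp_expect x).const 1
    simp only [expect, sum_bits_sum, mul_one] at this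
    rw [Finset.sum_comm] at this
    simp only [Fintype.sum_prod_type, norm_sq_branch]
    rw [← this]
    exact Finset.sum_congr rfl fun m _ => Finset.sum_comm
  · simp only [Set.mem_ofPred_eq, norm_smul, Complex.norm_real, norm_inv, norm_norm]
    exact inv_mul_le_one
  · simp only [expectState, Fintype.sum_prod_type]

end QCircuit

/-! ## The algorithms of the encryption scheme -/

section Scheme

variable {S T R : Type}

theorem amp_encCircuit [Fintype S] [DecidableEq S] (C : QCircuit S ((Unit ⊕ Fin 1) ⊕ R))
    (z : Bits (S ⊕ Unit)) (r : Bits R) (b m : Bits Unit) (q : Bits (Fin 1)) (g : Bits C.Garb) :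
    (encCircuit C).amp z (Sum.elim r (Sum.elim b m)) (Sum.elim q g) =
      if m = fun _ => xor (z (Sum.inr ())) (q 0) then
        C.amp (z ∘ Sum.inl) (Sum.elim (Sum.elim b q) r) g else 0 := by
  set e : S ⊕ C.Aux ↪ (S ⊕ Unit) ⊕ C.Aux := encEmb C.Aux with he
  set w' : Bits ((S ⊕ Unit) ⊕ C.Aux) := fun w =>
    Sum.elim (Sum.elim r (Sum.elim b m)) (Sum.elim q g) (encOut C.out w) with hw'
  have h1 : w' ∘ e = fun w => Sum.elim (Sum.elim (Sum.elim b q) r) g (C.out w) := by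
    funext w
    rcases h : C.out w with ((_ | _) | _) | _ <;> rcases w with w | w <;>
      simp [he, hw', h, encEmb, encOut]
  have h2 : w' (Sum.inl (Sum.inr ())) = m () := rfl
  set i : (S ⊕ Unit) ⊕ C.Aux := e (C.out.symm (Sum.inl (Sum.inl (Sum.inr 0)))) with hi
  have h3 : w' i = q 0 := by
    have := congrFun h1 (C.out.symm (Sum.inl (Sum.inl (Sum.inr 0))))
    simpa using this
  -- The configuration just before the final controlled-not; its message wire must still hold the
  -- input bit, which forces `m` to be that bit plus `q 0`.
  set w'' := Function.update w' (Sum.inl (Sum.inr ())) (xor (m ()) (q 0)) with hw''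
  have h4 : w'' ∘ e = w' ∘ e := by
    funext v
    rw [Function.comp_apply, hw'', Function.update_of_ne]
    · rfl
    · rcases v with v | v <;> simp [he, encEmb]
  have h5 : (fun w => basisAmp (Sum.elim z fun _ => false) (Function.extend e w w'')) =
      fun w => (if m = fun _ => xor (z (Sum.inr ())) (q 0) then 1 else 0) *
        basisAmp (Sum.elim (z ∘ Sum.inl) fun _ => false) w := by
    funext w
    have h6 : Function.extend e w w'' =
        Sum.elim (Sum.elim (w ∘ Sum.inl) fun _ => xor (m ()) (q 0)) (w ∘ Sum.inr) := by
      funext v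
      rcases v with (i | j) | a
      · exact e.injective.extend_apply _ _ (Sum.inl i)
      · rw [Function.extend_apply']
        · simp [hw'']
        · rintro ⟨_ | _, h⟩ <;> simp [he, encEmb] at h
      · exact e.injective.extend_apply _ _ (Sum.inr a)
    have h7 : (Sum.elim (Sum.elim (w ∘ Sum.inl) fun _ => xor (m ()) (q 0)) (w ∘ Sum.inr) =
        Sum.elim z fun _ => false) ↔
        (m = fun _ => xor (z (Sum.inr ())) (q 0)) ∧
          w = Sum.elim (z ∘ Sum.inl) fun _ => false := by
      have h8 : xor (m ()) (q 0) = z (Sum.inr ()) ↔ m () = xor (z (Sum.inr ())) (q 0) := by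
        cases m () <;> cases q 0 <;> cases z (Sum.inr ()) <;> decide
      simp only [funext_iff, Sum.forall, Sum.elim_inl, Sum.elim_inr, Function.comp_apply,
        forall_const, h8]
      tauto
    rw [h6]
    simp only [basisAmp, h7, ite_and, ite_mul, one_mul, zero_mul]
  rw [QCircuit.amp, QCircuit.final_eq_run, QGate.run_append, QGate.run_cons, QGate.run_nil]
  change QGate.run (C.gates.map (QGate.map e)) _ (Function.update w' (Sum.inl (Sum.inr ()))
    (xor (w' (Sum.inl (Sum.inr ()))) (w' i))) = _
  rw [h2, h3, QGate.run_map, h5, QGate.run_const_mul, h4, h1]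
  simp only [ite_mul, one_mul, zero_mul]
  rfl

/-- For each measured `q` a single value of the message qubit has nonzero amplitude, so adding
coherently and then discarding `x_b` has the same statistics as measuring first and adding
classically. -/
theorem expect_encCircuit [Fintype S] [DecidableEq S] [Fintype R] [DecidableEq R]
    (C : QCircuit S ((Unit ⊕ Fin 1) ⊕ R)) (z : Bits (S ⊕ Unit))
    (f : Bits (R ⊕ (Unit ⊕ Unit)) → ℝ) :
    (encCircuit C).expect z f = C.expect (z ∘ Sum.inl) fun y => f (Sum.elim (y ∘ Sum.inr)
      (Sum.elim (fun _ => y (Sum.inl (Sum.inl ())))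
        fun _ => xor (z (Sum.inr ())) (y (Sum.inl (Sum.inr 0))))) := by
  simp only [QCircuit.expect, sum_bits_sum, amp_encCircuit]
  have : ∀ (r : Bits R) (b : Bits Unit),
      ∑ m : Bits Unit, ∑ q : Bits (Fin 1), ∑ g : Bits C.Garb,
        ‖if m = fun _ => xor (z (Sum.inr ())) (q 0) then
          C.amp (z ∘ Sum.inl) (Sum.elim (Sum.elim b q) r) g else 0‖ ^ 2 *
          f (Sum.elim r (Sum.elim b m)) =
      ∑ q : Bits (Fin 1), ∑ g : Bits C.Garb,
        ‖C.amp (z ∘ Sum.inl) (Sum.elim (Sum.elim b q) r) g‖ ^ 2 *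
          f (Sum.elim r (Sum.elim b fun _ => xor (z (Sum.inr ())) (q 0))) := by
    intro r b
    rw [Finset.sum_comm]
    refine Finset.sum_congr rfl fun q _ => ?_
    rw [Finset.sum_eq_single fun _ => xor (z (Sum.inr ())) (q 0)]
    · simp
    · intro m _ hm
      simp [hm]
    · simp
  simp only [this]
  rw [Finset.sum_comm]
  refine Finset.sum_congr rfl fun b _ => ?_
  rw [Finset.sum_comm]
  rfl

theorem eval_decCircuit [DecidableEq T] [DecidableEq R]
    (C : RandCircuit (T ⊕ R) (Fin 1 ⊕ (Fin 1 ⊕ Unit))) (z : Bits (T ⊕ (R ⊕ (Unit ⊕ Unit))))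
    (r : Bits C.Rnd) :
    (decCircuit C).eval z r = fun _ => xor (z (Sum.inr (Sum.inr (Sum.inr ()))))
      (if z (Sum.inr (Sum.inr (Sum.inl ()))) then
        clawX₁ (C.eval (Sum.elim (z ∘ Sum.inl) (z ∘ Sum.inr ∘ Sum.inl)) r) 0 else
        clawX₀ (C.eval (Sum.elim (z ∘ Sum.inl) (z ∘ Sum.inr ∘ Sum.inl)) r) 0) := by
  have he : Function.Injective (decEmb (T := T) (R := R) C.Rnd C.Aux) :=
    Sum.map_injective.2 ⟨Sum.map_injective.2 ⟨Function.injective_id, Sum.inl_injective⟩,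
      Sum.map_injective.2 ⟨Function.injective_id, Sum.inl_injective⟩⟩
  have hs : (Sum.elim z (Sum.elim r fun _ => false) :
      Bits ((T ⊕ (R ⊕ (Unit ⊕ Unit))) ⊕ (C.Rnd ⊕ (C.Aux ⊕ Unit)))) ∘ decEmb C.Rnd C.Aux =
      Sum.elim (Sum.elim (z ∘ Sum.inl) (z ∘ Sum.inr ∘ Sum.inl)) (Sum.elim r fun _ => false) := by
    funext w; rcases w with (_ | _) | _ | _ <;> rfl
  have ht : ∀ w, decEmb (T := T) (R := R) C.Rnd C.Aux w ≠ Sum.inr (Sum.inr (Sum.inr ())) := by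
    rintro ((_ | _) | _ | _) <;> simp [decEmb]
  have hb : ∀ u, ¬∃ w, decEmb (T := T) (R := R) C.Rnd C.Aux w = Sum.inl (Sum.inr (Sum.inr u)) := by
    rintro u ⟨((_ | _) | _ | _), h⟩ <;> simp [decEmb] at h
  funext u
  simp only [RandCircuit.eval, List.foldl_append, BoolGate.foldl_map he, hs, List.foldl_cons,
    List.foldl_nil, clawX₀, clawX₁]
  generalize List.foldl _ _ C.gates = s
  simp only [BoolGate.apply, Function.update_self, Function.update_of_ne (ht _),
    he.extend_apply, ne_eq, reduceCtorEq, not_false_eq_true, Function.update_of_ne,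
    Function.extend_apply' _ _ _ (hb _), Sum.elim_inl]
  cases s (C.out (Sum.inl 0)) <;> cases s (C.out (Sum.inr (Sum.inl 0))) <;>
    cases z (Sum.inr (Sum.inr (Sum.inl ()))) <;> cases z (Sum.inr (Sum.inr (Sum.inr ()))) <;> rfl

theorem expect_decCircuit [DecidableEq T] [DecidableEq R]
    (C : RandCircuit (T ⊕ R) (Fin 1 ⊕ (Fin 1 ⊕ Unit))) (z : Bits (T ⊕ (R ⊕ (Unit ⊕ Unit))))
    (f : Bits Unit → ℝ) :
    (decCircuit C).expect z f = C.expect (Sum.elim (z ∘ Sum.inl) (z ∘ Sum.inr ∘ Sum.inl)) fun d =>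
      f fun _ => xor (z (Sum.inr (Sum.inr (Sum.inr ()))))
        (if z (Sum.inr (Sum.inr (Sum.inl ()))) then clawX₁ d 0 else clawX₀ d 0) := by
  simp only [RandCircuit.expect, eval_decCircuit]

theorem efficient_pkeOfCSG {P : TwoRoundCSG (fun _ => 1)} (hP : P.Efficient) :
    (pkeOfCSG P).Efficient := by
  refine ⟨hP.1, ?_, ?_⟩
  · refine (PolyBounded.add hP.2.1 (.const 2)).mono fun l => ?_
    simp only [QCircuit.size, List.length_append, List.length_map, List.length_singleton,
      Fintype.card_sum, Fintype.card_unit]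
    omega
  · refine (PolyBounded.add hP.2.2 (.const 7)).mono fun l => ?_
    simp only [RandCircuit.size, List.length_append, List.length_map, List.length_cons,
      List.length_nil, Fintype.card_sum, Fintype.card_unit, Fintype.card_fin]
    omega

end Scheme

/-! ## Honest executions of a claw-state generator -/

/-- Coordinatewise, `|a² - b²| = |a - b| (a + b)`, and the arithmetic-geometric mean inequality
bounds this by `(a - b)² / (2t) + t (a² + b²)`. The sum of `a b` over the coordinates dominates the
modulus of the inner product, which yields a bound linear in the infidelity. -/
theorem abs_sum_norm_sq_sub_le {ι : Type} [Fintype ι] (φ ψ : EuclideanSpace ℂ ι) (hφ : ‖φ‖ ≤ 1)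
    (hψ : ‖ψ‖ ≤ 1) (h : ι → ℝ) (hh : ∀ i, h i ∈ Set.Icc (0 : ℝ) 1) {t : ℝ} (ht : 0 < t) :
    |∑ i, ‖ψ i‖ ^ 2 * h i - ∑ i, ‖φ i‖ ^ 2 * h i| ≤ (1 - ‖(inner ℂ φ ψ : ℂ)‖) / t + 2 * t := by
  have h1 : ∑ i, ‖φ i‖ ^ 2 ≤ 1 := by
    rw [← EuclideanSpace.norm_sq_eq]; nlinarith [norm_nonneg φ]
  have h2 : ∑ i, ‖ψ i‖ ^ 2 ≤ 1 := by
    rw [← EuclideanSpace.norm_sq_eq]; nlinarith [norm_nonneg ψ]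
  have h3 : ‖(inner ℂ φ ψ : ℂ)‖ ≤ ∑ i, ‖φ i‖ * ‖ψ i‖ := by
    rw [PiLp.inner_apply]
    refine (norm_sum_le _ _).trans (Finset.sum_le_sum fun i _ => ?_)
    exact norm_inner_le_norm _ _
  have h4 : ∀ a b k : ℝ, 0 ≤ a → 0 ≤ b → k ∈ Set.Icc (0 : ℝ) 1 →
      |a ^ 2 * k - b ^ 2 * k| ≤ (a ^ 2 + b ^ 2 - 2 * (b * a)) / (2 * t) + t * (a ^ 2 + b ^ 2) := by
    intro a b k ha hb hk
    have h5 : |a ^ 2 * k - b ^ 2 * k| ≤ |a - b| * (a + b) := by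
      rw [show a ^ 2 * k - b ^ 2 * k = (a - b) * (a + b) * k by ring, abs_mul, abs_mul,
        abs_of_nonneg (add_nonneg ha hb), abs_of_nonneg hk.1]
      exact mul_le_of_le_one_right (by positivity) hk.2
    refine h5.trans ?_
    have h6 : (a ^ 2 + b ^ 2 - 2 * (b * a)) / (2 * t) + t * (a ^ 2 + b ^ 2) - |a - b| * (a + b) =
        ((|a - b| - t * (a + b)) ^ 2 + t ^ 2 * (a - b) ^ 2) / (2 * t) := by
      have := sq_abs (a - b)
      field_simp
      linear_combination (-1) * this
    have h7 : 0 ≤ ((|a - b| - t * (a + b)) ^ 2 + t ^ 2 * (a - b) ^ 2) / (2 * t) := by positivity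
    linarith
  rw [← Finset.sum_sub_distrib]
  refine (Finset.abs_sum_le_sum_abs _ _).trans ((Finset.sum_le_sum fun i _ =>
    h4 _ _ _ (norm_nonneg (ψ i)) (norm_nonneg (φ i)) (hh i)).trans ?_)
  rw [Finset.sum_add_distrib, ← Finset.sum_div, ← Finset.mul_sum, Finset.sum_sub_distrib,
    Finset.sum_add_distrib, ← Finset.mul_sum]
  refine add_le_add ?_ ?_
  · rw [div_le_div_iff₀ (by positivity) ht]
    nlinarith
  · nlinarith

theorem sum_norm_sq_clawState (x₀ x₁ : Bits (Fin 1)) (z : Bool) (h : Bits (Unit ⊕ Fin 1) → ℝ) :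
    ∑ q, ‖clawState x₀ x₁ z q‖ ^ 2 * h q =
      (h (Sum.elim (fun _ => false) x₀) + h (Sum.elim (fun _ => true) x₁)) / 2 := by
  -- The differentiating bit keeps the two kets orthogonal even when `x₀ = x₁`.
  have hne : (Sum.elim (fun _ => false) x₀ : Bits (Unit ⊕ Fin 1)) ≠ Sum.elim (fun _ => true) x₁ :=
    fun h => by simpa using congrFun h (Sum.inl ())
  have hs : ‖((Real.sqrt 2 : ℝ) : ℂ)⁻¹‖ ^ 2 = 1 / 2 := by
    rw [norm_inv, Complex.norm_real, Real.norm_of_nonneg (Real.sqrt_nonneg 2), inv_pow,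
      Real.sq_sqrt (by norm_num)]
    norm_num
  have hz : ‖sgn z‖ = 1 := by cases z <;> simp [sgn]
  have h1 : ∀ q, ‖clawState x₀ x₁ z q‖ ^ 2 * h q =
      (if q = Sum.elim (fun _ => false) x₀ then h q / 2 else 0) +
      (if q = Sum.elim (fun _ => true) x₁ then h q / 2 else 0) := by
    intro q
    simp only [clawState, ket, PiLp.smul_apply, PiLp.add_apply, norm_smul, mul_pow, hs,
      PiLp.single_apply]
    by_cases h0 : q = Sum.elim (fun _ => false) x₀
    · subst h0
      simp only [if_true, if_neg hne, smul_zero, add_zero, norm_one]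
      ring
    · by_cases h1 : q = Sum.elim (fun _ => true) x₁
      · subst h1
        simp only [if_true, if_neg h0, zero_add, norm_smul, hz, norm_one]
        ring
      · simp [h0, h1]
  simp only [h1, Finset.sum_add_distrib, Finset.sum_ite_eq', Finset.mem_univ, if_true]
  ring

theorem norm_clawState (x₀ x₁ : Bits (Fin 1)) (z : Bool) : ‖clawState x₀ x₁ z‖ = 1 := by
  have := sum_norm_sq_clawState x₀ x₁ z fun _ => 1
  simp only [mul_one, ← EuclideanSpace.norm_sq_eq] at this
  norm_num at this
  exact this.resolve_right fun h => by linarith [norm_nonneg (clawState x₀ x₁ z)]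

theorem projNorm_eq {Q : Type} [Fintype Q] [DecidableEq Q] {v : EuclideanSpace ℂ (Bits Q)}
    (hv : ‖v‖ = 1) (ψ : EuclideanSpace ℂ (Bits Q)) : projNorm v ψ = ‖(inner ℂ v ψ : ℂ)‖ := by
  rw [projNorm, norm_smul, hv, mul_one]

namespace TwoRoundCSG

variable (P : TwoRoundCSG (fun _ => 1))

/-- The expectation in an honest execution of a function of the sender's output, the receiver's
state and message, and the decoder's output. -/
def honest (l : ℕ) (f : Bits (P.MsgS l ⊕ P.St l) → EuclideanSpace ℂ (Bits (Unit ⊕ Fin 1)) →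
    Bits (P.MsgR l) → Bits (Fin 1 ⊕ (Fin 1 ⊕ Unit)) → ℝ) : ℝ :=
  (P.Sen l).expect Empty.elim fun y =>
    (P.Rec l).expectState (y ∘ Sum.inl) fun ψ m =>
      (P.Dec l).expect (Sum.elim (y ∘ Sum.inr) m) fun d => f y ψ m d

theorem isExp_honest (l : ℕ) : IsExp {p : Bits (P.MsgS l ⊕ P.St l) ×
    ((EuclideanSpace ℂ (Bits (Unit ⊕ Fin 1)) × Bits (P.MsgR l)) × Bits (Fin 1 ⊕ (Fin 1 ⊕ Unit))) |
      ‖p.2.1.1‖ ≤ 1} (fun f => P.honest l fun y ψ m d => f (y, ((ψ, m), d))) := by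
  have := ((P.Sen l).isExp_expect Empty.elim).bind (fun y =>
    ((P.Rec l).isExp_expectState (y ∘ Sum.inl)).bind fun p =>
      (P.Dec l).isExp_expect (Sum.elim (y ∘ Sum.inr) p.2))
  obtain ⟨ι, i, w, a, hw, h1, hS, hE⟩ := this
  exact ⟨ι, i, w, a, hw, h1, fun i => (hS i).2.1, hE⟩

theorem honest_sub (l : ℕ) (f g) :
    P.honest l (fun y ψ m d => f y ψ m d - g y ψ m d) = P.honest l f - P.honest l g :=
  (P.isExp_honest l).sub (fun p => f p.1 p.2.1.1 p.2.1.2 p.2.2)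
    (fun p => g p.1 p.2.1.1 p.2.1.2 p.2.2)

theorem honest_add (l : ℕ) (f g) :
    P.honest l (fun y ψ m d => f y ψ m d + g y ψ m d) = P.honest l f + P.honest l g :=
  (P.isExp_honest l).add (fun p => f p.1 p.2.1.1 p.2.1.2 p.2.2)
    (fun p => g p.1 p.2.1.1 p.2.1.2 p.2.2)

theorem honest_div_const (l : ℕ) (f) (k : ℝ) :
    P.honest l (fun y ψ m d => f y ψ m d / k) = P.honest l f / k :=
  (P.isExp_honest l).div_const k (fun p => f p.1 p.2.1.1 p.2.1.2 p.2.2)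

theorem honest_const (l : ℕ) (k : ℝ) : P.honest l (fun _ _ _ _ => k) = k :=
  (P.isExp_honest l).const k

variable {P}

/-- Measuring the receiver's state in the standard basis gives `(b, x_b)` for a uniform bit `b`, up
to a negligible error. -/
theorem negligible_honest_sub (hP : P.Correct) (h : ∀ l, Bits (P.MsgS l ⊕ P.St l) →
    Bits (P.MsgR l) → Bits (Fin 1 ⊕ (Fin 1 ⊕ Unit)) → Bool → Bool → ℝ)
    (hh : ∀ l y m d b x, h l y m d b x ∈ Set.Icc (0 : ℝ) 1) :
    Negligible fun l => P.honest l (fun y ψ m d => ∑ q, ‖ψ q‖ ^ 2 *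
        h l y m d (q (Sum.inl ())) (q (Sum.inr 0))) -
      P.honest l fun y _ m d =>
        (h l y m d false (clawX₀ d 0) + h l y m d true (clawX₁ d 0)) / 2 := by
  -- The pointwise bound is affine in the overlap, so its expectation is `(1 - fidelity) / t + 2 *
  -- t`, and correctness makes the numerator negligible.
  refine Negligible.of_forall_le hP fun l t ht => ?_
  rw [← honest_sub]
  refine ((P.isExp_honest l).abs_le (f := fun p => ∑ q, ‖p.2.1.1 q‖ ^ 2 *
        h l p.1 p.2.1.2 p.2.2 (q (Sum.inl ())) (q (Sum.inr 0)) -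
        (h l p.1 p.2.1.2 p.2.2 false (clawX₀ p.2.2 0) +
          h l p.1 p.2.1.2 p.2.2 true (clawX₁ p.2.2 0)) / 2)
    (g := fun p => (1 - projNorm (clawState (clawX₀ p.2.2) (clawX₁ p.2.2) (clawZ p.2.2)) p.2.1.1) / t
      + 2 * t) ?_).trans_eq ?_
  · rintro ⟨y, ⟨ψ, m⟩, d⟩ hψ
    have h1 := abs_sum_norm_sq_sub_le (clawState (clawX₀ d) (clawX₁ d) (clawZ d)) ψ
      (norm_clawState _ _ _).le hψ (fun q => h l y m d (q (Sum.inl ())) (q (Sum.inr 0)))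
      (fun _ => hh _ _ _ _ _ _) ht
    rw [sum_norm_sq_clawState, ← projNorm_eq (norm_clawState _ _ _)] at h1
    exact h1
  · rw [honest_add, honest_const, honest_div_const, honest_sub, honest_const]
    rfl

theorem polyBounded_card_msgS (hP : P.Efficient) : PolyBounded fun l => Fintype.card (P.MsgS l) :=
  PolyBounded.mono hP.2.1 fun l => by unfold QCircuit.size; omega

theorem polyBounded_card_msgR (hP : P.Efficient) : PolyBounded fun l => Fintype.card (P.MsgR l) :=
  PolyBounded.mono hP.2.2 fun l => by simp only [RandCircuit.size, Fintype.card_sum]; omega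

theorem sum_mul_expect {I O Q : Type} [DecidableEq I] [Fintype Q] (C : RandCircuit I O) (x : Bits I)
    (w : Q → ℝ) (f : Q → Bits O → ℝ) :
    ∑ q, w q * C.expect x (f q) = C.expect x fun y => ∑ q, w q * f q y := by
  simp only [(C.isExp_expect x).sum, (C.isExp_expect x).const_mul]

theorem correct_pkeOfCSG (hP : P.Correct) : (pkeOfCSG P).Correct := by
  intro μ
  refine ((negligible_honest_sub hP (fun l y m d b x =>
    ind (xor (xor μ x) (if b then clawX₁ d 0 else clawX₀ d 0) = μ))
    (fun _ _ _ _ _ _ => ind_mem_Icc _)).neg).of_abs_le fun l => le_of_eq (congrArg _ ?_)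
  -- With the ideal claw the measured bit is exactly `x_b`, so the ideal decryption probability is
  -- 1.
  have h1 : ∀ x : Bool, ind (xor (xor μ x) x = μ) = 1 := by cases μ <;> simp [ind]
  simp only [if_true, Bool.false_eq_true, if_false, h1, add_self_div_two, honest_const, neg_sub]
  congr 1
  simp only [PKE.decProb, expect_encCircuit, expect_decCircuit]
  simp only [QCircuit.expect_eq_expectState, honest]
  congr 1
  funext y
  congr 1
  funext ψ m
  rw [← sum_mul_expect]
  rfl

end TwoRoundCSG

/-! ## Predicting one of the two strings -/

section Reduction

variable {S M : Type} [Fintype S] [DecidableEq S] [Fintype M] [DecidableEq M]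

/-- From the receiver's measured output and a copy of the sender's message, prepare the input of a
predictor of `x_{1-b}` and keep the receiver's message and `x_b`. -/
abbrev predictorInput (S M : Type) :
    RandCircuit (((Unit ⊕ Fin 1) ⊕ M) ⊕ S) ((S ⊕ (M ⊕ Unit)) ⊕ (M ⊕ Fin 1)) where
  Rnd := Empty
  Aux := Empty
  gates := [⟨fun a _ => !a, Sum.inl (Sum.inl (Sum.inl (Sum.inl ()))),
    Sum.inl (Sum.inl (Sum.inl (Sum.inl ()))), Sum.inl (Sum.inl (Sum.inl (Sum.inl ())))⟩]
  out := Sum.inl ∘ Sum.elim (Sum.elim Sum.inr (Sum.elim (Sum.inl ∘ Sum.inr)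
    (Sum.inl ∘ Sum.inl ∘ Sum.inl))) (Sum.elim (Sum.inl ∘ Sum.inr) (Sum.inl ∘ Sum.inl ∘ Sum.inr))

omit [Fintype S] [Fintype M] in
theorem expect_predictorInput (z : Bits (((Unit ⊕ Fin 1) ⊕ M) ⊕ S))
    (f : Bits ((S ⊕ (M ⊕ Unit)) ⊕ (M ⊕ Fin 1)) → ℝ) :
    (predictorInput S M).expect z f = f (Sum.elim (Sum.elim (z ∘ Sum.inr)
      (Sum.elim (z ∘ Sum.inl ∘ Sum.inr) fun _ => !(z (Sum.inl (Sum.inl (Sum.inl ()))))))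
      (Sum.elim (z ∘ Sum.inl ∘ Sum.inr) (z ∘ Sum.inl ∘ Sum.inl ∘ Sum.inr))) := by
  have : ∀ r, (predictorInput S M).eval z r = Sum.elim (Sum.elim (z ∘ Sum.inr)
      (Sum.elim (z ∘ Sum.inl ∘ Sum.inr) fun _ => !(z (Sum.inl (Sum.inl (Sum.inl ()))))))
      (Sum.elim (z ∘ Sum.inl ∘ Sum.inr) (z ∘ Sum.inl ∘ Sum.inl ∘ Sum.inr)) := by
    intro r
    funext o
    rcases o with (_ | _ | _) | _ | _ <;> rfl
  simp [RandCircuit.expect, this]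

/-- Add the two predicted bits and flip the result with probability `1/4`. -/
abbrev noisyXor (M : Type) : RandCircuit (Unit ⊕ (M ⊕ Fin 1)) (M ⊕ Unit) where
  Rnd := Unit ⊕ Unit
  Aux := Empty
  gates := [⟨and, Sum.inr (Sum.inl (Sum.inl ())), Sum.inr (Sum.inl (Sum.inr ())),
      Sum.inr (Sum.inl (Sum.inl ()))⟩,
    ⟨xor, Sum.inr (Sum.inl (Sum.inl ())), Sum.inl (Sum.inl ()), Sum.inr (Sum.inl (Sum.inl ()))⟩,
    ⟨xor, Sum.inr (Sum.inl (Sum.inl ())), Sum.inl (Sum.inr (Sum.inr 0)),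
      Sum.inr (Sum.inl (Sum.inl ()))⟩]
  out := Sum.elim (fun m => Sum.inl (Sum.inr (Sum.inl m))) fun _ => Sum.inr (Sum.inl (Sum.inl ()))

omit [Fintype M] in
theorem expect_noisyXor (z : Bits (Unit ⊕ (M ⊕ Fin 1))) (f : Bits (M ⊕ Unit) → ℝ) :
    (noisyXor M).expect z f =
      (3 * f (Sum.elim (z ∘ Sum.inr ∘ Sum.inl)
          fun _ => xor (z (Sum.inl ())) (z (Sum.inr (Sum.inr 0)))) +
        f (Sum.elim (z ∘ Sum.inr ∘ Sum.inl)
          fun _ => !(xor (z (Sum.inl ())) (z (Sum.inr (Sum.inr 0)))))) / 4 := by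
  have : ∀ r, (noisyXor M).eval z r = Sum.elim (z ∘ Sum.inr ∘ Sum.inl) fun _ =>
      xor (xor (r (Sum.inl ()) && r (Sum.inr ())) (z (Sum.inl ()))) (z (Sum.inr (Sum.inr 0))) := by
    intro r
    funext o
    rcases o with _ | _ <;> rfl
  simp only [RandCircuit.expect, this, sum_bits_sum, sum_bits_unique, Sum.elim_inl, Sum.elim_inr,
    Bool.and_false, Bool.and_true, Bool.false_xor, Bool.true_xor, Bool.not_xor]
  simp
  ring

/-- The adversary that runs the receiver, measures `(b, x_b)`, predicts `x_{1-b}`, and flips its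
guess of `x₀ ⊕ x₁` with probability `1/4`. -/
def xorAdversary (C : QCircuit S ((Unit ⊕ Fin 1) ⊕ M)) (A : QCircuit (S ⊕ (M ⊕ Unit)) Unit) :
    QCircuit S (M ⊕ Unit) :=
  (QCircuit.route (Sum.elim id id : S ⊕ S → S)).seq <| (C.ctx S).seq <|
    (QCircuit.ofRand (predictorInput S M)).seq <| (A.ctx (M ⊕ Fin 1)).seq <|
      QCircuit.ofRand (noisyXor M)

theorem expect_xorAdversary (C : QCircuit S ((Unit ⊕ Fin 1) ⊕ M))
    (A : QCircuit (S ⊕ (M ⊕ Unit)) Unit) (x : Bits S) (f : Bits (M ⊕ Unit) → ℝ) :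
    (xorAdversary C A).expect x f = C.expect x fun w =>
      A.expect (Sum.elim x (Sum.elim (w ∘ Sum.inr) fun _ => !(w (Sum.inl (Sum.inl ()))))) fun a =>
        (3 * f (Sum.elim (w ∘ Sum.inr) fun _ => xor (a ()) (w (Sum.inl (Sum.inr 0)))) +
          f (Sum.elim (w ∘ Sum.inr) fun _ => !(xor (a ()) (w (Sum.inl (Sum.inr 0)))))) / 4 := by
  simp only [xorAdversary, QCircuit.expect_seq, QCircuit.expect_route, QCircuit.expect_ctx,
    QCircuit.expect_ofRand, expect_predictorInput, expect_noisyXor]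
  rfl

end Reduction

theorem qpt_xorAdversary {P : TwoRoundCSG (fun _ => 1)} (hP : P.Efficient)
    {A : ∀ l, QCircuit (P.MsgS l ⊕ (P.MsgR l ⊕ Unit)) Unit} (hA : QPT A) :
    QPT fun l => xorAdversary (P.Rec l) (A l) := by
  have hS := P.polyBounded_card_msgS hP
  have hM := P.polyBounded_card_msgR hP
  refine QPT.seq (O := fun l => P.MsgS l ⊕ P.MsgS l) ?_ (QPT.seq (QPT.ctx hP.2.1 hS)
    (QPT.seq (PPT.ofRand ?_) (QPT.seq (QPT.ctx hA (J := fun l => P.MsgR l ⊕ Fin 1) ?_)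
      (PPT.ofRand ?_))))
  · refine (PolyBounded.mul (.const 5) hS).mono fun l => ?_
    simp only [QCircuit.size, List.length_map, Finset.length_toList, Finset.card_univ,
      Fintype.card_sum]
    omega
  · refine (PolyBounded.add (.add (.mul (.const 5) hS) (.mul (.const 5) hM)) (.const 10)).mono
      fun l => ?_
    simp only [RandCircuit.size, List.length_singleton, Fintype.card_sum, Fintype.card_unit,
      Fintype.card_fin, Fintype.card_empty]
    omega
  · refine (PolyBounded.add hM (.const 1)).mono fun l => ?_
    simp only [Fintype.card_sum, Fintype.card_fin, le_refl]
  · refine (PolyBounded.add (.mul (.const 5) hM) (.const 10)).mono fun l => ?_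
    simp only [RandCircuit.size, List.length_cons, List.length_nil, Fintype.card_sum,
      Fintype.card_unit, Fintype.card_fin, Fintype.card_empty]
    omega

namespace TwoRoundCSG

variable {P : TwoRoundCSG (fun _ => 1)}

/-- On an ideal claw the adversary is right with probability exactly `1/4 + p/2`, where `p` is the
predictor's success probability. Only replacing the real state by the claw is approximate. -/
theorem negligible_advProb_xorAdversary (hP : P.Correct)
    (A : ∀ l, QCircuit (P.MsgS l ⊕ (P.MsgR l ⊕ Unit)) Unit) :
    Negligible fun l => (P.advProb (fun l => xorAdversary (P.Rec l) (A l)) l 0 - 1 / 2) -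
      (P.predictProb A l - 1 / 2) / 2 := by
  -- Flipping with probability 1/4 turns success probability `p` into `3p/4 + (1 - p)/4`, halving
  -- the advantage.
  have key : ∀ l (y : Bits (P.MsgS l ⊕ P.St l)) (m : Bits (P.MsgR l)) (X : Bool) (b x : Bool),
      (A l).expect (Sum.elim (y ∘ Sum.inl) (Sum.elim m fun _ => !b)) (fun a =>
        (3 * ind (xor (a ()) x = X) + ind ((!(xor (a ()) x)) = X)) / 4) =
      1 / 4 + (A l).expect (Sum.elim (y ∘ Sum.inl) (Sum.elim m fun _ => !b)) (fun a =>
        ind (a () = xor x X)) / 2 := by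
    intro l y m X b x
    have hE := (A l).isExp_expect (Sum.elim (y ∘ Sum.inl) (Sum.elim m fun _ => !b))
    rw [← hE.div_const, ← hE.const (1 / 4), ← hE.add]
    congr 1
    funext a
    cases a () <;> cases x <;> cases X <;> norm_num [ind]
  refine (negligible_honest_sub hP (fun l y m d b x =>
    (A l).expect (Sum.elim (y ∘ Sum.inl) (Sum.elim m fun _ => !b)) fun a =>
      (3 * ind (xor (a ()) x = xor (clawX₀ d 0) (clawX₁ d 0)) +
        ind ((!(xor (a ()) x)) = xor (clawX₀ d 0) (clawX₁ d 0))) / 4) ?_).of_abs_le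
    fun l => le_of_eq (congrArg _ ?_)
  · intro l y m d b x
    rw [key]
    have := ((A l).isExp_expect (Sum.elim (y ∘ Sum.inl) (Sum.elim m fun _ => !b))).mem_Icc
      (f := fun a => ind (a () = xor x (xor (clawX₀ d 0) (clawX₁ d 0)))) fun _ _ => ind_mem_Icc _
    constructor <;> linarith [this.1, this.2]
  · have h1 : P.advProb (fun l => xorAdversary (P.Rec l) (A l)) l 0 =
        P.honest l fun y ψ m d => ∑ q, ‖ψ q‖ ^ 2 *
          (A l).expect (Sum.elim (y ∘ Sum.inl) (Sum.elim m fun _ => !(q (Sum.inl ())))) fun a =>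
            (3 * ind (xor (a ()) (q (Sum.inr 0)) = xor (clawX₀ d 0) (clawX₁ d 0)) +
              ind ((!(xor (a ()) (q (Sum.inr 0)))) = xor (clawX₀ d 0) (clawX₁ d 0))) / 4 := by
      simp only [advProb, expect_xorAdversary]
      simp only [QCircuit.expect_eq_expectState (P.Rec l), honest]
      congr 1
      funext y
      congr 1
      funext ψ m
      rw [← sum_mul_expect]
      refine Finset.sum_congr rfl fun q _ => congrArg _ ?_
      have hD := (P.Dec l).isExp_expect (Sum.elim (y ∘ Sum.inr) m)
      -- The run of `A` does not depend on the decoder's output, so the two samplings may be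
      -- exchanged.
      rw [hD.comm ((A l).isExp_expect _)]
      simp only [hD.div_const, hD.add, hD.const_mul]
      rfl
    have h2 : P.predictProb A l = P.honest l fun y _ m d => (∑ b : Bool,
          (A l).expect (Sum.elim (y ∘ Sum.inl) (Sum.elim m (fun _ => b))) fun a =>
            ind (a () = if b then clawX₁ d 0 else clawX₀ d 0)) / 2 := rfl
    -- Having measured `x₀`, the adversary asks for `x₁`, and conversely; the average over `b` is
    -- symmetric, so this is the predictor's game.
    have h3 : 1 / 4 + P.predictProb A l / 2 = P.honest l fun y _ m d =>
        ((A l).expect (Sum.elim (y ∘ Sum.inl) (Sum.elim m fun _ => !false)) (fun a =>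
          (3 * ind (xor (a ()) (clawX₀ d 0) = xor (clawX₀ d 0) (clawX₁ d 0)) +
            ind ((!(xor (a ()) (clawX₀ d 0))) = xor (clawX₀ d 0) (clawX₁ d 0))) / 4) +
        (A l).expect (Sum.elim (y ∘ Sum.inl) (Sum.elim m fun _ => !true)) (fun a =>
          (3 * ind (xor (a ()) (clawX₁ d 0) = xor (clawX₀ d 0) (clawX₁ d 0)) +
            ind ((!(xor (a ()) (clawX₁ d 0))) = xor (clawX₀ d 0) (clawX₁ d 0))) / 4)) / 2 := by
      rw [h2, ← honest_div_const, ← P.honest_const l (1 / 4), ← honest_add]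
      congr 1
      funext y _ m d
      rw [key, key, Fintype.sum_bool]
      have h4 : ∀ a b : Bool, xor a (xor a b) = b := by decide
      have h5 : ∀ a b : Bool, xor b (xor a b) = a := by decide
      simp only [h4, h5, Bool.not_false, Bool.not_true, if_true, Bool.false_eq_true, if_false]
      ring
    rw [h1, ← h3]
    ring

end TwoRoundCSG

/-! ## Security of the encryption scheme -/

section Predictor

variable {S M : Type} [Fintype S] [DecidableEq S] [Fintype M] [DecidableEq M]

/-- Append a random message bit and keep a copy of it. -/
abbrev randomCiphertext (S M : Type) :
    RandCircuit (S ⊕ (M ⊕ Unit)) ((S ⊕ (M ⊕ (Unit ⊕ Unit))) ⊕ Unit) where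
  Rnd := Unit
  Aux := Empty
  gates := []
  out := Sum.elim (Sum.elim (Sum.inl ∘ Sum.inl) (Sum.elim (Sum.inl ∘ Sum.inr ∘ Sum.inl)
    (Sum.elim (Sum.inl ∘ Sum.inr ∘ Sum.inr) (Sum.inr ∘ Sum.inl)))) (Sum.inr ∘ Sum.inl)

omit [Fintype S] [Fintype M] in
theorem expect_randomCiphertext (z : Bits (S ⊕ (M ⊕ Unit)))
    (f : Bits ((S ⊕ (M ⊕ (Unit ⊕ Unit))) ⊕ Unit) → ℝ) :
    (randomCiphertext S M).expect z f = (∑ c : Bool, f (Sum.elim (Sum.elim (z ∘ Sum.inl)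
      (Sum.elim (z ∘ Sum.inr ∘ Sum.inl) (Sum.elim (z ∘ Sum.inr ∘ Sum.inr) fun _ => c)))
        fun _ => c)) / 2 := by
  have : ∀ r, (randomCiphertext S M).eval z r = Sum.elim (Sum.elim (z ∘ Sum.inl)
      (Sum.elim (z ∘ Sum.inr ∘ Sum.inl) (Sum.elim (z ∘ Sum.inr ∘ Sum.inr) r))) r := by
    intro r
    funext o
    rcases o with (_ | _ | _ | _) | _ <;> rfl
  simp only [RandCircuit.expect, this, sum_bits_unique, Fintype.sum_bool]
  simp [add_comm]

/-- The sum of two bits. -/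
abbrev xorBits : RandCircuit (Unit ⊕ Unit) Unit where
  Rnd := Empty
  Aux := Empty
  gates := [⟨xor, Sum.inl (Sum.inl ()), Sum.inl (Sum.inr ()), Sum.inl (Sum.inl ())⟩]
  out := fun _ => Sum.inl (Sum.inl ())

theorem expect_xorBits (z : Bits (Unit ⊕ Unit)) (f : Bits Unit → ℝ) :
    xorBits.expect z f = f fun _ => xor (z (Sum.inl ())) (z (Sum.inr ())) := by
  have : ∀ r, xorBits.eval z r = fun _ => xor (z (Sum.inl ())) (z (Sum.inr ())) := by
    intro r
    rfl
  simp [RandCircuit.expect, this]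

/-- The predictor of `x_b` that runs a distinguisher of encryptions on a random message bit. -/
def predictor (A : QCircuit (S ⊕ (M ⊕ (Unit ⊕ Unit))) Unit) : QCircuit (S ⊕ (M ⊕ Unit)) Unit :=
  (QCircuit.ofRand (randomCiphertext S M)).seq ((A.ctx Unit).seq (QCircuit.ofRand xorBits))

theorem expect_predictor (A : QCircuit (S ⊕ (M ⊕ (Unit ⊕ Unit))) Unit) (z : Bits (S ⊕ (M ⊕ Unit)))
    (f : Bits Unit → ℝ) :
    (predictor A).expect z f = (∑ c : Bool, A.expect (Sum.elim (z ∘ Sum.inl)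
      (Sum.elim (z ∘ Sum.inr ∘ Sum.inl) (Sum.elim (z ∘ Sum.inr ∘ Sum.inr) fun _ => c)))
      fun a => f fun _ => xor (a ()) c) / 2 := by
  simp only [predictor, QCircuit.expect_seq, QCircuit.expect_ctx, QCircuit.expect_ofRand,
    expect_randomCiphertext, expect_xorBits]
  rfl

end Predictor

theorem qpt_predictor {P : TwoRoundCSG (fun _ => 1)} (hP : P.Efficient)
    {A : ∀ l, QCircuit (P.MsgS l ⊕ (P.MsgR l ⊕ (Unit ⊕ Unit))) Unit} (hA : QPT A) :
    QPT fun l => predictor (A l) := by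
  have hS := P.polyBounded_card_msgS hP
  have hM := P.polyBounded_card_msgR hP
  refine QPT.seq (PPT.ofRand ?_) (QPT.seq (QPT.ctx hA (.const 1)) (PPT.ofRand (.const _)))
  refine (PolyBounded.add (.add (.mul (.const 5) hS) (.mul (.const 5) hM)) (.const 10)).mono
    fun l => ?_
  simp only [RandCircuit.size, List.length_nil, Fintype.card_sum, Fintype.card_unit,
    Fintype.card_empty]
  omega

namespace TwoRoundCSG

variable {P : TwoRoundCSG (fun _ => 1)}

/-- On an ideal claw, the last ciphertext bit equals `x_b` for message 0 and its negation for
message 1. The predictor outputs the distinguisher's answer plus the random bit `c`, so its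
advantage is half the distinguishing advantage. -/
theorem negligible_advProb_sub (hP : P.Correct)
    (A : ∀ l, QCircuit (P.MsgS l ⊕ (P.MsgR l ⊕ (Unit ⊕ Unit))) Unit) :
    Negligible fun l => ((pkeOfCSG P).advProb A l false - (pkeOfCSG P).advProb A l true) -
      2 * (P.predictProb (fun l => predictor (A l)) l - 1 / 2) := by
  have h1 : ∀ μ l, (pkeOfCSG P).advProb A l μ = P.honest l fun y ψ m _ => ∑ q, ‖ψ q‖ ^ 2 *
      (A l).expect (Sum.elim (y ∘ Sum.inl) (Sum.elim m (Sum.elim (fun _ => q (Sum.inl ()))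
        fun _ => xor μ (q (Sum.inr 0))))) fun a => ind (a () = false) := by
    intro μ l
    simp only [PKE.advProb, expect_encCircuit]
    simp only [QCircuit.expect_eq_expectState (P.Rec l), honest, ((P.Dec l).isExp_expect _).const]
    rfl
  have h2 := fun μ => negligible_honest_sub hP (fun l y m _ b x =>
    (A l).expect (Sum.elim (y ∘ Sum.inl) (Sum.elim m (Sum.elim (fun _ => b) fun _ => xor μ x)))
      fun a => ind (a () = false)) fun l y m d b x =>
        ((A l).isExp_expect _).mem_Icc fun _ _ => ind_mem_Icc _
  have key : ∀ l (z : Bits (P.MsgS l ⊕ (P.MsgR l ⊕ (Unit ⊕ Unit)))),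
      (A l).expect z (fun a => ind (a () = true)) =
        1 - (A l).expect z (fun a => ind (a () = false)) := by
    intro l z
    have hE := (A l).isExp_expect z
    rw [← hE.const 1, ← hE.sub]
    congr 1
    funext a
    cases a () <;> simp [ind]
  refine ((h2 false).sub (h2 true)).of_abs_le fun l => le_of_eq (congrArg _ ?_)
  simp only [← h1]
  rw [sub_sub_sub_comm]
  congr 1
  rw [← honest_sub]
  have h3 : P.predictProb (fun l => predictor (A l)) l = P.honest l fun y _ m d => (∑ b : Bool,
      (predictor (A l)).expect (Sum.elim (y ∘ Sum.inl) (Sum.elim m (fun _ => b))) fun a =>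
        ind (a () = if b then clawX₁ d 0 else clawX₀ d 0)) / 2 := rfl
  rw [h3, ← P.honest_const l (1 / 2), ← honest_sub, mul_comm, ← div_inv_eq_mul, ← honest_div_const]
  congr 1
  funext y _ m d
  -- The case `c = x` is won when the distinguisher answers 0, the case `c ≠ x` when it answers 1.
  have h4 : ∀ (b x : Bool), (predictor (A l)).expect (Sum.elim (y ∘ Sum.inl)
      (Sum.elim m (fun _ => b))) (fun a => ind (a () = x)) = 1 / 2 +
      ((A l).expect (Sum.elim (y ∘ Sum.inl) (Sum.elim m (Sum.elim (fun _ => b) fun _ => x)))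
          (fun a => ind (a () = false)) -
        (A l).expect (Sum.elim (y ∘ Sum.inl) (Sum.elim m (Sum.elim (fun _ => b) fun _ => !x)))
          fun a => ind (a () = false)) / 2 := by
    intro b x
    rw [expect_predictor, Fintype.sum_bool]
    have h5 : ∀ c : Bool, (A l).expect (Sum.elim (y ∘ Sum.inl) (Sum.elim m
        (Sum.elim (fun _ => b) fun _ => c))) (fun a => ind (xor (a ()) c = c)) =
        (A l).expect (Sum.elim (y ∘ Sum.inl) (Sum.elim m
          (Sum.elim (fun _ => b) fun _ => c))) (fun a => ind (a () = false)) := by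
      intro c; congr 1; funext a; cases a () <;> cases c <;> rfl
    have h6 : ∀ c : Bool, (A l).expect (Sum.elim (y ∘ Sum.inl) (Sum.elim m
        (Sum.elim (fun _ => b) fun _ => !c))) (fun a => ind (xor (a ()) (!c) = c)) =
        (A l).expect (Sum.elim (y ∘ Sum.inl) (Sum.elim m
          (Sum.elim (fun _ => b) fun _ => !c))) (fun a => ind (a () = true)) := by
      intro c; congr 1; funext a; cases a () <;> cases c <;> rfl
    have h7 := h5 x
    have h8 := h6 x
    rw [key] at h8
    cases x
    · simp only [Bool.not_false] at h8 ⊢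
      change ((A l).expect (Sum.elim (y ∘ Sum.inl) (Sum.elim m
        (Sum.elim (fun _ => b) fun _ => true))) (fun a => ind (xor (a ()) true = false)) +
        (A l).expect (Sum.elim (y ∘ Sum.inl) (Sum.elim m
        (Sum.elim (fun _ => b) fun _ => false))) (fun a => ind (xor (a ()) false = false))) / 2 = _
      rw [h7, h8]; ring
    · simp only [Bool.not_true] at h8 ⊢
      change ((A l).expect (Sum.elim (y ∘ Sum.inl) (Sum.elim m
        (Sum.elim (fun _ => b) fun _ => true))) (fun a => ind (xor (a ()) true = true)) +
        (A l).expect (Sum.elim (y ∘ Sum.inl) (Sum.elim m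
        (Sum.elim (fun _ => b) fun _ => false))) (fun a => ind (xor (a ()) false = true))) / 2 = _
      rw [h7, h8]; ring
  simp only [Fintype.sum_bool, if_true, Bool.false_eq_true, if_false, h4, Bool.false_xor,
    Bool.true_xor]
  ring

theorem secure_pkeOfCSG (hE : P.Efficient) (hC : P.Correct) (hS : P.IndSecure) :
    (pkeOfCSG P).Secure := by
  intro A hA
  have h1 := hS _ (qpt_xorAdversary hE (qpt_predictor hE hA)) fun _ => 0
  have h2 := negligible_advProb_xorAdversary hC fun l => predictor (A l)
  have h3 := negligible_advProb_sub hC A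
  -- Each of the two reductions halves the advantage, hence the factor 4.
  refine (((h1.of_abs.sub h2).const_mul 4).add h3).abs.of_abs_le fun l =>
    le_of_eq (congrArg _ (congrArg _ ?_))
  ring

theorem isCPASecurePKE_pkeOfCSG (hE : P.Efficient) (hC : P.Correct) (hS : P.IndSecure) :
    (pkeOfCSG P).IsCPASecurePKE :=
  ⟨efficient_pkeOfCSG hE, correct_pkeOfCSG hC, secure_pkeOfCSG hE hC hS⟩

end TwoRoundCSG

/-! ## Claw states from pairs of prepared qubits -/

/-- The amplitudes of `H u`. -/
def hadamard (u : EuclideanSpace ℂ (Bits Unit)) (s : Bool) : ℂ :=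
  ((Real.sqrt 2 : ℝ) : ℂ)⁻¹ * (u (fun _ => false) + sgn s * u (fun _ => true))

/-- The result of applying Hadamard gates to `u` and `v` and then a controlled-not gate from the
second to the first qubit. -/
def entangle (u v : EuclideanSpace ℂ (Bits Unit)) : EuclideanSpace ℂ (Bits (Unit ⊕ Fin 1)) :=
  WithLp.toLp 2 fun q => hadamard u (xor (q (Sum.inl ())) (q (Sum.inr 0))) *
    hadamard v (q (Sum.inr 0))

theorem inv_sqrt_two_sq : ((Real.sqrt 2 : ℝ) : ℂ)⁻¹ * ((Real.sqrt 2 : ℝ) : ℂ)⁻¹ = 1 / 2 := by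
  rw [← mul_inv, ← Complex.ofReal_mul, Real.mul_self_sqrt (by norm_num)]
  norm_num

/-- The Hadamard transform is its own inverse; listing the amplitudes from `s` instead of from
`false` costs the sign `sgn (s && t)`. -/
theorem hadamard_add (u : EuclideanSpace ℂ (Bits Unit)) (s t : Bool) :
    ((Real.sqrt 2 : ℝ) : ℂ)⁻¹ * (hadamard u s + sgn t * hadamard u (!s)) =
      sgn (s && t) * u (fun _ => t) := by
  have h : ((Real.sqrt 2 : ℝ) : ℂ)⁻¹ * (hadamard u s + sgn t * hadamard u (!s)) =
      (((Real.sqrt 2 : ℝ) : ℂ)⁻¹ * ((Real.sqrt 2 : ℝ) : ℂ)⁻¹) *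
        ((u (fun _ => false) + sgn s * u (fun _ => true)) +
          sgn t * (u (fun _ => false) + sgn (!s) * u (fun _ => true))) := by
    unfold hadamard; ring
  rw [h, inv_sqrt_two_sq]
  cases s <;> cases t <;> simp [sgn] <;> ring

theorem norm_sq_hadamard_add (u : EuclideanSpace ℂ (Bits Unit)) :
    ‖hadamard u false‖ ^ 2 + ‖hadamard u true‖ ^ 2 = ‖u‖ ^ 2 := by
  have hs : ‖((Real.sqrt 2 : ℝ) : ℂ)⁻¹‖ ^ 2 = 1 / 2 := by
    rw [norm_inv, Complex.norm_real, Real.norm_of_nonneg (Real.sqrt_nonneg 2), inv_pow,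
      Real.sq_sqrt (by norm_num)]
    norm_num
  have hp := parallelogram_law_with_norm ℝ (u (fun _ => false)) (u (fun _ => true))
  rw [EuclideanSpace.norm_sq_eq, sum_bits_unique]
  simp only [hadamard, norm_mul, mul_pow, hs, sgn, Bool.false_eq_true, if_false, if_true, one_mul,
    neg_one_mul, ← sub_eq_add_neg]
  linarith

/-- With the bilinearity below, this shows that normalizing the two qubits separately and then
entangling agrees with entangling and then normalizing. -/
theorem norm_entangle (u v : EuclideanSpace ℂ (Bits Unit)) : ‖entangle u v‖ = ‖u‖ * ‖v‖ := by
  rw [← sq_eq_sq₀ (norm_nonneg _) (by positivity), mul_pow, ← norm_sq_hadamard_add u,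
    ← norm_sq_hadamard_add v, EuclideanSpace.norm_sq_eq, sum_bits_sum]
  simp only [sum_bits_unique, entangle, norm_mul, mul_pow, Sum.elim_inl, Sum.elim_inr,
    Bool.xor_false, Bool.xor_true, Bool.not_false, Bool.not_true]
  ring

theorem entangle_smul_smul (a b : ℂ) (u v : EuclideanSpace ℂ (Bits Unit)) :
    entangle (a • u) (b • v) = (a * b) • entangle u v := by
  ext q
  simp only [entangle, hadamard, PiLp.smul_apply, smul_eq_mul]
  ring

theorem conj_sgn (z : Bool) : (starRingEnd ℂ) (sgn z) = sgn z := by cases z <;> simp [sgn]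

theorem norm_sgn (z : Bool) : ‖sgn z‖ = 1 := by cases z <;> simp [sgn]

theorem inner_clawState (x₀ x₁ : Bits (Fin 1)) (z : Bool)
    (ψ : EuclideanSpace ℂ (Bits (Unit ⊕ Fin 1))) :
    inner ℂ (clawState x₀ x₁ z) ψ = ((Real.sqrt 2 : ℝ) : ℂ)⁻¹ *
      (ψ (Sum.elim (fun _ => false) x₀) + sgn z * ψ (Sum.elim (fun _ => true) x₁)) := by
  simp only [clawState, ket, inner_smul_left, inner_add_left, EuclideanSpace.inner_single_left,
    map_inv₀, Complex.conj_ofReal, conj_sgn, map_one, one_mul]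

theorem inner_ospState (b s : Bool) (ψ : EuclideanSpace ℂ (Bits Unit)) :
    inner ℂ (ospState b s) ψ = if b then hadamard ψ s else ψ (fun _ => s) := by
  cases b
  · simp [ospState, ket, EuclideanSpace.inner_single_left]
  · simp only [ospState, hadamard, ket, if_true, inner_smul_left, inner_add_left,
      EuclideanSpace.inner_single_left, map_inv₀, Complex.conj_ofReal, conj_sgn, map_one, one_mul]

theorem norm_ospState (b s : Bool) : ‖ospState b s‖ = 1 := by
  have h : ‖ospState b s‖ ^ 2 = 1 := by
    have hs : ‖((Real.sqrt 2 : ℝ) : ℂ)⁻¹‖ ^ 2 = 1 / 2 := by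
      rw [norm_inv, Complex.norm_real, Real.norm_of_nonneg (Real.sqrt_nonneg 2), inv_pow,
        Real.sq_sqrt (by norm_num)]
      norm_num
    rw [EuclideanSpace.norm_sq_eq, sum_bits_unique]
    have h1 : ((fun _ => false : Bits Unit) = fun _ => true) ↔ False := by simp [funext_iff]
    have h2 : ((fun _ => true : Bits Unit) = fun _ => false) ↔ False := by simp [funext_iff]
    cases b
    · cases s <;> simp [ospState, ket, h1, h2]
    · simp only [ospState, ket, if_true, PiLp.smul_apply, PiLp.add_apply, PiLp.single_apply, h1, h2,
        if_false, norm_smul, mul_pow, hs, smul_zero, add_zero, zero_add, norm_one, norm_sgn]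
      norm_num
  nlinarith [norm_nonneg (ospState b s)]

/-- The claw `(x₀, x₁, z)` of the state obtained from `H^b|s₁⟩` and `H^(1-b)|s₂⟩`. -/
def clawBits (b s₁ s₂ : Bool) : Bits (Fin 1 ⊕ (Fin 1 ⊕ Unit)) :=
  Sum.elim (fun _ => if b then s₁ else s₂) (Sum.elim (fun _ => xor (if b then s₁ else s₂) b)
    fun _ => if b then s₂ else s₁)

/-- The entangling unitary sends `H^b|s₁⟩ ⊗ H^(1-b)|s₂⟩` to the claw state of `clawBits` up to a
sign, and unitaries preserve overlaps. In each case one Hadamard factor appears in both claw terms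
and comes out, while the other is inverted by `hadamard_add`. -/
theorem projNorm_entangle (b s₁ s₂ : Bool) (u v : EuclideanSpace ℂ (Bits Unit)) :
    projNorm (clawState (clawX₀ (clawBits b s₁ s₂)) (clawX₁ (clawBits b s₁ s₂))
      (clawZ (clawBits b s₁ s₂))) (entangle u v) =
      projNorm (ospState b s₁) u * projNorm (ospState (!b) s₂) v := by
  rw [projNorm_eq (norm_clawState _ _ _), projNorm_eq (norm_ospState _ _),
    projNorm_eq (norm_ospState _ _), inner_clawState, inner_ospState, inner_ospState, ← norm_mul]
  cases b
  · have h := congrArg norm (congrArg (· * hadamard v s₂) (hadamard_add u s₂ s₁))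
    simp only [norm_mul, norm_sgn, one_mul] at h
    simp only [clawBits, clawX₀, clawX₁, clawZ, Sum.elim_inl, Sum.elim_inr, Bool.false_eq_true,
      if_false, Bool.xor_false, entangle, Bool.false_xor, Bool.true_xor, Bool.not_false, if_true]
    rw [norm_mul (u _), ← h, ← norm_mul, ← norm_mul]
    congr 1
    ring
  · have h := congrArg norm (congrArg (hadamard u s₁ * ·) (hadamard_add v s₁ s₂))
    simp only [norm_mul, norm_sgn, one_mul] at h
    simp only [clawBits, clawX₀, clawX₁, clawZ, Sum.elim_inl, Sum.elim_inr, Bool.false_eq_true,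
      if_false, Bool.xor_true, entangle, Bool.false_xor, Bool.true_xor, Bool.not_true, if_true,
      Bool.not_not]
    rw [norm_mul (hadamard u s₁), ← h, ← norm_mul, ← norm_mul]
    congr 1
    ring

/-! ## The receiver -/

namespace QCircuit

variable {S T M N : Type}

/-- Run two circuits that prepare a qubit each, and entangle the two qubits. -/
abbrev entanglePair (C : QCircuit S (Unit ⊕ M)) (D : QCircuit T (Unit ⊕ N)) :
    QCircuit (S ⊕ T) ((Unit ⊕ Fin 1) ⊕ (M ⊕ N)) where
  Aux := C.Aux ⊕ D.Aux
  Garb := C.Garb ⊕ D.Garb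
  gates := C.gates.map (QGate.map (.sumMap .inl .inl)) ++
    (D.gates.map (QGate.map (.sumMap .inr .inr)) ++
      [QGate.h (Sum.map Sum.inl Sum.inl (C.out.symm (Sum.inl (Sum.inl ())))),
        QGate.h (Sum.map Sum.inr Sum.inr (D.out.symm (Sum.inl (Sum.inl ())))),
        QGate.cnot (Sum.map Sum.inr Sum.inr (D.out.symm (Sum.inl (Sum.inl ()))))
          (Sum.map Sum.inl Sum.inl (C.out.symm (Sum.inl (Sum.inl ())))) (by
            rcases C.out.symm (Sum.inl (Sum.inl ())) with _ | _ <;>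
              rcases D.out.symm (Sum.inl (Sum.inl ())) with _ | _ <;> simp)])
  out := (Equiv.sumSumSumComm S T C.Aux D.Aux).trans <| (Equiv.sumCongr C.out D.out).trans <|
    (Equiv.sumSumSumComm (Unit ⊕ M) C.Garb (Unit ⊕ N) D.Garb).trans <|
    Equiv.sumCongr ((Equiv.sumSumSumComm Unit M Unit N).trans
      (Equiv.sumCongr (Equiv.sumCongr (.refl Unit) (Equiv.ofUnique Unit (Fin 1))) (.refl _)))
      (.refl _)

variable [Fintype S] [DecidableEq S] [Fintype T] [DecidableEq T]

/-- The circuits act on disjoint wires from a product basis state, so the result is a tensor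
product. -/
theorem run_pair (C : QCircuit S (Unit ⊕ M)) (D : QCircuit T (Unit ⊕ N)) (x : Bits (S ⊕ T))
    (w : Bits ((S ⊕ T) ⊕ (C.Aux ⊕ D.Aux))) :
    QGate.run (D.gates.map (QGate.map (.sumMap .inr .inr)))
      (QGate.run (C.gates.map (QGate.map (.sumMap .inl .inl)))
        (basisAmp (Sum.elim x fun _ => false))) w =
      C.final (x ∘ Sum.inl) (w ∘ Sum.map Sum.inl Sum.inl) *
        D.final (x ∘ Sum.inr) (w ∘ Sum.map Sum.inr Sum.inr) := by
  set e₁ : S ⊕ C.Aux ↪ (S ⊕ T) ⊕ (C.Aux ⊕ D.Aux) := .sumMap .inl .inl with he₁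
  set e₂ : T ⊕ D.Aux ↪ (S ⊕ T) ⊕ (C.Aux ⊕ D.Aux) := .sumMap .inr .inr with he₂
  have h1 : ∀ (t : Bits (S ⊕ C.Aux)) (u : Bits (T ⊕ D.Aux)),
      Function.extend e₁ t (Function.extend e₂ u w) = Sum.elim
        (Sum.elim (t ∘ Sum.inl) (u ∘ Sum.inl)) (Sum.elim (t ∘ Sum.inr) (u ∘ Sum.inr)) := by
    intro t u
    funext v
    rcases v with (s | s) | (a | a)
    · exact e₁.injective.extend_apply _ _ (Sum.inl s)
    · rw [Function.extend_apply']
      · exact e₂.injective.extend_apply _ _ (Sum.inl s)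
      · rintro ⟨_ | _, h⟩ <;> simp [he₁] at h
    · exact e₁.injective.extend_apply _ _ (Sum.inr a)
    · rw [Function.extend_apply']
      · exact e₂.injective.extend_apply _ _ (Sum.inr a)
      · rintro ⟨_ | _, h⟩ <;> simp [he₁] at h
  have h2 : ∀ u : Bits (T ⊕ D.Aux), Function.extend e₂ u w ∘ e₁ = w ∘ e₁ := by
    intro u
    funext v
    simp only [Function.comp_apply]
    rw [Function.extend_apply']
    rintro ⟨u, hu⟩
    rcases v with v | v <;> rcases u with u | u <;> simp [he₁, he₂] at hu
  have h3 : ∀ (t : Bits (S ⊕ C.Aux)) (u : Bits (T ⊕ D.Aux)),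
      basisAmp (Sum.elim x fun _ => false) (Sum.elim
        (Sum.elim (t ∘ Sum.inl) (u ∘ Sum.inl)) (Sum.elim (t ∘ Sum.inr) (u ∘ Sum.inr))) =
      basisAmp (Sum.elim (x ∘ Sum.inr) fun _ => false) u *
        basisAmp (Sum.elim (x ∘ Sum.inl) fun _ => false) t := by
    intro t u
    have : (Sum.elim (Sum.elim (t ∘ Sum.inl) (u ∘ Sum.inl))
        (Sum.elim (t ∘ Sum.inr) (u ∘ Sum.inr)) = Sum.elim x fun _ => false) ↔
        (u = Sum.elim (x ∘ Sum.inr) fun _ => false) ∧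
          t = Sum.elim (x ∘ Sum.inl) fun _ => false := by
      simp only [funext_iff, Sum.forall, Sum.elim_inl, Sum.elim_inr, Function.comp_apply]
      tauto
    simp only [basisAmp, this, ite_and, ite_mul, one_mul, zero_mul]
  rw [QGate.run_map]
  simp only [QGate.run_map, h1, h2, h3, QGate.run_const_mul]
  simp only [mul_comm _ (QGate.run C.gates _ _), QGate.run_const_mul]
  rfl

theorem amp_entanglePair (C : QCircuit S (Unit ⊕ M)) (D : QCircuit T (Unit ⊕ N))
    (x : Bits (S ⊕ T)) (q : Bits (Unit ⊕ Fin 1)) (m : Bits M) (n : Bits N) (g : Bits C.Garb)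
    (g' : Bits D.Garb) :
    (entanglePair C D).amp x (Sum.elim q (Sum.elim m n)) (Sum.elim g g') =
      entangle (C.branch (x ∘ Sum.inl) m g) (D.branch (x ∘ Sum.inr) n g') q := by
  set e₁ : S ⊕ C.Aux → (S ⊕ T) ⊕ (C.Aux ⊕ D.Aux) := Sum.map Sum.inl Sum.inl with he₁
  set e₂ : T ⊕ D.Aux → (S ⊕ T) ⊕ (C.Aux ⊕ D.Aux) := Sum.map Sum.inr Sum.inr with he₂
  have hi₁ : e₁.Injective := Sum.map_injective.2 ⟨Sum.inl_injective, Sum.inl_injective⟩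
  have hi₂ : e₂.Injective := Sum.map_injective.2 ⟨Sum.inr_injective, Sum.inr_injective⟩
  have hne : ∀ a b, e₁ a ≠ e₂ b := by rintro (_ | _) (_ | _) <;> simp [he₁, he₂]
  set p₁ := C.out.symm (Sum.inl (Sum.inl ())) with hp₁
  set p₂ := D.out.symm (Sum.inl (Sum.inl ())) with hp₂
  set w' : Bits ((S ⊕ T) ⊕ (C.Aux ⊕ D.Aux)) := fun w =>
    Sum.elim (Sum.elim q (Sum.elim m n)) (Sum.elim g g') ((entanglePair C D).out w) with hw'
  have h1 : w' ∘ e₁ = fun w =>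
      Sum.elim (Sum.elim (fun _ => q (Sum.inl ())) m) g (C.out w) := by
    funext w
    rcases h : C.out w with (_ | _) | _ <;> rcases w with w | w <;> simp [he₁, hw', h]
  have h2 : w' ∘ e₂ = fun w =>
      Sum.elim (Sum.elim (fun _ => q (Sum.inr 0)) n) g' (D.out w) := by
    funext w
    rcases h : D.out w with (_ | _) | _ <;> rcases w with w | w <;> simp [he₂, hw', h]
  have h3 : w' (e₁ p₁) = q (Sum.inl ()) := by
    have := congrFun h1 p₁
    simpa [hp₁] using this
  have h4 : w' (e₂ p₂) = q (Sum.inr 0) := by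
    have := congrFun h2 p₂
    simpa [hp₂] using this
  -- Pulled back through the last three gates, `w'` changes only at the two prepared qubits; on the
  -- wires of `C` only the latest value written to `p₁` remains.
  have h5 : ∀ a b c : Bool, Function.update (Function.update (Function.update w' (e₁ p₁) c)
      (e₂ p₂) b) (e₁ p₁) a ∘ e₁ = fun w => Sum.elim (Sum.elim (fun _ => a) m) g (C.out w) := by
    intro a b c
    funext v
    by_cases hv : v = p₁
    · subst hv
      simp [hp₁]
    · rw [Function.comp_apply, Function.update_of_ne (hi₁.ne hv), Function.update_of_ne (hne _ _),
        Function.update_of_ne (hi₁.ne hv)]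
      refine (congrFun h1 v).trans ?_
      rcases h : C.out v with (_ | _) | _
      · exact absurd (by rw [hp₁, ← h, Equiv.symm_apply_apply]) hv
      · rfl
      · rfl
  have h6 : ∀ a b c : Bool, Function.update (Function.update (Function.update w' (e₁ p₁) c)
      (e₂ p₂) b) (e₁ p₁) a ∘ e₂ = fun w => Sum.elim (Sum.elim (fun _ => b) n) g' (D.out w) := by
    intro a b c
    funext v
    rw [Function.comp_apply, Function.update_of_ne (hne _ _).symm]
    by_cases hv : v = p₂
    · subst hv
      simp [hp₂]
    · rw [Function.update_of_ne (hi₂.ne hv), Function.update_of_ne (hne _ _).symm]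
      refine (congrFun h2 v).trans ?_
      rcases h : D.out v with (_ | _) | _
      · exact absurd (by rw [hp₂, ← h, Equiv.symm_apply_apply]) hv
      · rfl
      · rfl
  rw [amp, final_eq_run, QGate.run_append, QGate.run_append, QGate.run_cons, QGate.run_cons,
    QGate.run_cons, QGate.run_nil]
  change (QGate.cnot (e₂ p₂) (e₁ p₁) _).apply ((QGate.h (e₂ p₂)).apply
    ((QGate.h (e₁ p₁)).apply _)) w' = _
  simp only [QGate.apply, run_pair, Function.update_self, Function.update_of_ne (hne _ _),
    Function.update_of_ne (hne _ _).symm, h3, h4, ← he₁, ← he₂, h5, h6]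
  simp only [entangle, hadamard, branch, amp, sgn]
  ring

theorem expectState_entanglePair [Fintype M] [DecidableEq M] [Fintype N] [DecidableEq N]
    (C : QCircuit S (Unit ⊕ M)) (D : QCircuit T (Unit ⊕ N)) (x : Bits (S ⊕ T))
    (F : EuclideanSpace ℂ (Bits (Unit ⊕ Fin 1)) → Bits (M ⊕ N) → ℝ) :
    (entanglePair C D).expectState x F = C.expectState (x ∘ Sum.inl) fun ψ m =>
      D.expectState (x ∘ Sum.inr) fun ψ' n => F (entangle ψ ψ') (Sum.elim m n) := by
  have h : ∀ m n g g', (entanglePair C D).branch x (Sum.elim m n) (Sum.elim g g') =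
      entangle (C.branch (x ∘ Sum.inl) m g) (D.branch (x ∘ Sum.inr) n g') := by
    intro m n g g'
    ext q
    exact amp_entanglePair C D x q m n g g'
  simp only [expectState, sum_bits_sum, h, norm_entangle, entangle_smul_smul, mul_inv,
    Complex.ofReal_mul, mul_pow, Finset.mul_sum, mul_assoc]
  refine Finset.sum_congr rfl fun m _ => ?_
  rw [Finset.sum_comm]

end QCircuit

/-! ## A claw-state generator from oblivious state preparation -/

section Sender

variable {S T M : Type} [DecidableEq S] [DecidableEq T] [DecidableEq M]

/-- Two copies of a random bit. -/
abbrev coinPair : RandCircuit Empty (Unit ⊕ Unit) where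
  Rnd := Unit
  Aux := Empty
  gates := []
  out := fun _ => Sum.inr (Sum.inl ())

theorem expect_coinPair (x : Bits Empty) (f : Bits (Unit ⊕ Unit) → ℝ) :
    coinPair.expect x f = (f (fun _ => false) + f (fun _ => true)) / 2 := by
  simp only [RandCircuit.expect, sum_bits_unique]
  simp
  rfl

/-- Prepend the negation of the last bit. -/
abbrev prependNot (K : Type) : RandCircuit (K ⊕ Unit) (Unit ⊕ (K ⊕ Unit)) where
  Rnd := Empty
  Aux := Unit
  gates := [⟨fun a _ => !a, Sum.inl (Sum.inr ()), Sum.inl (Sum.inr ()), Sum.inr (Sum.inr ())⟩]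
  out := Sum.elim (Sum.inr ∘ Sum.inr) Sum.inl

theorem expect_prependNot {K : Type} [DecidableEq K] (z : Bits (K ⊕ Unit))
    (f : Bits (Unit ⊕ (K ⊕ Unit)) → ℝ) :
    (prependNot K).expect z f = f (Sum.elim (fun _ => !(z (Sum.inr ()))) z) := by
  have : ∀ r, (prependNot K).eval z r = Sum.elim (fun _ => !(z (Sum.inr ()))) z := by
    intro r
    funext o
    rcases o with _ | _ | _ <;> rfl
  simp [RandCircuit.expect, this]

variable [Fintype S] [Fintype T] [Fintype M]

/-- Run `C` on a random bit and on its negation; the state consists of the random bit and of the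
two states. -/
def pairSender (C : RandCircuit Unit (S ⊕ T)) : RandCircuit Empty ((S ⊕ S) ⊕ (Unit ⊕ (T ⊕ T))) :=
  coinPair.seq <| (C.ctx Unit).seq <| (prependNot (S ⊕ T)).seq <|
    (C.ctx ((S ⊕ T) ⊕ Unit)).seq <| RandCircuit.route <|
      Sum.elim (Sum.elim (Sum.inr ∘ Sum.inl ∘ Sum.inl) (Sum.inl ∘ Sum.inl)) <|
        Sum.elim (Sum.inr ∘ Sum.inr) (Sum.elim (Sum.inr ∘ Sum.inl ∘ Sum.inr) (Sum.inl ∘ Sum.inr))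

theorem expect_pairSender (C : RandCircuit Unit (S ⊕ T)) (x : Bits Empty)
    (f : Bits ((S ⊕ S) ⊕ (Unit ⊕ (T ⊕ T))) → ℝ) :
    (pairSender C).expect x f = (∑ b : Bool, C.expect (fun _ => b) fun y =>
      C.expect (fun _ => !b) fun y' => f (Sum.elim (Sum.elim (y ∘ Sum.inl) (y' ∘ Sum.inl))
        (Sum.elim (fun _ => b) (Sum.elim (y ∘ Sum.inr) (y' ∘ Sum.inr))))) / 2 := by
  have h : ∀ (b : Bits Unit) (y y' : Bits (S ⊕ T)),
      (Sum.elim y' (Sum.elim y b) : Bits ((S ⊕ T) ⊕ ((S ⊕ T) ⊕ Unit))) ∘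
        Sum.elim (Sum.elim (Sum.inr ∘ Sum.inl ∘ Sum.inl) (Sum.inl ∘ Sum.inl))
        (Sum.elim (Sum.inr ∘ Sum.inr) (Sum.elim (Sum.inr ∘ Sum.inl ∘ Sum.inr) (Sum.inl ∘ Sum.inr))) =
      Sum.elim (Sum.elim (y ∘ Sum.inl) (y' ∘ Sum.inl))
        (Sum.elim b (Sum.elim (y ∘ Sum.inr) (y' ∘ Sum.inr))) := by
    intro b y y'
    funext v
    rcases v with (_ | _) | _ | _ | _ <;> rfl
  simp only [pairSender, RandCircuit.expect_seq, RandCircuit.expect_ctx, RandCircuit.expect_route,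
    expect_coinPair, expect_prependNot, Sum.elim_comp_inl, Sum.elim_comp_inr, Sum.elim_inr, h]
  rw [Fintype.sum_bool, add_comm]
  rfl

/-- From the two decoded bits and the random bit, compute the claw. -/
abbrev clawCircuit : RandCircuit (Unit ⊕ (Unit ⊕ Unit)) (Fin 1 ⊕ (Fin 1 ⊕ Unit)) where
  Rnd := Empty
  Aux := Unit ⊕ (Unit ⊕ Unit)
  gates :=
    let s₂ := Sum.inl (Sum.inl ())
    let s₁ := Sum.inl (Sum.inr (Sum.inl ()))
    let b := Sum.inl (Sum.inr (Sum.inr ()))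
    let d := Sum.inr (Sum.inr (Sum.inl ()))
    let x₀ := Sum.inr (Sum.inr (Sum.inr (Sum.inl ())))
    let x₁ := Sum.inr (Sum.inr (Sum.inr (Sum.inr ())))
    [⟨xor, s₁, s₂, d⟩, ⟨and, d, b, d⟩, ⟨xor, s₂, d, x₀⟩, ⟨xor, x₀, b, x₁⟩, ⟨xor, s₁, d, d⟩]
  out := Sum.elim (fun _ => Sum.inr (Sum.inr (Sum.inr (Sum.inl ()))))
    (Sum.elim (fun _ => Sum.inr (Sum.inr (Sum.inr (Sum.inr ()))))
      fun _ => Sum.inr (Sum.inr (Sum.inl ())))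

theorem expect_clawCircuit (z : Bits (Unit ⊕ (Unit ⊕ Unit)))
    (f : Bits (Fin 1 ⊕ (Fin 1 ⊕ Unit)) → ℝ) :
    clawCircuit.expect z f =
      f (clawBits (z (Sum.inr (Sum.inr ()))) (z (Sum.inr (Sum.inl ()))) (z (Sum.inl ()))) := by
  have : ∀ r, clawCircuit.eval z r =
      clawBits (z (Sum.inr (Sum.inr ()))) (z (Sum.inr (Sum.inl ()))) (z (Sum.inl ())) := by
    intro r
    -- The bit `(s₁ ⊕ s₂) ∧ b` acts as a selector: added to `s₂` it gives `x₀`, added to `s₁` it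
    -- gives `z`.
    have h0 : ∀ a b c : Bool, xor a (xor b a && c) = if c then b else a := by decide
    have h1 : ∀ a b c : Bool, xor b (xor b a && c) = if c then a else b := by decide
    funext o
    rcases o with _ | _ | _
    · exact h0 _ _ _
    · exact congrArg (xor · _) (h0 _ _ _)
    · exact h1 _ _ _
  simp [RandCircuit.expect, this]

/-- Decode both messages and compute the claw. -/
def pairDecoder (C : RandCircuit (T ⊕ M) Unit) :
    RandCircuit ((Unit ⊕ (T ⊕ T)) ⊕ (M ⊕ M)) (Fin 1 ⊕ (Fin 1 ⊕ Unit)) :=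
  (RandCircuit.route (O := (T ⊕ M) ⊕ ((T ⊕ M) ⊕ Unit)) <|
    Sum.elim (Sum.elim (Sum.inl ∘ Sum.inr ∘ Sum.inl) (Sum.inr ∘ Sum.inl)) <|
      Sum.elim (Sum.elim (Sum.inl ∘ Sum.inr ∘ Sum.inr) (Sum.inr ∘ Sum.inr))
        (Sum.inl ∘ Sum.inl)).seq <|
  (C.ctx ((T ⊕ M) ⊕ Unit)).seq <|
  (RandCircuit.route (O := (T ⊕ M) ⊕ (Unit ⊕ Unit)) <|
    Sum.elim (Sum.inr ∘ Sum.inl) (Sum.elim Sum.inl (Sum.inr ∘ Sum.inr))).seq <|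
  (C.ctx (Unit ⊕ Unit)).seq clawCircuit

theorem expect_pairDecoder (C : RandCircuit (T ⊕ M) Unit) (b : Bits Unit) (t t' : Bits T)
    (m m' : Bits M) (f : Bits (Fin 1 ⊕ (Fin 1 ⊕ Unit)) → ℝ) :
    (pairDecoder C).expect (Sum.elim (Sum.elim b (Sum.elim t t')) (Sum.elim m m')) f =
      C.expect (Sum.elim t m) fun s => C.expect (Sum.elim t' m') fun s' =>
        f (clawBits (b ()) (s ()) (s' ())) := by
  have h1 : (Sum.elim (Sum.elim b (Sum.elim t t')) (Sum.elim m m') :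
      Bits ((Unit ⊕ (T ⊕ T)) ⊕ (M ⊕ M))) ∘
      Sum.elim (Sum.elim (Sum.inl ∘ Sum.inr ∘ Sum.inl) (Sum.inr ∘ Sum.inl))
        (Sum.elim (Sum.elim (Sum.inl ∘ Sum.inr ∘ Sum.inr) (Sum.inr ∘ Sum.inr))
          (Sum.inl ∘ Sum.inl)) = Sum.elim (Sum.elim t m) (Sum.elim (Sum.elim t' m') b) := by
    funext v
    rcases v with (_ | _) | (_ | _) | _ <;> rfl
  have h2 : ∀ (s : Bits Unit) (u : Bits (T ⊕ M)), (Sum.elim s (Sum.elim u b) :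
      Bits (Unit ⊕ ((T ⊕ M) ⊕ Unit))) ∘
      Sum.elim (Sum.inr ∘ Sum.inl) (Sum.elim Sum.inl (Sum.inr ∘ Sum.inr)) =
      Sum.elim u (Sum.elim s b) := by
    intro s u
    funext v
    rcases v with _ | _ | _ <;> rfl
  simp only [pairDecoder, RandCircuit.expect_seq, RandCircuit.expect_ctx, RandCircuit.expect_route,
    expect_clawCircuit, h1, h2, Sum.elim_comp_inl, Sum.elim_comp_inr, Sum.elim_inr, Sum.elim_inl]

end Sender

/-- The generator whose sender runs the sender of `O` on a random bit and on its negation. -/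
abbrev csgOfOSP (O : TwoRoundOSP) : TwoRoundCSG (fun _ => 1) where
  MsgS := fun l => O.MsgS l ⊕ O.MsgS l
  St := fun l => Unit ⊕ (O.St l ⊕ O.St l)
  MsgR := fun l => O.MsgR l ⊕ O.MsgR l
  fintypeMsgS := fun _ => inferInstance
  decEqMsgS := fun _ => inferInstance
  fintypeSt := fun _ => inferInstance
  decEqSt := fun _ => inferInstance
  fintypeMsgR := fun _ => inferInstance
  decEqMsgR := fun _ => inferInstance
  Sen := fun l => pairSender (O.Sen l)
  Rec := fun l => QCircuit.entanglePair (O.Rec l) (O.Rec l)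
  Dec := fun l => pairDecoder (O.Dec l)

namespace TwoRoundOSP

variable {O : TwoRoundOSP}

theorem polyBounded_card_msgS (hO : O.Efficient) : PolyBounded fun l => Fintype.card (O.MsgS l) :=
  PolyBounded.mono hO.2.1 fun l => by unfold QCircuit.size; omega

theorem polyBounded_card_msgR (hO : O.Efficient) : PolyBounded fun l => Fintype.card (O.MsgR l) :=
  PolyBounded.mono hO.2.2 fun l => by simp only [RandCircuit.size, Fintype.card_sum]; omega

theorem polyBounded_card_st (hO : O.Efficient) : PolyBounded fun l => Fintype.card (O.St l) :=
  PolyBounded.mono hO.2.2 fun l => by simp only [RandCircuit.size, Fintype.card_sum]; omega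

theorem efficient_csgOfOSP (hO : O.Efficient) : (csgOfOSP O).Efficient := by
  have hS := polyBounded_card_msgS hO
  have hM := polyBounded_card_msgR hO
  have hT := polyBounded_card_st hO
  refine ⟨?_, ?_, ?_⟩
  · refine PPT.seq (O := fun _ => Unit ⊕ Unit) (.const _) (PPT.seq (PPT.ctx hO.1 (.const _))
      (PPT.seq (C := fun l => prependNot (O.MsgS l ⊕ O.St l)) ?_ (PPT.seq
        (PPT.ctx hO.1 (J := fun l => (O.MsgS l ⊕ O.St l) ⊕ Unit) ?_) ?_)))
    all_goals
      refine (PolyBounded.add (.add (.mul (.const 5) hS) (.mul (.const 5) hT)) (.const 10)).mono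
        fun l => ?_
      simp only [RandCircuit.size, List.length_cons, List.length_nil, Fintype.card_sum,
        Fintype.card_unit, Fintype.card_empty]
      omega
  · refine (PolyBounded.add (.mul (.const 2) hO.2.1) (.const 3)).mono fun l => ?_
    simp only [csgOfOSP, QCircuit.size, List.length_append, List.length_map, List.length_cons,
      List.length_nil, Fintype.card_sum]
    omega
  · refine PPT.seq ?_ (PPT.seq (PPT.ctx hO.2.2 (J := fun l => (O.St l ⊕ O.MsgR l) ⊕ Unit) ?_)
      (PPT.seq ?_ (PPT.seq (PPT.ctx hO.2.2 (.const _)) (.const _))))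
    all_goals
      refine (PolyBounded.add (.add (.mul (.const 5) hM) (.mul (.const 5) hT)) (.const 10)).mono
        fun l => ?_
      simp only [RandCircuit.size, List.length_nil, Fintype.card_sum,
        Fintype.card_unit, Fintype.card_empty, csgOfOSP]
      omega

/-- The two OSP executions are independent and the overlap is a product, so expectations multiply.
Either value of `b` uses each OSP input once and gives the same product. -/
theorem fidelity_csgOfOSP (l : ℕ) :
    (csgOfOSP O).fidelity l = O.fidelity l false * O.fidelity l true := by
  have hstate : ∀ (x : Bits (O.MsgS l)) (k : ℝ) (F : EuclideanSpace ℂ (Bits Unit) →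
      Bits (O.MsgR l) → ℝ),
      (O.Rec l).expectState x (fun ψ m => k * F ψ m) = k * (O.Rec l).expectState x F :=
    fun x k F => ((O.Rec l).isExp_expectState x).const_mul k fun p => F p.1 p.2
  have hstate' : ∀ (x : Bits (O.MsgS l)) (k : ℝ) (F : EuclideanSpace ℂ (Bits Unit) →
      Bits (O.MsgR l) → ℝ),
      (O.Rec l).expectState x (fun ψ m => F ψ m * k) = (O.Rec l).expectState x F * k :=
    fun x k F => ((O.Rec l).isExp_expectState x).mul_const k fun p => F p.1 p.2
  have h : ∀ b : Bool, (O.Sen l).expect (fun _ => b) (fun y =>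
      (O.Sen l).expect (fun _ => !b) fun y' =>
        (O.Rec l).expectState (y ∘ Sum.inl) fun ψ m =>
          (O.Rec l).expectState (y' ∘ Sum.inl) fun ψ' m' =>
            (O.Dec l).expect (Sum.elim (y ∘ Sum.inr) m) fun s =>
              (O.Dec l).expect (Sum.elim (y' ∘ Sum.inr) m') fun s' =>
                projNorm (ospState b (s ())) ψ * projNorm (ospState (!b) (s' ())) ψ') =
      O.fidelity l b * O.fidelity l !b := by
    intro b
    simp only [((O.Dec l).isExp_expect _).const_mul, ((O.Dec l).isExp_expect _).mul_const,
      hstate, hstate', ((O.Sen l).isExp_expect _).const_mul, ((O.Sen l).isExp_expect _).mul_const]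
    rfl
  have h' : (csgOfOSP O).fidelity l =
      (∑ b : Bool, O.fidelity l b * O.fidelity l !b) / 2 := by
    simp only [← h, ← projNorm_entangle]
    refine (expect_pairSender _ _ _).trans (congrArg (· / 2) ?_)
    refine Finset.sum_congr rfl fun b _ => ?_
    congr 1; funext y; congr 1; funext y'
    refine (QCircuit.expectState_entanglePair _ _ _ _).trans ?_
    congr 1; funext ψ m; congr 1; funext ψ' m'
    exact expect_pairDecoder (O.Dec l) (fun _ => b) _ _ m m' _
  rw [h', Fintype.sum_bool, Bool.not_true, Bool.not_false]
  ring

theorem correct_csgOfOSP (hO : O.Correct) : (csgOfOSP O).Correct := by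
  -- With errors `ε` and `δ`, `1 - (1 - ε)(1 - δ) = ε + δ - ε δ`.
  refine (((hO false).add (hO true)).sub ((hO false).mul (hO true))).of_abs_le
    fun l => le_of_eq (congrArg _ ?_)
  rw [fidelity_csgOfOSP]
  ring

/-! ### Security -/

/-- The probability that an adversary against `csgOfOSP O` outputs the bit 0 when the inputs of the
sender of `O` are `b` and `b'`. -/
def pairProb (O : TwoRoundOSP)
    (A : ∀ l, QCircuit (O.MsgS l ⊕ O.MsgS l) ((O.MsgR l ⊕ O.MsgR l) ⊕ Unit)) (l : ℕ)
    (b b' : Bool) : ℝ :=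
  (O.Sen l).expect (fun _ => b) fun y => (O.Sen l).expect (fun _ => b') fun y' =>
    (A l).expect (Sum.elim (y ∘ Sum.inl) (y' ∘ Sum.inl)) fun a => ind (a (Sum.inr ()) = false)

theorem advProb_csgOfOSP
    (A : ∀ l, QCircuit (O.MsgS l ⊕ O.MsgS l) ((O.MsgR l ⊕ O.MsgR l) ⊕ Unit)) (l : ℕ) (i : Fin 1) :
    (csgOfOSP O).advProb A l i - 1 / 2 =
      (O.pairProb A l false true - O.pairProb A l true false) / 2 := by
  -- Whatever is decoded, even from a malicious message, the target bit is the sender's `b`; hence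
  -- the decoder drops out of the security game.
  have hx : ∀ b s s' : Bool, xor (clawX₀ (clawBits b s s') i) (clawX₁ (clawBits b s s') i) = b := by
    intro b s s'; cases b <;> cases s <;> cases s' <;> rfl
  have h2 : (csgOfOSP O).advProb A l i = (∑ b : Bool, (O.Sen l).expect (fun _ => b) fun y =>
      (O.Sen l).expect (fun _ => !b) fun y' =>
        (A l).expect (Sum.elim (y ∘ Sum.inl) (y' ∘ Sum.inl)) fun a =>
          ind (a (Sum.inr ()) = b)) / 2 := by
    refine (expect_pairSender _ _ _).trans (congrArg (· / 2) ?_)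
    refine Finset.sum_congr rfl fun b _ => ?_
    congr 1; funext y; congr 1; funext y'
    change (A l).expect _ _ = _
    congr 1; funext a
    have h3 := expect_pairDecoder (O.Dec l) (fun _ => b) (y ∘ Sum.inr) (y' ∘ Sum.inr)
      (a ∘ Sum.inl ∘ Sum.inl) (a ∘ Sum.inl ∘ Sum.inr)
      fun d => ind (a (Sum.inr ()) = xor (clawX₀ d i) (clawX₁ d i))
    simp only [hx, ((O.Dec l).isExp_expect _).const] at h3
    refine Eq.trans (congrArg (fun z => (pairDecoder (O.Dec l)).expect (Sum.elim _ z) _) ?_) h3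
    funext v
    rcases v with _ | _ <;> rfl
  have h3 : ∀ z, (A l).expect z (fun a => ind (a (Sum.inr ()) = true)) =
      1 - (A l).expect z (fun a => ind (a (Sum.inr ()) = false)) := by
    intro z
    have hE := (A l).isExp_expect z
    rw [← hE.const 1, ← hE.sub]
    congr 1
    funext a
    cases a (Sum.inr ()) <;> simp [ind]
  rw [h2, Fintype.sum_bool, Bool.not_true, Bool.not_false]
  simp only [h3, ((O.Sen l).isExp_expect _).sub, ((O.Sen l).isExp_expect _).const, pairProb]
  ring

/-! ### The hybrid argument for the sender's bit -/

section Hybrid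

variable {S T M : Type} [Fintype S] [DecidableEq S] [Fintype T] [DecidableEq T] [Fintype M]
  [DecidableEq M]

/-- Prepend a zero bit. -/
abbrev prependZero (S : Type) : RandCircuit S (Unit ⊕ S) where
  Rnd := Empty
  Aux := Unit
  gates := []
  out := Sum.elim (Sum.inr ∘ Sum.inr) Sum.inl

omit [Fintype S] in
theorem expect_prependZero (z : Bits S) (f : Bits (Unit ⊕ S) → ℝ) :
    (prependZero S).expect z f = f (Sum.elim (fun _ => false) z) := by
  have : ∀ r, (prependZero S).eval z r = Sum.elim (fun _ => false) z := by
    intro r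
    funext o
    rcases o with _ | _ <;> rfl
  simp [RandCircuit.expect, this]

/-- Run `C` on the bit 0 to generate a second message, run `A` on both messages arranged by `e`, and
discard the second answer. -/
def hybridAdversary (C : RandCircuit Unit (S ⊕ T)) (e : S ⊕ S → (S ⊕ T) ⊕ S)
    (A : QCircuit (S ⊕ S) ((M ⊕ M) ⊕ Unit)) : QCircuit S (M ⊕ Unit) :=
  (QCircuit.ofRand (prependZero S)).seq <| ((QCircuit.ofRand C).ctx S).seq <|
    (QCircuit.route e).seq <| A.seq <| QCircuit.route (Sum.map Sum.inl id)

theorem expect_hybridAdversary (C : RandCircuit Unit (S ⊕ T)) (e : S ⊕ S → (S ⊕ T) ⊕ S)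
    (A : QCircuit (S ⊕ S) ((M ⊕ M) ⊕ Unit)) (x : Bits S) (f : Bits (M ⊕ Unit) → ℝ) :
    (hybridAdversary C e A).expect x f = C.expect (fun _ => false) fun y =>
      A.expect (Sum.elim y x ∘ e) fun a => f (a ∘ Sum.map Sum.inl id) := by
  simp only [hybridAdversary, QCircuit.expect_seq, QCircuit.expect_ctx, QCircuit.expect_ofRand,
    QCircuit.expect_route, expect_prependZero, Sum.elim_comp_inl, Sum.elim_comp_inr]

end Hybrid

theorem qpt_hybridAdversary (hO : O.Efficient)
    {A : ∀ l, QCircuit (O.MsgS l ⊕ O.MsgS l) ((O.MsgR l ⊕ O.MsgR l) ⊕ Unit)} (hA : QPT A)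
    (e : ∀ l, O.MsgS l ⊕ O.MsgS l → (O.MsgS l ⊕ O.St l) ⊕ O.MsgS l) :
    QPT fun l => hybridAdversary (O.Sen l) (e l) (A l) := by
  have hS := polyBounded_card_msgS hO
  have hM := polyBounded_card_msgR hO
  have hT := polyBounded_card_st hO
  refine QPT.seq (PPT.ofRand ?_) (QPT.seq (QPT.ctx (PPT.ofRand hO.1) hS)
    (QPT.seq ?_ (QPT.seq hA ?_)))
  all_goals
    refine (PolyBounded.add (.add (.add (.mul (.const 10) hM) (.mul (.const 10) hT))
      (.mul (.const 10) hS)) (.const 10)).mono fun l => ?_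
    simp only [RandCircuit.size, QCircuit.size, List.length_nil, List.length_map,
      Finset.length_toList, Finset.card_univ, Fintype.card_sum, Fintype.card_unit,
      Fintype.card_empty]
    omega

/-- The input pairs `(0, 1)` and `(1, 0)` are each compared with `(0, 0)`. Each comparison changes a
single OSP input, and the message for the fixed input 0 can be generated by the reduction itself. -/
theorem indSecure_csgOfOSP (hE : O.Efficient) (hO : O.Secure) : (csgOfOSP O).IndSecure := by
  intro (A : ∀ l, QCircuit (O.MsgS l ⊕ O.MsgS l) ((O.MsgR l ⊕ O.MsgR l) ⊕ Unit)) hA i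
  have h1 := hO _ (qpt_hybridAdversary hE hA fun l => Sum.elim Sum.inr (Sum.inl ∘ Sum.inl))
  have h2 := hO _ (qpt_hybridAdversary hE hA fun l => Sum.elim (Sum.inl ∘ Sum.inl) Sum.inr)
  have h3 : ∀ l b, O.advProb (fun l => hybridAdversary (O.Sen l)
      (Sum.elim Sum.inr (Sum.inl ∘ Sum.inl)) (A l)) l b = O.pairProb A l b false := by
    intro l b
    simp only [advProb, expect_hybridAdversary, pairProb, Sum.comp_elim, Sum.elim_comp_inr,
      ← Function.comp_assoc, Sum.elim_comp_inl]
    rfl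
  have h4 : ∀ l b, O.advProb (fun l => hybridAdversary (O.Sen l)
      (Sum.elim (Sum.inl ∘ Sum.inl) Sum.inr) (A l)) l b = O.pairProb A l false b := by
    intro l b
    simp only [advProb, expect_hybridAdversary, pairProb, Sum.comp_elim, Sum.elim_comp_inr,
      ← Function.comp_assoc, Sum.elim_comp_inl]
    -- Here the challenge message is the second one, whereas the OSP game samples it before the
    -- self-generated message.
    exact ((O.Sen l).isExp_expect _).comm ((O.Sen l).isExp_expect _) _
  simp only [h3] at h1
  simp only [h4] at h2
  refine (((h1.of_abs.sub h2.of_abs).const_mul (1 / 2)).abs).of_abs_le fun l =>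
    le_of_eq (congrArg _ (congrArg _ ?_))
  rw [advProb_csgOfOSP]
  ring

end TwoRoundOSP

end OSPPKE
end

theorem mainTheorem9 :
    -- the scheme built from a two-round claw-state generator is a CPA-secure encryption scheme
    (∀ P : OSPPKE.TwoRoundCSG (fun _ => 1), P.Efficient → P.Correct → P.IndSecure →
      (OSPPKE.pkeOfCSG P).IsCPASecurePKE) ∧
    -- predicting `x_b` reduces to predicting `x₀ ⊕ x₁`
    (∀ P : OSPPKE.TwoRoundCSG (fun _ => 1), P.Efficient → P.Correct →
      ∀ A : (∀ l, OSPPKE.QCircuit (P.MsgS l ⊕ (P.MsgR l ⊕ Unit)) Unit), OSPPKE.QPT A →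
        ∃ B : (∀ l, OSPPKE.QCircuit (P.MsgS l) (P.MsgR l ⊕ Unit)), OSPPKE.QPT B ∧
          OSPPKE.Negligible (fun l =>
            (P.advProb B l 0 - 1 / 2) - (P.predictProb A l - 1 / 2) / 2)) ∧
    -- two-round oblivious state preparation suffices
    (∀ O : OSPPKE.TwoRoundOSP, O.Efficient → O.Correct → O.Secure →
      ∃ P : OSPPKE.TwoRoundCSG (fun _ => 1), P.Efficient ∧ P.Correct ∧ P.IndSecure ∧
        (OSPPKE.pkeOfCSG P).IsCPASecurePKE) := by
  refine ⟨fun P hE hC hS => P.isCPASecurePKE_pkeOfCSG hE hC hS, fun P hE hC A hA =>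
    ⟨_, OSPPKE.qpt_xorAdversary hE hA, P.negligible_advProb_xorAdversary hC A⟩, fun O hE hC hS => ?_⟩
  have h1 := OSPPKE.TwoRoundOSP.efficient_csgOfOSP hE
  have h2 := OSPPKE.TwoRoundOSP.correct_csgOfOSP hC
  have h3 := OSPPKE.TwoRoundOSP.indSecure_csgOfOSP hE hS
  exact ⟨_, h1, h2, h3, OSPPKE.TwoRoundCSG.isCPASecurePKE_pkeOfCSG h1 h2 h3⟩
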